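/- **Setting.** Let $N$ and $M$ be odd with $M\ge 3$ and let $m=(M-1)/2$. In Herman's protocol, $N$ processors $1,\dots,N$ are arranged clockwise in a ring, and each may hold a token. Initially exactly the processors $z(1)<\dots<z(M)$ in $\{1,\dots,N\}$ have a token. In the *synchronous* variant with parameter $r\in(0,1)$, in each time step every processor that has a token, independently of the others, passes it to its clockwise neighbour with probability $r$ and keeps it with probability $1-r$; a kept and a received token at the same processor annihilate each other. In the *asynchronous* variant with parameter $\lambda>0$ (a continuous-time Markov chain), each processor with a token passes it to its clockwise neighbour with rate $\lambda$; if that neighbour has a token, both tokens are annihilated. Let $\mathbf T$ be the time until only one token is left. **Collision times.** Consider also a system of $M$ tokens started at $z(1),\dots,z(M)$ that move independently of each other by the same rule (each is passed with probability $r$ in each time step, respectively with rate $\lambda$), without annihilation. Let $d_u(t)$ be the distance travelled clockwise by token $u$ up to time $t$. For $u<v$, the tokens $u$ and $v$ meet *down* at time $t$ if $z(u)+d_u(t)=z(v)+d_v(t)$, and *up* if $z(u)+d_u(t)+N=z(v)+d_v(t)$. Let $T_{uv}$ be the first time at which $u$ and $v$ meet, and, for $\delta\in\{\downarrow,\uparrow\}$,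 let $A_{uv\delta}$ be the event that $u$ and $v$ eventually meet and that their first meeting is down (if $\delta={\downarrow}$), respectively up (if $\delta={\uparrow}$). **Pairings.** A *pairing* is a set $w=\{(u_1,v_1),\dots,(u_m,v_m)\}$ with $1\le u_i<v_i\le M$ such that $\{u_1,v_1,\dots,u_m,v_m,w_0\}=\{1,\dots,M\}$ for some $w_0$. Let $s(w)=1$ if the permutation $(u_1v_1\cdots u_mv_mw_0)$ of $1,\dots,M$ (in one-line notation) is even, and $s(w)=-1$ otherwise; this does not depend on the order of the pairs. A *directed pairing* is a set $\vec w=\{(u_1,v_1,\delta_1),\dots,(u_m,v_m,\delta_m)\}$ with $\delta_i\in\{\downarrow,\uparrow\}$ such that $w=\{(u_1,v_1),\dots,(u_m,v_m)\}$ is a pairing. Put $\vec s(\vec w)=s(w)\cdot(-1)^{|\{i:\delta_i=\uparrow\}|}$, $A_{\vec w}=\bigcap_{i=1}^m A_{u_iv_i\delta_i}$ and $T_{\vec w}=\max_{1\le i\le m}T_{u_iv_i}$. Let $\vec W_M$ be the set of all directed pairings. **Theorem.** In the synchronous variant for every $r\in(0,1)$, and in the asynchronous variant for every $\lambda>0$,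 the expectation $\mathbb E\,\mathbf T$ is finite, for each $\vec w\in\vec W_M$ we have $\mathbb P(A_{\vec w})>0$ and $\mathbb E[T_{\vec w}\mid A_{\vec w}]<\infty$, and $$\mathbb E\,\mathbf T=\sum_{\vec w\in\vec W_M}\vec s(\vec w)\cdot\mathbb E[\,T_{\vec w}\mid A_{\vec w}\,]\cdot\mathbb P(A_{\vec w}).$$ -/

import Mathlib

open MeasureTheory ProbabilityTheory
open scoped NNReal ENNReal BigOperators

noncomputable section

namespace Herman

/-! ## Markov chains in discrete and in continuous time -/

/-- `X` is a time-homogeneous Markov chain in discrete time with transition probabilities `p`,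
started in the state `x₀`. The state space is meant to be countable and discrete. -/
structure IsMarkovChain {S Ω : Type*} [MeasurableSpace Ω] (p : S → S → ℝ) (x₀ : S)
    (P : Measure Ω) (X : ℕ → Ω → S) : Prop where
  measurable : ∀ n x, MeasurableSet {ω | X n ω = x}
  start : P {ω | X 0 ω = x₀} = 1
  law : ∀ (n : ℕ) (x : ℕ → S), x 0 = x₀ →
    P {ω | ∀ k ≤ n, X k ω = x k} =
      ENNReal.ofReal (∏ k ∈ Finset.range n, p (x k) (x (k + 1)))

/-- The total rate of leaving `x`, if `q x y` is the rate of jumping from `x` to `y`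
(with `q x x = 0`). -/
def exitRate {S : Type*} (q : S → S → ℝ) (x : S) : ℝ := ∑' y, q x y

/-- `X` is a continuous-time Markov chain with jump rates `q` (and no absorbing states), started in
the state `x₀`: it visits successively the states `Y 0, Y 1, …` and stays in `Y k` for the time
`H k`, where `Y` is the Markov chain with transition probabilities `q x y / exitRate q x`, and,
given `Y`, the holding times are independent and `H k` is exponentially distributed with
parameter `exitRate q (Y k)`. -/
def IsJumpProcess {S Ω : Type*} [MeasurableSpace Ω] (q : S → S → ℝ) (x₀ : S)
    (P : Measure Ω) (X : ℝ≥0 → Ω → S) : Prop :=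
  ∃ (Y : ℕ → Ω → S) (H : ℕ → Ω → ℝ≥0),
    (∀ n x, MeasurableSet {ω | Y n ω = x}) ∧
    (∀ n, Measurable (H n)) ∧
    P {ω | Y 0 ω = x₀} = 1 ∧
    (∀ (n : ℕ) (x : ℕ → S) (t : ℕ → ℝ≥0), x 0 = x₀ →
      P {ω | (∀ k ≤ n, Y k ω = x k) ∧ ∀ k < n, t k < H k ω} =
        ENNReal.ofReal (∏ k ∈ Finset.range n,
          (q (x k) (x (k + 1)) / exitRate q (x k)) * Real.exp (-(exitRate q (x k) * t k)))) ∧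
    ∀ᵐ ω ∂P, ∀ (n : ℕ) (t : ℝ≥0),
      ∑ k ∈ Finset.range n, H k ω ≤ t → t < ∑ k ∈ Finset.range (n + 1), H k ω → X t ω = Y n ω

/-! ## Herman's protocol -/

/-- A configuration of the ring of `N` processors: the set of the processors that have a token.
The clockwise neighbour of the processor `p` is `p + 1`. -/
abbrev Config (N : ℕ) := Finset (ZMod N)

/-- The configuration that arises from `c` if the processors in `A ⊆ c` pass their tokens to their
clockwise neighbours and the others keep theirs. A kept and a received token annihilate. -/
def pass {N : ℕ} (c A : Config N) : Config N :=
  symmDiff (c \ A) (A.image (· + 1))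

/-- Synchronous protocol: in a time step each token is passed with probability `r` and kept with
probability `1 - r`, independently of the others. -/
def syncProb (N : ℕ) (r : ℝ) (c c' : Config N) : ℝ :=
  ∑ A ∈ c.powerset, if pass c A = c' then r ^ A.card * (1 - r) ^ (c \ A).card else 0

/-- Asynchronous protocol: each processor with a token passes it with rate `lam`. -/
def asyncRate (N : ℕ) (lam : ℝ) (c c' : Config N) : ℝ :=
  ∑ p ∈ c, if pass c {p} = c' then lam else 0

/-- The configuration with tokens exactly at the positions `z i`. -/
def initialConfig (N : ℕ) {M : ℕ} (z : Fin M → ℕ) : Config N :=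
  Finset.univ.image fun i => (z i : ZMod N)

/-- The time (as an extended nonnegative real number, `∞` if it never happens) until only one token
is left. Here `time` is the embedding of the time axis `𝕋`, which is `ℕ` or `ℝ≥0`. -/
def stabilizationTime {N : ℕ} {𝕋 Ω : Type*} (time : 𝕋 → ℝ≥0∞) (X : 𝕋 → Ω → Config N)
    (ω : Ω) : ℝ≥0∞ :=
  ⨅ (t : 𝕋) (_ : (X t ω).card = 1), time t

/-! ## Tokens that do not interact

The state is the vector of the distances travelled clockwise by the tokens. -/

/-- Synchronous movement of `M` independent tokens. -/
def freeSyncProb (M : ℕ) (r : ℝ) (d d' : Fin M → ℕ) : ℝ :=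
  ∏ i, if d' i = d i + 1 then r else if d' i = d i then 1 - r else 0

/-- Asynchronous movement of `M` independent tokens: each moves by one with rate `lam`. -/
def freeAsyncRate (M : ℕ) (lam : ℝ) (d d' : Fin M → ℕ) : ℝ :=
  ∑ i, if d' = d + Pi.single i 1 then lam else 0

/-- The direction of a collision. -/
inductive Dir where
  | down
  | up
  deriving DecidableEq

instance : Fintype Dir where
  elems := {Dir.down, Dir.up}
  complete := by intro x; cases x <;> simp

/-- The tokens `u < v` started at `z u < z v` on a ring of `N` processors meet in the direction
`δ` when the tokens have travelled the distances `d`: `u` has caught up with `v` (down), or `v`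
has caught up with `u` (up). -/
def Meet (N : ℕ) {M : ℕ} (z : Fin M → ℕ) (u v : Fin M) (δ : Dir) (d : Fin M → ℕ) : Prop :=
  match δ with
  | .down => z u + d u = z v + d v
  | .up => z u + d u + N = z v + d v

/-- The time of the first collision of `u` and `v`, whatever the other tokens do. -/
def collisionTime (N : ℕ) {M : ℕ} {𝕋 Ω : Type*} (time : 𝕋 → ℝ≥0∞) (z : Fin M → ℕ)
    (D : 𝕋 → Ω → Fin M → ℕ) (u v : Fin M) (ω : Ω) : ℝ≥0∞ :=
  ⨅ (t : 𝕋) (_ : ∃ δ, Meet N z u v δ (D t ω)), time t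

/-- The event that `u` and `v` eventually collide and their first collision has direction `δ`. -/
def collisionEvent (N : ℕ) {M : ℕ} {𝕋 Ω : Type*} [LT 𝕋] (z : Fin M → ℕ)
    (D : 𝕋 → Ω → Fin M → ℕ) (u v : Fin M) (δ : Dir) : Set Ω :=
  {ω | ∃ t, Meet N z u v δ (D t ω) ∧ ∀ s < t, ∀ δ', ¬ Meet N z u v δ' (D s ω)}

/-! ## Pairings -/

/-- `w` is a set of `(M - 1) / 2` pairs `(u, v)` with `u < v` that together with one further
element `w₀` exhaust all `M` tokens. -/
def IsPairing {M : ℕ} (w : Finset (Fin M × Fin M)) : Prop :=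
  w.card = (M - 1) / 2 ∧ (∀ e ∈ w, e.1 < e.2) ∧
    ∃ w₀ : Fin M, ∀ x, x = w₀ ∨ ∃ e ∈ w, x = e.1 ∨ x = e.2

/-- The permutation `σ`, written as the word `σ 0, σ 1, …, σ (M - 1)`, is
`u₁ v₁ u₂ v₂ ⋯ u_m v_m w₀` for an enumeration `(u₁, v₁), …, (u_m, v_m)` of `w`. -/
def IsListing {M : ℕ} (σ : Equiv.Perm (Fin M)) (w : Finset (Fin M × Fin M)) : Prop :=
  ∀ u v : Fin M, (u, v) ∈ w ↔
    ∃ i j : Fin M, Even (i : ℕ) ∧ (j : ℕ) = i + 1 ∧ σ i = u ∧ σ j = v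

open Classical in
/-- The sign of the pairing `w`: the sign of the permutation `u₁ v₁ ⋯ u_m v_m w₀`, which does not
depend on the enumeration of `w`. -/
def pairingSign {M : ℕ} (w : Finset (Fin M × Fin M)) : ℝ :=
  if ∃ σ : Equiv.Perm (Fin M), IsListing σ w ∧ Equiv.Perm.sign σ = 1 then 1 else -1

/-- The pairs of a set of directed pairs. -/
def undirected {M : ℕ} (w : Finset (Fin M × Fin M × Dir)) : Finset (Fin M × Fin M) :=
  w.image fun e => (e.1, e.2.1)

open Classical in
/-- The set of all directed pairings: pairings with a direction attached to each pair. -/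
def directedPairings (M : ℕ) : Finset (Finset (Fin M × Fin M × Dir)) :=
  Finset.univ.filter fun w => w.card = (M - 1) / 2 ∧ IsPairing (undirected w)

/-- The sign of a directed pairing. -/
def directedSign {M : ℕ} (w : Finset (Fin M × Fin M × Dir)) : ℝ :=
  pairingSign (undirected w) * (-1) ^ (w.filter fun e => e.2.2 = Dir.up).card

/-- The maximum of the collision times of the pairs in `w`. -/
def maxCollisionTime (N : ℕ) {M : ℕ} {𝕋 Ω : Type*} (time : 𝕋 → ℝ≥0∞) (z : Fin M → ℕ)
    (D : 𝕋 → Ω → Fin M → ℕ) (w : Finset (Fin M × Fin M × Dir)) (ω : Ω) : ℝ≥0∞ :=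
  w.sup fun e => collisionTime N time z D e.1 e.2.1 ω

/-- The event that all pairs in `w` collide in the prescribed directions. -/
def allCollide (N : ℕ) {M : ℕ} {𝕋 Ω : Type*} [LT 𝕋] (z : Fin M → ℕ)
    (D : 𝕋 → Ω → Fin M → ℕ) (w : Finset (Fin M × Fin M × Dir)) : Set Ω :=
  ⋂ e ∈ w, collisionEvent N z D e.1 e.2.1 e.2.2

/-! ## Expectations of times -/

/-- `f` is a random variable with finite expectation. -/
def FiniteMean {Ω : Type*} [MeasurableSpace Ω] (P : Measure Ω) (f : Ω → ℝ≥0∞) : Prop :=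
  AEMeasurable f P ∧ ∫⁻ ω, f ω ∂P ≠ ∞

/-- The expectation of `f`, if it is finite. -/
def mean {Ω : Type*} [MeasurableSpace Ω] (P : Measure Ω) (f : Ω → ℝ≥0∞) : ℝ :=
  (∫⁻ ω, f ω ∂P).toReal

/-- The expression of the expected stabilization time of the protocol `X` through the collision
times of pairs in the system `D` of non-interacting tokens. The first two parts say that all
expectations and conditional expectations involved exist. -/
def ExpectedTimeFormula (N : ℕ) {M : ℕ} {𝕋 Ω Ω' : Type*} [LT 𝕋] [MeasurableSpace Ω]
    [MeasurableSpace Ω'] (time : 𝕋 → ℝ≥0∞) (z : Fin M → ℕ) (P : Measure Ω)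
    (X : 𝕋 → Ω → Config N) (P' : Measure Ω') (D : 𝕋 → Ω' → Fin M → ℕ) : Prop :=
  FiniteMean P (stabilizationTime time X) ∧
  (∀ w ∈ directedPairings M,
    NullMeasurableSet (allCollide N z D w) P' ∧ P' (allCollide N z D w) ≠ 0 ∧
    FiniteMean (P'[|allCollide N z D w]) (maxCollisionTime N time z D w)) ∧
  mean P (stabilizationTime time X) =
    ∑ w ∈ directedPairings M,
      directedSign w * mean (P'[|allCollide N z D w]) (maxCollisionTime N time z D w) *
        P'.real (allCollide N z D w)

end Herman

end

/-! Let S(k) be the probability that after k steps a single token is left, and let q_w(k) be the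
probability that non-interacting tokens have made all the collisions prescribed by the directed
pairing w by step k. The heart of the proof is the identity S(k) = Σ_w s(w) q_w(k),
`singleProb_eq_sum`. Replacing pairings by their listings turns its right side, up to the factor 2^m
m!, into a Pfaffian-like sum over permutations, `pfaffianSum`. Each term is the sign of the
permutation times the expected product, over the pairs, of 1 (collided down), -1 (collided up) or 0
(not yet collided).

The identity is proved by induction on k for positions that are only weakly ordered
(`singleFormula`). If the order is strict, no pair has collided, both sides satisfy the same
one-step recursion, and one step leaves the tokens weakly ordered. If two tokens coincide,
exchanging their labels flips the sign of a listing and changes nothing else, unless the two are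
paired with each other. So only listings that pair them survive; there the pair has collided and can
be dropped, just as the annihilating system drops both tokens (`pfaffianSum_reduce`,
`oddConfig_reduce`). A coincidence elsewhere on the ring is brought to the front by cyclic
renumbering, an even permutation because the number of tokens is odd (`pfaffianSum_rotate`).

Of the movement, this uses only that the weight of a set of moving tokens depends on its size alone
and that the weights for fewer tokens are marginals (`Consistent`). Bernoulli weights give the
synchronous protocol; at most one move per step, uniformized to the total rate of M tokens, gives
the asynchronous one.

As k grows, the Lyapunov function x(N - x) shows that the expected number of steps with undecided
pairs is finite (`summable_pending`), so q_w(k) increases to a limit κ_w with summable error. A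
minimum principle gives S(k) → 1 (`tendsto_singleProb`). Subtracting, 1 - S(k) = Σ_w s(w) (κ_w -
q_w(k)), and summation over k gives the formula in units of steps (`tsum_one_sub_singleProb`).

Holding times enter only through their means given the path. `lintegral_stabilizationTime`
identifies the expected stabilization time with a solution of the first-step equation, and
`lintegral_maxCollisionTime` computes the integral of the maximal collision time over the event of
w. In the asynchronous protocol the exit rate depends on the number of tokens left;
`ofReal_stepValue_async` shows that the uniformized step count, times 1/(Mλ), still solves the
equation for the true rates. -/

open Filter Topology

/-! ### Consistent weights and the transition operator of stopped differences -/

namespace Herman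

/-- `φ n k` is the weight with which exactly the members of a given set of `k` out of `n` tokens
move; the weights for `n` tokens are the marginals of those for `n + 1` tokens. -/
def Consistent (φ : ℕ → ℕ → ℝ) : Prop := ∀ n k, φ n k = φ (n + 1) k + φ (n + 1) (k + 1)

/-- The tokens in `t` are integrated out one at a time: for each of them the weights with and
without its move add up by consistency. -/
theorem Consistent.sum_powerset_union {φ : ℕ → ℕ → ℝ} (hφ : Consistent φ) {L : Type*}
    [DecidableEq L] (s t : Finset L) (hst : Disjoint s t) (g : Finset L → ℝ) :
    ∑ A ∈ (s ∪ t).powerset, φ (s.card + t.card) A.card * g (A ∩ s) =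
      ∑ B ∈ s.powerset, φ s.card B.card * g B := by
  induction t using Finset.induction_on with
  | empty =>
    simp only [Finset.union_empty, Finset.card_empty, add_zero]
    refine Finset.sum_congr rfl fun A hA => ?_
    rw [Finset.inter_eq_left.2 (Finset.mem_powerset.1 hA)]
  | insert a t ha ih =>
    rw [Finset.disjoint_insert_right] at hst
    have hau : a ∉ s ∪ t := by simp [hst.1, ha]
    rw [Finset.union_insert, Finset.sum_powerset_insert hau, ← ih hst.2, ← Finset.sum_add_distrib]
    refine Finset.sum_congr rfl fun A hA => ?_
    have haA : a ∉ A := fun h => hau (Finset.mem_powerset.1 hA h)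
    rw [Finset.card_insert_of_notMem haA, Finset.card_insert_of_notMem ha,
      Finset.insert_inter_of_notMem hst.1, hφ (s.card + t.card) A.card, ← add_assoc]
    ring

theorem sum_powerset_map_univ {L L' : Type*} [Fintype L'] [DecidableEq L] (f : L' ↪ L)
    (g : Finset L → ℝ) :
    ∑ A ∈ (Finset.univ.map f).powerset, g A = ∑ B : Finset L', g (B.map f) := by
  have h2 : (Finset.univ.map f).powerset =
      (Finset.univ : Finset (Finset L')).map (Finset.mapEmbedding f).toEmbedding := by
    ext A
    simp only [Finset.mem_powerset, Finset.mem_map, Finset.mem_univ, true_and]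
    constructor
    · intro hA
      obtain ⟨B, -, hB⟩ := Finset.subset_map_iff.1 hA
      exact ⟨B, by simpa [Finset.mapEmbedding_apply] using hB.symm⟩
    · rintro ⟨B, rfl⟩
      exact Finset.map_subset_map.2 (Finset.subset_univ B)
  rw [h2, Finset.sum_map]
  rfl

/-- The law of the set of moving tokens among the tokens in the range of `f`. -/
theorem Consistent.sum_preimage {φ : ℕ → ℕ → ℝ} (hφ : Consistent φ) {L L' : Type*}
    [Fintype L] [Fintype L'] [DecidableEq L] [DecidableEq L'] (f : L' ↪ L)
    (g : Finset L' → ℝ) :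
    ∑ A : Finset L, φ (Fintype.card L) A.card * g (Finset.univ.filter fun i => f i ∈ A) =
      ∑ B : Finset L', φ (Fintype.card L') B.card * g B := by
  have h := hφ.sum_powerset_union (Finset.univ.map f) (Finset.univ.map f)ᶜ disjoint_compl_right
    (fun A => g (Finset.univ.filter fun i => f i ∈ A))
  rw [Finset.union_compl, Finset.card_add_card_compl, Finset.powerset_univ] at h
  have h1 : ∀ A : Finset L, (Finset.univ.filter fun i => f i ∈ A ∩ Finset.univ.map f) =
      Finset.univ.filter fun i => f i ∈ A := by intro A; ext i; simp
  simp only [h1] at h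
  rw [h, sum_powerset_map_univ]
  refine Finset.sum_congr rfl fun B _ => ?_
  simp

/-- The total mass is the marginal on the empty set of tokens. -/
theorem Consistent.sum_weights {φ : ℕ → ℕ → ℝ} (hφ : Consistent φ) (h0 : φ 0 0 = 1)
    (L : Type*) [Fintype L] [DecidableEq L] :
    ∑ A : Finset L, φ (Fintype.card L) A.card = 1 := by
  have h := hφ.sum_preimage (L := L) (Function.Embedding.ofIsEmpty : Empty ↪ L) (fun _ => 1)
  simpa [Finset.univ_unique, show (default : Finset Empty) = ∅ from rfl, h0] using h

variable {ι ι' L L' : Type*} [Fintype L] [Fintype L'] [DecidableEq L] [DecidableEq L']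

/-- The change of the differences `x i` between the tokens `v i` and `u i` if the tokens in `A`
move; a difference that has reached `0` or `N` is not changed any more. -/
def stoppedStep (N : ℕ) (u v : ι → L) (x : ι → ℤ) (A : Finset L) : ι → ℤ := fun i =>
  if x i = 0 ∨ x i = N then x i
  else x i + (if v i ∈ A then 1 else 0) - (if u i ∈ A then 1 else 0)

/-- The transition operator of the stopped differences. -/
noncomputable def stepOp (φ : ℕ → ℕ → ℝ) (N : ℕ) (u v : ι → L) (f : (ι → ℤ) → ℝ) (x : ι → ℤ) : ℝ :=
  ∑ A : Finset L, φ (Fintype.card L) A.card * f (stoppedStep N u v x A)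

theorem iterate_stepOp_succ (φ : ℕ → ℕ → ℝ) (N : ℕ) (u v : ι → L) (f : (ι → ℤ) → ℝ) (k : ℕ)
    (x : ι → ℤ) : (stepOp φ N u v)^[k + 1] f x =
      ∑ A : Finset L, φ (Fintype.card L) A.card *
        (stepOp φ N u v)^[k] f (stoppedStep N u v x A) := by
  rw [Function.iterate_succ_apply']
  rfl

/-- Differences that are stopped from the beginning, and tokens that do not occur in the other
differences, can be left out. -/
theorem iterate_stepOp_comap {φ : ℕ → ℕ → ℝ} (hφ : Consistent φ) (N : ℕ) {u v : ι → L}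
    {u' v' : ι' → L'} (F : L' ↪ L) (j : ι' → ι) (hu : ∀ i, F (u' i) = u (j i))
    (hv : ∀ i, F (v' i) = v (j i)) (y : ι → ℤ)
    (hy : ∀ i, i ∉ Set.range j → y i = 0 ∨ y i = N) (c : ℝ) {f : (ι → ℤ) → ℝ}
    {f' : (ι' → ℤ) → ℝ}
    (hf : ∀ x, (∀ i, i ∉ Set.range j → x i = y i) → f x = c * f' (x ∘ j)) (k : ℕ) (x : ι → ℤ)
    (hx : ∀ i, i ∉ Set.range j → x i = y i) :
    (stepOp φ N u v)^[k] f x = c * (stepOp φ N u' v')^[k] f' (x ∘ j) := by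
  induction k generalizing x with
  | zero => exact hf x hx
  | succ k ih =>
    -- The remaining differences see only which tokens in the range of `F` move, and by consistency
    -- this set has the law of a system consisting of `L'` alone.
    rw [iterate_stepOp_succ, iterate_stepOp_succ, Finset.mul_sum, ← Finset.mul_sum,
      ← hφ.sum_preimage F, Finset.mul_sum]
    refine Finset.sum_congr rfl fun A _ => ?_
    rw [ih]
    · have : stoppedStep N u v x A ∘ j =
          stoppedStep N u' v' (x ∘ j) (Finset.univ.filter fun i => F i ∈ A) := by
        ext i
        simp [stoppedStep, hu, hv]
      rw [this]; ring
    · intro i hi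
      have h1 := hy i hi
      rw [← hx i hi] at h1
      rw [stoppedStep, if_pos h1, hx i hi]

/-- Reflection of one difference. -/
theorem iterate_stepOp_reflect (φ : ℕ → ℕ → ℝ) (N : ℕ) [DecidableEq ι] {u v : ι → L} (i₀ : ι)
    (hne : u i₀ ≠ v i₀) (hi : ∀ i, i ≠ i₀ → u i ≠ u i₀ ∧ u i ≠ v i₀ ∧ v i ≠ u i₀ ∧ v i ≠ v i₀)
    {f : (ι → ℤ) → ℝ} (hf : ∀ x, f (Function.update x i₀ (N - x i₀)) = - f x) (k : ℕ)
    (x : ι → ℤ) :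
    (stepOp φ N u v)^[k] f (Function.update x i₀ (N - x i₀)) = - (stepOp φ N u v)^[k] f x := by
  induction k generalizing x with
  | zero => exact hf x
  | succ k ih =>
    -- Exchanging the roles of the two tokens of `i₀` in the moving set keeps its size, hence its
    -- weight, and reverses the increment of that difference only.
    rw [iterate_stepOp_succ, iterate_stepOp_succ,
      ← (Equiv.swap (u i₀) (v i₀)).finsetCongr.sum_comp, ← Finset.sum_neg_distrib]
    refine Finset.sum_congr rfl fun A _ => ?_
    have : stoppedStep N u v (Function.update x i₀ (N - x i₀))
        ((Equiv.swap (u i₀) (v i₀)).finsetCongr A) =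
        Function.update (stoppedStep N u v x A) i₀ (N - stoppedStep N u v x A i₀) := by
      ext i
      rcases eq_or_ne i i₀ with rfl | h
      · have h1 : ((N : ℤ) - x i = 0 ∨ (N : ℤ) - x i = N) ↔ (x i = 0 ∨ x i = N) := by omega
        simp only [stoppedStep, Function.update_self, h1, Equiv.finsetCongr_apply,
          Finset.mem_map_equiv, Equiv.symm_swap, Equiv.swap_apply_right, Equiv.swap_apply_left]
        split_ifs <;> ring
      · obtain ⟨h1, h2, h3, h4⟩ := hi i h
        simp only [stoppedStep, Function.update_of_ne h, Equiv.finsetCongr_apply,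
          Finset.mem_map_equiv, Equiv.symm_swap, Equiv.swap_apply_of_ne_of_ne h1 h2,
          Equiv.swap_apply_of_ne_of_ne h3 h4]
    rw [this, ih, Equiv.finsetCongr_apply, Finset.card_map]
    ring

end Herman

namespace Herman

/-! ### Pfaffian-like sums over permutations -/

/-- The first position of the `i`-th pair in the word `u₁ v₁ ⋯ u_m v_m w₀`. -/
def slotL {m : ℕ} (i : Fin m) : Fin (2 * m + 1) := ⟨2 * i, by omega⟩

/-- The second position of the `i`-th pair in the word `u₁ v₁ ⋯ u_m v_m w₀`. -/
def slotR {m : ℕ} (i : Fin m) : Fin (2 * m + 1) := ⟨2 * i + 1, by omega⟩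

theorem slotL_inj {m : ℕ} {i j : Fin m} : slotL i = slotL j ↔ i = j := by
  simp [slotL, Fin.ext_iff]

theorem slotR_inj {m : ℕ} {i j : Fin m} : slotR i = slotR j ↔ i = j := by
  simp [slotR, Fin.ext_iff]

theorem slotL_ne_slotR {m : ℕ} (i j : Fin m) : slotL i ≠ slotR j := by
  simp only [slotL, slotR, ne_eq, Fin.ext_iff]; omega

theorem slotL_ne_last {m : ℕ} (i : Fin m) : slotL i ≠ Fin.last _ := by
  simp only [slotL, ne_eq, Fin.ext_iff, Fin.val_last]; omega

theorem slotR_ne_last {m : ℕ} (i : Fin m) : slotR i ≠ Fin.last _ := by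
  simp only [slotR, ne_eq, Fin.ext_iff, Fin.val_last]; omega

theorem slot_cases {m : ℕ} (x : Fin (2 * m + 1)) :
    (∃ i : Fin m, x = slotL i) ∨ (∃ i : Fin m, x = slotR i) ∨ x = Fin.last _ := by
  simp only [slotL, slotR, Fin.ext_iff, Fin.val_last]
  by_cases h : (x : ℕ) = 2 * m
  · exact Or.inr (Or.inr h)
  · have := x.2
    rcases Nat.even_or_odd' (x : ℕ) with ⟨c, hc | hc⟩
    · exact Or.inl ⟨⟨c, by omega⟩, hc⟩
    · exact Or.inr (Or.inl ⟨⟨c, by omega⟩, hc⟩)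

/-- The positions of a word are those of the pairs and the last one. -/
noncomputable def slotEquiv (m : ℕ) : (Fin m ⊕ Fin m) ⊕ Unit ≃ Fin (2 * m + 1) :=
  Equiv.ofBijective (Sum.elim (Sum.elim slotL slotR) fun _ => Fin.last _) <| by
    constructor
    · rintro ((i | i) | i) ((j | j) | j) h <;>
        simp_all [slotL_inj, slotR_inj, slotL_ne_slotR, slotL_ne_last, slotR_ne_last,
          (slotL_ne_slotR _ _).symm, (slotL_ne_last _).symm, (slotR_ne_last _).symm]
    · intro x
      rcases slot_cases x with ⟨i, rfl⟩ | ⟨i, rfl⟩ | rfl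
      exacts [⟨Sum.inl (Sum.inl i), rfl⟩, ⟨Sum.inl (Sum.inr i), rfl⟩, ⟨Sum.inr (), rfl⟩]

/-- The permutation of the positions that permutes the pairs according to `π`. -/
noncomputable def pairPerm {m : ℕ} (π : Equiv.Perm (Fin m)) : Equiv.Perm (Fin (2 * m + 1)) :=
  (slotEquiv m).permCongr (Equiv.Perm.sumCongr (Equiv.Perm.sumCongr π π) 1)

theorem pairPerm_slotL {m : ℕ} (π : Equiv.Perm (Fin m)) (i : Fin m) :
    pairPerm π (slotL i) = slotL (π i) := by
  have : (slotEquiv m).symm (slotL i) = Sum.inl (Sum.inl i) := by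
    rw [Equiv.symm_apply_eq]; rfl
  simp [pairPerm, Equiv.permCongr_apply, this]; rfl

theorem pairPerm_slotR {m : ℕ} (π : Equiv.Perm (Fin m)) (i : Fin m) :
    pairPerm π (slotR i) = slotR (π i) := by
  have : (slotEquiv m).symm (slotR i) = Sum.inl (Sum.inr i) := by
    rw [Equiv.symm_apply_eq]; rfl
  simp [pairPerm, Equiv.permCongr_apply, this]; rfl

/-- `π` acts once on the first and once on the second positions, so its sign is squared. This is why
the order of the pairs does not matter. -/
theorem sign_pairPerm {m : ℕ} (π : Equiv.Perm (Fin m)) : Equiv.Perm.sign (pairPerm π) = 1 := by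
  rw [pairPerm, Equiv.Perm.sign_permCongr, Equiv.Perm.sign_sumCongr, Equiv.Perm.sign_sumCongr,
    Int.units_mul_self, map_one, mul_one]

/-- The sign of a collision: `1` for a difference that has reached `0` (down), `-1` for one that has
reached `N` (up), and `0` if there has been no collision. -/
noncomputable def collisionSign (N : ℕ) (x : ℤ) : ℝ := if x = 0 then 1 else if x = N then -1 else 0

theorem collisionSign_reflect {N : ℕ} (hN : N ≠ 0) (x : ℤ) :
    collisionSign N (N - x) = - collisionSign N x := by
  have : (N : ℤ) ≠ 0 := by exact_mod_cast hN
  unfold collisionSign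
  split_ifs <;> first | omega | simp

/-- The expected product of the signs of the collisions up to time `k`. -/
noncomputable def pairVal (φ : ℕ → ℕ → ℝ) (N k : ℕ) {m : ℕ} (x : Fin m → ℤ) : ℝ :=
  (stepOp φ N slotL slotR)^[k] (fun x => ∏ i, collisionSign N (x i)) x

/-- The distance from token `u` clockwise to token `v`, for tokens at the positions `p` (lifted
from the ring to the integers), of which those with smaller indices are behind. -/
def cycDist (N : ℕ) {n : ℕ} (p : Fin n → ℤ) (u v : Fin n) : ℤ :=
  p v - p u + if v < u then (N : ℤ) else 0

/-- The contribution of a permutation to `pfaffianSum`. -/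
noncomputable def pfaffianTerm (φ : ℕ → ℕ → ℝ) (N k : ℕ) {m : ℕ} (p : Fin (2 * m + 1) → ℤ)
    (σ : Equiv.Perm (Fin (2 * m + 1))) : ℝ :=
  (Equiv.Perm.sign σ : ℤ) *
    pairVal φ N k fun i : Fin m => cycDist N p (σ (slotL i)) (σ (slotR i))

/-- The signed sum over all listings of pairings. -/
noncomputable def pfaffianSum (φ : ℕ → ℕ → ℝ) (N k : ℕ) {m : ℕ} (p : Fin (2 * m + 1) → ℤ) : ℝ :=
  ∑ σ, pfaffianTerm φ N k p σ

theorem pairVal_perm {φ : ℕ → ℕ → ℝ} (hφ : Consistent φ) (N k : ℕ) {m : ℕ} (x : Fin m → ℤ)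
    (π : Equiv.Perm (Fin m)) : pairVal φ N k (x ∘ π) = pairVal φ N k x := by
  unfold pairVal
  rw [iterate_stepOp_comap hφ N (u := slotL) (v := slotR) (u' := slotL) (v' := slotR)
    (pairPerm π).toEmbedding π (by simp [pairPerm_slotL]) (by simp [pairPerm_slotR]) x
    (by simp) 1 (f' := fun x => ∏ i, collisionSign N (x i)) ?_ k x (by simp), one_mul]
  intro y _
  rw [one_mul]
  exact (Equiv.prod_comp π fun i => collisionSign N (y i)).symm

/-- Reflection of one difference preserves the dynamics and exchanges up with down, so exactly one
factor of the product changes its sign. -/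
theorem pairVal_reflect (φ : ℕ → ℕ → ℝ) {N : ℕ} (hN : N ≠ 0) (k : ℕ) {m : ℕ}
    (x : Fin m → ℤ) (i : Fin m) :
    pairVal φ N k (Function.update x i (N - x i)) = - pairVal φ N k x := by
  refine iterate_stepOp_reflect φ N i (slotL_ne_slotR i i) (fun j hj => ?_) (fun y => ?_) k x
  · exact ⟨by simpa [slotL_inj] using hj, slotL_ne_slotR _ _, (slotL_ne_slotR _ _).symm,
      by simpa [slotR_inj] using hj⟩
  · rw [← Finset.mul_prod_erase _ _ (Finset.mem_univ i),
      ← Finset.mul_prod_erase (a := i) _ (fun j => collisionSign N (y j)) (Finset.mem_univ i),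
      Function.update_self, collisionSign_reflect hN, neg_mul]
    congr 2
    refine Finset.prod_congr rfl fun j hj => ?_
    rw [Function.update_of_ne (Finset.ne_of_mem_erase hj)]

/-- A pair that starts at difference 0 is frozen there with sign 1, and its two tokens occur in no
other difference, so they can be integrated out. -/
theorem pairVal_cons_zero {φ : ℕ → ℕ → ℝ} (hφ : Consistent φ) (N k : ℕ) {m : ℕ}
    (x : Fin (m + 1) → ℤ) (hx : x 0 = 0) :
    pairVal φ N k x = pairVal φ N k (fun i : Fin m => x i.succ) := by
  unfold pairVal
  have hr : ∀ i : Fin (m + 1), i ∉ Set.range Fin.succ → i = 0 := by simp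
  rw [iterate_stepOp_comap hφ N (u := slotL) (v := slotR) (u' := slotL) (v' := slotR)
    ((Fin.succEmb (2 * m + 1)).trans (Fin.succEmb (2 * m + 1 + 1))) Fin.succ
    (fun i => by rfl) (fun i => by rfl) x
    (fun i hi => by rw [hr i hi]; exact Or.inl hx) 1 (f' := fun x => ∏ i, collisionSign N (x i))
    ?_ k x (by simp), one_mul]
  · rfl
  · intro y hy
    rw [Fin.prod_univ_succ, hy 0 (by simp), hx]
    simp [collisionSign]

/-- The relabelling by `σ` costs nothing because the weights are exchangeable. Its purpose is that
the moving set `A` refers to tokens rather than positions in the word, so that the same `A` serves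
all `σ` in `pfaffianSum_succ`. -/
theorem pairVal_succ {φ : ℕ → ℕ → ℝ} (hφ : Consistent φ) (N k : ℕ) {m : ℕ} (x : Fin m → ℤ)
    (hx : ∀ i, x i ≠ 0 ∧ x i ≠ N) (σ : Equiv.Perm (Fin (2 * m + 1))) :
    pairVal φ N (k + 1) x = ∑ A : Finset (Fin (2 * m + 1)), φ (2 * m + 1) A.card *
      pairVal φ N k fun i => x i + (if σ (slotR i) ∈ A then 1 else 0) -
        (if σ (slotL i) ∈ A then 1 else 0) := by
  have h := hφ.sum_preimage σ.toEmbedding fun A =>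
      pairVal φ N k fun i => x i + (if slotR i ∈ A then 1 else 0) -
        (if slotL i ∈ A then 1 else 0)
  simp only [Fintype.card_fin, Finset.mem_filter, Finset.mem_univ, true_and,
    Equiv.coe_toEmbedding] at h
  rw [h, pairVal, iterate_stepOp_succ, Fintype.card_fin]
  refine Finset.sum_congr rfl fun A _ => ?_
  have : stoppedStep N slotL slotR x A = fun i => x i + (if slotR i ∈ A then 1 else 0) -
      (if slotL i ∈ A then 1 else 0) := by
    ext i
    simp [stoppedStep, hx i]
  rw [this, pairVal]

/-- The clockwise arcs from u to v and from v to u make up the whole ring. -/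
theorem cycDist_swap {N n : ℕ} (p : Fin n → ℤ) {u v : Fin n} (h : u ≠ v) :
    cycDist N p v u = N - cycDist N p u v := by
  unfold cycDist
  rcases lt_or_gt_of_ne h with h | h
  · rw [if_pos h, if_neg h.le.not_gt]; ring
  · rw [if_pos h, if_neg h.le.not_gt]; ring

theorem pfaffianTerm_mul_pairPerm {φ : ℕ → ℕ → ℝ} (hφ : Consistent φ) (N k : ℕ) {m : ℕ}
    (p : Fin (2 * m + 1) → ℤ) (σ : Equiv.Perm (Fin (2 * m + 1))) (π : Equiv.Perm (Fin m)) :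
    pfaffianTerm φ N k p (σ * pairPerm π) = pfaffianTerm φ N k p σ := by
  rw [pfaffianTerm, pfaffianTerm, Equiv.Perm.sign_mul, sign_pairPerm, mul_one,
    ← pairVal_perm hφ N k (fun i : Fin m => cycDist N p (σ (slotL i)) (σ (slotR i))) π]
  simp only [Equiv.Perm.mul_apply, pairPerm_slotL, pairPerm_slotR]
  rfl

/-- Two signs cancel: that of the transposition and that of the reflection of the difference it
causes. -/
theorem pfaffianTerm_mul_swap (φ : ℕ → ℕ → ℝ) {N : ℕ} (hN : N ≠ 0) (k : ℕ) {m : ℕ}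
    (p : Fin (2 * m + 1) → ℤ) (σ : Equiv.Perm (Fin (2 * m + 1))) (i : Fin m) :
    pfaffianTerm φ N k p (σ * Equiv.swap (slotL i) (slotR i)) = pfaffianTerm φ N k p σ := by
  rw [pfaffianTerm, pfaffianTerm, Equiv.Perm.sign_mul, Equiv.Perm.sign_swap (slotL_ne_slotR i i)]
  have : (fun j : Fin m => cycDist N p ((σ * Equiv.swap (slotL i) (slotR i)) (slotL j))
      ((σ * Equiv.swap (slotL i) (slotR i)) (slotR j))) =
      Function.update (fun j : Fin m => cycDist N p (σ (slotL j)) (σ (slotR j))) i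
        (N - cycDist N p (σ (slotL i)) (σ (slotR i))) := by
    ext j
    rcases eq_or_ne j i with rfl | h
    · simp [← cycDist_swap p (σ.injective.ne (slotL_ne_slotR j j))]
    · rw [Function.update_of_ne h, Equiv.Perm.mul_apply, Equiv.Perm.mul_apply,
        Equiv.swap_apply_of_ne_of_ne (by simpa [slotL_inj] using h) (slotL_ne_slotR _ _),
        Equiv.swap_apply_of_ne_of_ne (slotL_ne_slotR _ _).symm (by simpa [slotR_inj] using h)]
  rw [this, pairVal_reflect φ hN k (fun j : Fin m => cycDist N p (σ (slotL j)) (σ (slotR j))) i]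
  push_cast
  ring

/-- The positions after renumbering the tokens such that the first one becomes the last one. -/
def rotate (N : ℕ) {n : ℕ} (p : Fin (n + 1) → ℤ) (i : Fin (n + 1)) : ℤ :=
  p (finRotate (n + 1) i) + if i = Fin.last n then (N : ℤ) else 0

/-- The former first token is lifted by one full turn, which compensates exactly for its change of
rank in the correction term of `cycDist`. -/
theorem cycDist_rotate (N : ℕ) {n : ℕ} (p : Fin (n + 1) → ℤ) {u v : Fin (n + 1)} (h : u ≠ v) :
    cycDist N (rotate N p) u v = cycDist N p (finRotate _ u) (finRotate _ v) := by
  have key : ∀ u v : Fin (n + 1), u ≠ v →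
      ((if v < u then (N : ℤ) else 0) + (if v = Fin.last n then (N : ℤ) else 0) -
        (if u = Fin.last n then (N : ℤ) else 0)) =
      if finRotate _ v < finRotate _ u then (N : ℤ) else 0 := by
    intro u v h
    rcases Fin.eq_castSucc_or_eq_last u with ⟨u, rfl⟩ | rfl <;>
    rcases Fin.eq_castSucc_or_eq_last v with ⟨v, rfl⟩ | rfl
    · have h1 : ∀ a : Fin n, finRotate (n + 1) a.castSucc = a.succ := fun a => by
        rw [finRotate_apply, Fin.coeSucc_eq_succ]
      simp [h1]
    · simp [finRotate_apply, Fin.le_last]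
    · simp [finRotate_apply]
    · exact absurd rfl h
  have := key u v h
  simp only [cycDist, rotate]
  linarith

/-- Renumbering multiplies every listing by a cycle of odd length, an even permutation, and leaves
all cyclic distances unchanged. -/
theorem pfaffianSum_rotate (φ : ℕ → ℕ → ℝ) (N k : ℕ) {m : ℕ} (p : Fin (2 * m + 1) → ℤ) :
    pfaffianSum φ N k (rotate N p) = pfaffianSum φ N k p := by
  unfold pfaffianSum
  rw [← Equiv.sum_comp (Equiv.mulLeft (finRotate (2 * m + 1))) (pfaffianTerm φ N k p)]
  refine Finset.sum_congr rfl fun σ _ => ?_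
  rw [pfaffianTerm, pfaffianTerm, Equiv.coe_mulLeft, Equiv.Perm.sign_mul, sign_finRotate]
  have : (fun i : Fin m => cycDist N (rotate N p) (σ (slotL i)) (σ (slotR i))) =
      fun i : Fin m => cycDist N p ((finRotate (2 * m + 1) * σ) (slotL i))
        ((finRotate (2 * m + 1) * σ) (slotR i)) := by
    ext i
    rw [cycDist_rotate N p (σ.injective.ne (slotL_ne_slotR i i))]
    rfl
  rw [this]
  simp

theorem sum_perm_fix_zero {n : ℕ} (F : Equiv.Perm (Fin (n + 1)) → ℝ) :
    (∑ σ, if σ 0 = 0 then F σ else 0) = ∑ e, F (Equiv.Perm.decomposeFin.symm (0, e)) := by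
  rw [← Equiv.Perm.decomposeFin.symm.sum_comp, Fintype.sum_prod_type,
    Finset.sum_eq_single 0 (fun q _ hq => ?_) (by simp)]
  · simp [Equiv.Perm.decomposeFin_symm_apply_zero]
  · simp [Equiv.Perm.decomposeFin_symm_apply_zero, hq]

theorem sum_perm_fix_zero_one {n : ℕ} (F : Equiv.Perm (Fin (n + 2)) → ℝ) :
    (∑ σ, if σ 0 = 0 ∧ σ 1 = 1 then F σ else 0) =
      ∑ e, F (Equiv.Perm.decomposeFin.symm (0, Equiv.Perm.decomposeFin.symm (0, e))) := by
  rw [← sum_perm_fix_zero fun e => F (Equiv.Perm.decomposeFin.symm (0, e))]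
  simp only [ite_and]
  rw [sum_perm_fix_zero fun σ => if σ 1 = 1 then F σ else 0]
  refine Finset.sum_congr rfl fun e _ => ?_
  have : Equiv.Perm.decomposeFin.symm (0, e) 1 = 1 ↔ e 0 = 0 := by
    rw [← Fin.succ_zero_eq_one, Equiv.Perm.decomposeFin_symm_apply_succ, Equiv.swap_self,
      Equiv.refl_apply, Fin.succ_inj]
  simp only [this]

/-- No index lies between 0 and 1, so any third token sees these two coinciding tokens alike. The
pair itself has to be excluded: its cyclic distance would change between 0 and N. -/
theorem cycDist_swap_zero_one (N : ℕ) {n : ℕ} (p : Fin (n + 2) → ℤ) (hp : p 0 = p 1)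
    {u v : Fin (n + 2)} (h : u ≠ v) (h1 : ¬(u = 0 ∧ v = 1)) (h2 : ¬(u = 1 ∧ v = 0)) :
    cycDist N p (Equiv.swap 0 1 u) (Equiv.swap 0 1 v) = cycDist N p u v := by
  have hlt : ∀ w : Fin (n + 2), w ≠ 0 → w ≠ 1 → 1 < w := by
    intro w hw0 hw1
    simp only [ne_eq, Fin.ext_iff, Fin.lt_def, Fin.val_zero, Fin.val_one] at *
    omega
  have h01 : ∀ w : Fin (n + 2), w ≠ 0 → w ≠ 1 → 0 < w := fun w hw _ => Fin.pos_of_ne_zero hw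
  by_cases hu0 : u = 0
  · subst hu0
    have hv1 : v ≠ 1 := fun h => h1 ⟨rfl, h⟩
    rw [Equiv.swap_apply_left, Equiv.swap_apply_of_ne_of_ne h.symm hv1]
    simp [cycDist, hp, (hlt v h.symm hv1).not_gt]
  by_cases hu1 : u = 1
  · subst hu1
    have hv0 : v ≠ 0 := fun h => h2 ⟨rfl, h⟩
    rw [Equiv.swap_apply_right, Equiv.swap_apply_of_ne_of_ne hv0 h.symm]
    simp only [cycDist, hp, (h01 v hv0 h.symm).not_gt, (hlt v hv0 h.symm).not_gt]
  rw [Equiv.swap_apply_of_ne_of_ne hu0 hu1]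
  by_cases hv0 : v = 0
  · subst hv0
    simp [cycDist, hp, hlt u hu0 hu1, h01 u hu0 hu1]
  by_cases hv1 : v = 1
  · subst hv1
    simp [cycDist, hp, hlt u hu0 hu1, h01 u hu0 hu1]
  rw [Equiv.swap_apply_of_ne_of_ne hv0 hv1]

theorem pfaffianTerm_swap_mul (φ : ℕ → ℕ → ℝ) (N k : ℕ) {m : ℕ}
    (p : Fin (2 * (m + 1) + 1) → ℤ) (hp : p 0 = p 1) (σ : Equiv.Perm (Fin (2 * (m + 1) + 1)))
    (hσ : ∀ i : Fin (m + 1), ¬(σ (slotL i) = 0 ∧ σ (slotR i) = 1) ∧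
      ¬(σ (slotL i) = 1 ∧ σ (slotR i) = 0)) :
    pfaffianTerm φ N k p (Equiv.swap 0 1 * σ) = - pfaffianTerm φ N k p σ := by
  rw [pfaffianTerm, pfaffianTerm, Equiv.Perm.sign_mul, Equiv.Perm.sign_swap
    (by simp : (0 : Fin (2 * (m + 1) + 1)) ≠ 1)]
  have : (fun i : Fin (m + 1) => cycDist N p ((Equiv.swap 0 1 * σ : Equiv.Perm _) (slotL i))
      ((Equiv.swap 0 1 * σ : Equiv.Perm _) (slotR i))) =
      fun i : Fin (m + 1) => cycDist N p (σ (slotL i)) (σ (slotR i)) := by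
    ext i
    exact cycDist_swap_zero_one N p hp (σ.injective.ne (slotL_ne_slotR i i)) (hσ i).1 (hσ i).2
  rw [this]
  push_cast
  ring

theorem pfaffianTerm_decomposeFin {φ : ℕ → ℕ → ℝ} (hφ : Consistent φ) (N k : ℕ) {m : ℕ}
    (p : Fin (2 * (m + 1) + 1) → ℤ) (hp : p 0 = p 1) (e : Equiv.Perm (Fin (2 * m + 1))) :
    pfaffianTerm φ N k p
        (Equiv.Perm.decomposeFin.symm (0, Equiv.Perm.decomposeFin.symm (0, e))) =
      pfaffianTerm φ N k (fun i : Fin (2 * m + 1) => p i.succ.succ) e := by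
  have h0 : ∀ {n : ℕ} (e : Equiv.Perm (Fin n)) (x : Fin n),
      Equiv.Perm.decomposeFin.symm ((0 : Fin (n + 1)), e) x.succ = (e x).succ := by
    intro n e x
    rw [Equiv.Perm.decomposeFin_symm_apply_succ, Equiv.swap_self, Equiv.refl_apply]
  set σ := Equiv.Perm.decomposeFin.symm ((0 : Fin (2 * m + 1 + 2)),
    Equiv.Perm.decomposeFin.symm ((0 : Fin (2 * m + 1 + 1)), e)) with hσ
  have hz : σ 0 = 0 := Equiv.Perm.decomposeFin_symm_apply_zero _ _
  have h1 : σ 1 = 1 := by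
    rw [← Fin.succ_zero_eq_one, hσ, h0, Equiv.Perm.decomposeFin_symm_apply_zero]
  have h2 : ∀ x : Fin (2 * m + 1), σ x.succ.succ = (e x).succ.succ := by
    intro x; rw [hσ, h0, h0]
  have hs : Equiv.Perm.sign σ = Equiv.Perm.sign e := by
    rw [hσ, Equiv.Perm.decomposeFin.symm_sign, Equiv.Perm.decomposeFin.symm_sign]; simp
  rw [pfaffianTerm, pfaffianTerm]
  erw [hs]
  congr 1
  rw [pairVal_cons_zero hφ]
  · congr 1
    ext i
    have hl : (slotL i.succ : Fin (2 * (m + 1) + 1)) = (slotL i : Fin (2 * m + 1)).succ.succ := rfl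
    have hr : (slotR i.succ : Fin (2 * (m + 1) + 1)) = (slotR i : Fin (2 * m + 1)).succ.succ := rfl
    rw [hl, hr]
    erw [h2, h2]
    simp [cycDist]
  · have hl : (slotL 0 : Fin (2 * (m + 1) + 1)) = 0 := rfl
    have hr : (slotR 0 : Fin (2 * (m + 1) + 1)) = 1 := rfl
    rw [hl, hr]
    erw [hz, h1]
    simp [cycDist, hp]

/-- Two tokens at the same position can be removed. -/
theorem pfaffianSum_reduce {φ : ℕ → ℕ → ℝ} (hφ : Consistent φ) {N : ℕ} (hN : N ≠ 0) (k : ℕ)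
    {m : ℕ} (p : Fin (2 * (m + 1) + 1) → ℤ) (hp : p 0 = p 1) :
    pfaffianSum φ N k p =
      2 * (m + 1) * pfaffianSum φ N k (fun i : Fin (2 * m + 1) => p i.succ.succ) := by
  classical
  set f := pfaffianTerm φ N k p with hf
  -- `a` and `b` say that slot `i` pairs the coinciding tokens with each other, in either
  -- orientation. For each `σ` this happens for at most one slot and one orientation.
  let a : Equiv.Perm (Fin (2 * (m + 1) + 1)) → Fin (m + 1) → Prop :=
    fun σ i => σ (slotL i) = 0 ∧ σ (slotR i) = 1
  let b : Equiv.Perm (Fin (2 * (m + 1) + 1)) → Fin (m + 1) → Prop :=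
    fun σ i => σ (slotL i) = 1 ∧ σ (slotR i) = 0
  have h10 : (0 : Fin (2 * (m + 1) + 1)) ≠ 1 := by simp
  have hsplit : ∀ σ, f σ = (if ∀ i, ¬ a σ i ∧ ¬ b σ i then f σ else 0) +
      ∑ i, ((if a σ i then f σ else 0) + if b σ i then f σ else 0) := by
    intro σ
    by_cases h : ∀ i, ¬ a σ i ∧ ¬ b σ i
    · rw [if_pos h, Finset.sum_eq_zero, add_zero]
      intro i _
      rw [if_neg (h i).1, if_neg (h i).2, add_zero]
    · rw [if_neg h, zero_add]
      push Not at h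
      obtain ⟨i, hi⟩ := h
      have hab : ∀ j, a σ j ∨ b σ j → j = i := by
        intro j hj
        have hi' : a σ i ∨ b σ i := by tauto
        rcases hj with hj | hj <;> rcases hi' with hi' | hi'
        · exact slotL_inj.1 (σ.injective (hj.1.trans hi'.1.symm))
        · exact absurd (σ.injective (hj.1.trans hi'.2.symm)) (slotL_ne_slotR _ _)
        · exact absurd (σ.injective (hj.1.trans hi'.2.symm)) (slotL_ne_slotR _ _)
        · exact slotL_inj.1 (σ.injective (hj.1.trans hi'.1.symm))
      rw [Finset.sum_eq_single i (fun j _ hj => ?_) (by simp)]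
      · by_cases hai : a σ i
        · have : ¬ b σ i := fun hb => h10 (hai.1.symm.trans hb.1)
          simp [hai, this]
        · simp [hai, hi hai]
      · have h1 : ¬ a σ j := fun h => hj (hab j (Or.inl h))
        have h2 : ¬ b σ j := fun h => hj (hab j (Or.inr h))
        simp [h1, h2]
  -- Exchanging the labels 0 and 1 is a sign-reversing involution without fixed points on the
  -- listings that do not pair them.
  have hzero : (∑ σ, if ∀ i, ¬ a σ i ∧ ¬ b σ i then f σ else 0) = 0 := by
    have hinv : ∀ σ, (∀ i, ¬ a (Equiv.swap 0 1 * σ) i ∧ ¬ b (Equiv.swap 0 1 * σ) i) ↔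
        ∀ i, ¬ a σ i ∧ ¬ b σ i := by
      intro σ
      refine forall_congr' fun i => ?_
      simp only [a, b, Equiv.Perm.mul_apply, Equiv.swap_apply_eq_iff, Equiv.swap_apply_left,
        Equiv.swap_apply_right]
      tauto
    refine Finset.sum_involution (fun σ _ => Equiv.swap 0 1 * σ) (fun σ _ => ?_) (fun σ _ _ h => ?_)
      (fun _ _ => Finset.mem_univ _) (fun σ _ => ?_)
    · simp only [hinv σ]
      split_ifs with h
      · rw [hf, pfaffianTerm_swap_mul φ N k p hp σ h, add_neg_cancel]
      · simp
    · have := congrArg (· * σ⁻¹) h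
      simp only [mul_assoc, mul_inv_cancel, mul_one] at this
      exact h10 (Equiv.swap_eq_one_iff.1 this)
    · rw [← mul_assoc, Equiv.swap_mul_self, one_mul]
  -- The surviving listings can be normalized so that the pair is oriented as (0, 1) and sits in
  -- slot 0. The two orientations and the `m + 1` slots produce the factor `2 * (m + 1)`.
  have hb : ∀ i, (∑ σ, if b σ i then f σ else 0) = ∑ σ, if a σ i then f σ else 0 := by
    intro i
    rw [← Equiv.sum_comp (Equiv.mulRight (Equiv.swap (slotL i) (slotR i)))]
    refine Finset.sum_congr rfl fun σ _ => ?_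
    have : b (σ * Equiv.swap (slotL i) (slotR i)) i ↔ a σ i := by
      simp only [a, b, Equiv.Perm.mul_apply, Equiv.swap_apply_left, Equiv.swap_apply_right]
      tauto
    simp only [Equiv.coe_mulRight, this, hf, pfaffianTerm_mul_swap φ hN]
  have ha : ∀ i, (∑ σ, if a σ i then f σ else 0) = ∑ σ, if a σ 0 then f σ else 0 := by
    intro i
    rw [← Equiv.sum_comp (Equiv.mulRight (pairPerm (Equiv.swap i 0)))]
    refine Finset.sum_congr rfl fun σ _ => ?_
    have : a (σ * pairPerm (Equiv.swap i 0)) i ↔ a σ 0 := by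
      simp [a, Equiv.Perm.mul_apply, pairPerm_slotL, pairPerm_slotR]
    simp only [Equiv.coe_mulRight, this, hf, pfaffianTerm_mul_pairPerm hφ]
  have h0 : (∑ σ, if a σ 0 then f σ else 0) =
      pfaffianSum φ N k (fun i : Fin (2 * m + 1) => p i.succ.succ) := by
    refine (sum_perm_fix_zero_one (n := 2 * m + 1) f).trans ?_
    exact Finset.sum_congr rfl fun e _ => pfaffianTerm_decomposeFin hφ N k p hp e
  rw [pfaffianSum, Finset.sum_congr rfl fun σ _ => hsplit σ, Finset.sum_add_distrib, hzero,
    zero_add, Finset.sum_comm]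
  simp only [Finset.sum_add_distrib, hb, ha, h0]
  simp
  ring

end Herman

namespace Herman

/-! ### The annihilating system -/

/-- The weight of the paths along which the configuration `c` has a single token after `k` steps. -/
noncomputable def singleProb (φ : ℕ → ℕ → ℝ) {N : ℕ} : ℕ → Config N → ℝ
  | 0, c => if c.card = 1 then 1 else 0
  | k + 1, c => ∑ A ∈ c.powerset, φ c.card A.card * singleProb φ k (pass c A)

/-- The configuration of the processors at which an odd number of the tokens are, for tokens at
the positions `p` (lifted from the ring to the integers). -/
def oddConfig (N : ℕ) [NeZero N] {L : Type*} [Fintype L] (p : L → ℤ) : Config N :=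
  Finset.univ.filter fun c => Odd (Finset.univ.filter fun u => (p u : ZMod N) = c).card

theorem odd_card_filter_iff {L K : Type*} [DecidableEq K] [DecidableEq L] {q : L → K}
    (hq : Function.Injective q) (s : Finset L) (c : K) :
    Odd (s.filter fun u => q u = c).card ↔ c ∈ s.image q := by
  by_cases h : c ∈ s.image q
  · obtain ⟨u, hu, rfl⟩ := Finset.mem_image.1 h
    have : s.filter (fun v => q v = q u) = {u} := by
      ext v
      simp only [Finset.mem_filter, Finset.mem_singleton]
      exact ⟨fun hv => hq hv.2, fun hv => ⟨hv ▸ hu, hv ▸ rfl⟩⟩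
    simp [this, h]
  · have : s.filter (fun v => q v = c) = ∅ := by
      refine Finset.filter_eq_empty_iff.2 fun v hv hvc => h (hvc ▸ Finset.mem_image_of_mem q hv)
    simp only [this, h, iff_false]
    simp

theorem oddConfig_eq_map {N : ℕ} [NeZero N] {L : Type*} [Fintype L] [DecidableEq L] {p : L → ℤ}
    (hp : Function.Injective fun u => (p u : ZMod N)) :
    oddConfig N p = Finset.univ.map ⟨_, hp⟩ := by
  ext c
  rw [oddConfig, Finset.mem_filter, odd_card_filter_iff hp]
  simp

/-- From distinct processors, each processor keeps at most one token and receives at most one. Hence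
an odd count means exactly one of the two, which is the symmetric difference in `pass`. -/
theorem oddConfig_move {N : ℕ} [NeZero N] {L : Type*} [Fintype L] [DecidableEq L] {p : L → ℤ}
    (hp : Function.Injective fun u => (p u : ZMod N)) (A : Finset L) :
    oddConfig N (fun u => p u + if u ∈ A then 1 else 0) =
      pass (Finset.univ.map ⟨_, hp⟩) (A.map ⟨_, hp⟩) := by
  ext c
  have hq : Function.Injective fun u => (p u : ZMod N) + 1 :=
    fun u v h => hp (add_right_cancel h)
  have hcard : (Finset.univ.filter fun u =>
        ((p u + if u ∈ A then 1 else 0 : ℤ) : ZMod N) = c).card =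
      (Aᶜ.filter fun u => (p u : ZMod N) = c).card +
        (A.filter fun u => (p u : ZMod N) + 1 = c).card := by
    rw [← Finset.card_union_of_disjoint]
    · congr 1
      ext u
      by_cases hu : u ∈ A <;> simp [hu]
    · exact Finset.disjoint_filter_filter (disjoint_compl_left)
  rw [oddConfig, Finset.mem_filter, hcard, Nat.odd_add, ← Nat.not_odd_iff_even,
    odd_card_filter_iff hp, odd_card_filter_iff hq, pass, Finset.mem_symmDiff]
  have h1 : c ∈ Aᶜ.image (fun u => (p u : ZMod N)) ↔
      c ∈ Finset.univ.map ⟨_, hp⟩ \ A.map ⟨_, hp⟩ := by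
    simp only [Finset.mem_image, Finset.mem_compl, Finset.mem_sdiff, Finset.mem_map,
      Finset.mem_univ, true_and, Function.Embedding.coeFn_mk]
    constructor
    · rintro ⟨u, hu, rfl⟩
      exact ⟨⟨u, rfl⟩, fun ⟨v, hv, h⟩ => hu (hp h ▸ hv)⟩
    · rintro ⟨⟨u, rfl⟩, h⟩
      exact ⟨u, fun hu => h ⟨u, hu, rfl⟩, rfl⟩
  have h2 : c ∈ A.image (fun u => (p u : ZMod N) + 1) ↔
      c ∈ (A.map ⟨_, hp⟩).image (· + 1) := by
    simp only [Finset.mem_image, Finset.mem_map, Function.Embedding.coeFn_mk,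
      exists_exists_and_eq_and]
  rw [h1, h2]
  simp only [Finset.mem_univ, true_and]
  tauto

theorem rotate_castSucc (N : ℕ) {n : ℕ} (p : Fin (n + 1) → ℤ) (i : Fin n) :
    rotate N p i.castSucc = p i.succ := by
  rw [rotate, finRotate_apply, Fin.coeSucc_eq_succ, if_neg (Fin.castSucc_lt_last i).ne, add_zero]

theorem rotate_last (N : ℕ) {n : ℕ} (p : Fin (n + 1) → ℤ) :
    rotate N p (Fin.last n) = p 0 + N := by
  rw [rotate, finRotate_last, if_pos rfl]

theorem oddConfig_rotate (N : ℕ) [NeZero N] {n : ℕ} (p : Fin (n + 1) → ℤ) :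
    oddConfig N (rotate N p) = oddConfig N p := by
  ext c
  simp only [oddConfig, Finset.mem_filter, Finset.mem_univ, true_and]
  have : (Finset.univ.filter fun u => (rotate N p u : ZMod N) = c).map
      (finRotate (n + 1)).toEmbedding = Finset.univ.filter fun u => (p u : ZMod N) = c := by
    ext u
    have h : ((rotate N p ((finRotate (n + 1)).symm u) : ℤ) : ZMod N) = p u := by
      simp only [rotate, Equiv.apply_symm_apply]
      split_ifs <;> simp
    rw [Finset.mem_map_equiv, Finset.mem_filter, Finset.mem_filter, h]
    simp only [Finset.mem_univ, true_and]
  rw [← this, Finset.card_map]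

theorem oddConfig_reduce (N : ℕ) [NeZero N] {n : ℕ} (p : Fin (n + 1 + 1) → ℤ) (hp : p 0 = p 1) :
    oddConfig N p = oddConfig N (fun i : Fin n => p i.succ.succ) := by
  ext c
  simp only [oddConfig, Finset.mem_filter, Finset.mem_univ, true_and, Finset.card_filter]
  rw [Fin.sum_univ_succ, Fin.sum_univ_succ, Fin.succ_zero_eq_one, ← hp, ← add_assoc, Nat.odd_add']
  exact iff_true_right ⟨_, rfl⟩

/-- The bound by one turn becomes the last of the order relations, and the first order relation
implies the new bound. -/
theorem monotone_rotate {N n : ℕ} {p : Fin (n + 2) → ℤ} (hp : Monotone p)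
    (hN : p (Fin.last _) ≤ p 0 + N) :
    Monotone (rotate N p) ∧ rotate N p (Fin.last _) ≤ rotate N p 0 + N := by
  constructor
  · rw [Fin.monotone_iff_le_succ]
    intro i
    rw [rotate_castSucc]
    rcases Fin.eq_castSucc_or_eq_last i.succ with ⟨j, hj⟩ | hj
    · rw [hj, rotate_castSucc]
      exact hp (Fin.castSucc_lt_succ).le
    · rw [hj, rotate_last]
      exact hN
  · rw [rotate_last, ← Fin.castSucc_zero, rotate_castSucc]
    have := hp (Fin.zero_le (Fin.succ (0 : Fin (n + 1))))
    rw [Fin.castSucc_zero]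
    linarith

/-- The formula for the probability that a single token is left, as a statement about the
positions `p`. -/
def SingleFormula (φ : ℕ → ℕ → ℝ) (N : ℕ) [NeZero N] (k : ℕ) {m : ℕ} (p : Fin (2 * m + 1) → ℤ) :
    Prop := pfaffianSum φ N k p = 2 ^ m * m.factorial * singleProb φ k (oddConfig N p)

/-- Each rotation brings the coincidence one index closer to the front, where the two tokens are
removed. The normalizations agree because `2 * (m + 1)` times 2^m m! is the constant for `m + 1`
pairs. -/
theorem singleFormula_of_coincidence {φ : ℕ → ℕ → ℝ} (hφ : Consistent φ) (N : ℕ) [NeZero N] (k : ℕ)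
    {m : ℕ} (ih : ∀ p : Fin (2 * m + 1) → ℤ, Monotone p → p (Fin.last _) ≤ p 0 + N →
      SingleFormula φ N k p) (j : ℕ) (hj : j < 2 * (m + 1)) (p : Fin (2 * (m + 1) + 1) → ℤ)
    (hp : Monotone p) (hpN : p (Fin.last _) ≤ p 0 + N)
    (hpj : p (Fin.castSucc ⟨j, hj⟩) = p (Fin.succ ⟨j, hj⟩)) : SingleFormula φ N k p := by
  induction j generalizing p with
  | zero =>
    have h01 : p 0 = p 1 := hpj
    unfold SingleFormula
    rw [pfaffianSum_reduce hφ (NeZero.ne N) k p h01,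
      ih (fun i : Fin (2 * m + 1) => p i.succ.succ), oddConfig_reduce N (n := 2 * m + 1) p h01,
      pow_succ,
      Nat.factorial_succ]
    · push_cast; ring
    · exact fun a b h => hp (by simpa using h)
    · have h1 := hp (Fin.zero_le (Fin.succ (Fin.succ (0 : Fin (2 * m + 1)))))
      rw [Fin.succ_last, Fin.succ_last]
      refine hpN.trans ?_
      linarith
  | succ j hind =>
    have hr := monotone_rotate hp hpN
    have := hind (by omega) (rotate N p) hr.1 hr.2 (by
      rw [rotate_castSucc]
      have : (Fin.succ ⟨j, by omega⟩ : Fin (2 * (m + 1) + 1)) = Fin.castSucc ⟨j + 1, hj⟩ := rfl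
      rw [this, rotate_castSucc, ← hpj])
    unfold SingleFormula at this ⊢
    rwa [pfaffianSum_rotate, oddConfig_rotate] at this

/-- Strictness fails through a coincidence of neighbours or through the last token being one full
turn ahead of the first. One rotation makes the latter a coincidence at the last two indices. -/
theorem singleFormula_of_strict {φ : ℕ → ℕ → ℝ} (hφ : Consistent φ) (N : ℕ) [NeZero N] (k : ℕ)
    (h : ∀ (m : ℕ) (p : Fin (2 * m + 1) → ℤ), StrictMono p → p (Fin.last _) < p 0 + N →
      SingleFormula φ N k p) (m : ℕ) (p : Fin (2 * m + 1) → ℤ) (hp : Monotone p)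
    (hpN : p (Fin.last _) ≤ p 0 + N) : SingleFormula φ N k p := by
  induction m with
  | zero =>
    refine h 0 p (fun a b hab => by have := a.2; have := b.2; rw [Fin.lt_def] at hab; omega) ?_
    have : (0 : ℤ) < N := by exact_mod_cast Nat.pos_of_ne_zero (NeZero.ne N)
    have h0 : (Fin.last (2 * 0) : Fin (2 * 0 + 1)) = 0 := rfl
    rw [h0]; linarith
  | succ m ih =>
    by_cases hs : StrictMono p
    · rcases hpN.lt_or_eq with hlt | heq
      · exact h _ p hs hlt
      · have hr := monotone_rotate hp hpN
        have := singleFormula_of_coincidence hφ N k ih (2 * m + 1) (by omega) (rotate N p) hr.1 hr.2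
          (by
            rw [rotate_castSucc]
            have : (Fin.succ ⟨2 * m + 1, by omega⟩ : Fin (2 * (m + 1) + 1)) = Fin.last _ := rfl
            rw [this, rotate_last, heq])
        unfold SingleFormula at this ⊢
        rwa [pfaffianSum_rotate, oddConfig_rotate] at this
    · rw [Fin.strictMono_iff_lt_succ] at hs
      push Not at hs
      obtain ⟨i, hi⟩ := hs
      exact singleFormula_of_coincidence hφ N k ih i i.2 p hp hpN
        (le_antisymm (hp (Fin.castSucc_lt_succ).le) hi)

theorem cycDist_mem_Ioo {N n : ℕ} {p : Fin (n + 1) → ℤ} (hp : StrictMono p)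
    (hpN : p (Fin.last _) < p 0 + N) {u v : Fin (n + 1)} (h : u ≠ v) :
    0 < cycDist N p u v ∧ cycDist N p u v < N := by
  have h1 : ∀ w, p 0 ≤ p w ∧ p w ≤ p (Fin.last _) := fun w =>
    ⟨hp.monotone (Fin.zero_le w), hp.monotone (Fin.le_last w)⟩
  have := h1 u
  have := h1 v
  unfold cycDist
  rcases lt_or_gt_of_ne h with h | h
  · rw [if_neg h.le.not_gt]
    have := hp h
    omega
  · rw [if_pos h]
    have := hp h
    omega

theorem injective_cast_of_strictMono {N n : ℕ} {p : Fin (n + 1) → ℤ} (hp : StrictMono p)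
    (hpN : p (Fin.last _) < p 0 + N) : Function.Injective fun u => (p u : ZMod N) := by
  intro u v h
  by_contra huv
  have h1 := cycDist_mem_Ioo hp hpN huv
  have h2 : (N : ℤ) ∣ cycDist N p u v := by
    rw [← ZMod.intCast_zmod_eq_zero_iff_dvd]
    have h' : (p u : ZMod N) = p v := h
    unfold cycDist
    split_ifs <;> simp [h']
  have := Int.le_of_dvd h1.1 h2
  omega

/-- In strict order all cyclic distances lie strictly between 0 and N, so no difference is stopped
yet and every term takes its step with the same set of moving tokens. -/
theorem pfaffianSum_succ {φ : ℕ → ℕ → ℝ} (hφ : Consistent φ) {N : ℕ} (k : ℕ) {m : ℕ}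
    {p : Fin (2 * m + 1) → ℤ} (hp : StrictMono p) (hpN : p (Fin.last _) < p 0 + N) :
    pfaffianSum φ N (k + 1) p = ∑ A : Finset (Fin (2 * m + 1)), φ (2 * m + 1) A.card *
      pfaffianSum φ N k (fun u => p u + if u ∈ A then 1 else 0) := by
  simp only [pfaffianSum, Finset.mul_sum]
  rw [Finset.sum_comm]
  refine Finset.sum_congr rfl fun σ _ => ?_
  rw [pfaffianTerm, pairVal_succ hφ N k _ (fun i => ?_) σ, Finset.mul_sum]
  · refine Finset.sum_congr rfl fun A _ => ?_
    rw [pfaffianTerm, mul_left_comm]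
    congr 3
    ext i
    simp only [cycDist]
    ring
  · have := cycDist_mem_Ioo hp hpN (σ.injective.ne (slotL_ne_slotR i i))
    omega

/-- The probability that a single token is left, expressed through the collisions of pairs of
non-interacting tokens. -/
theorem singleFormula {φ : ℕ → ℕ → ℝ} (hφ : Consistent φ) (N : ℕ) [NeZero N] (k : ℕ) {m : ℕ}
    (p : Fin (2 * m + 1) → ℤ) (hp : Monotone p) (hpN : p (Fin.last _) ≤ p 0 + N) :
    SingleFormula φ N k p := by
  induction k generalizing m with
  | zero =>
    refine singleFormula_of_strict hφ N 0 (fun m p hp hpN => ?_) m p hp hpN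
    unfold SingleFormula
    rw [oddConfig_eq_map (injective_cast_of_strictMono hp hpN), singleProb, Finset.card_map,
      Finset.card_univ, Fintype.card_fin]
    -- A lone token gives 1 on both sides. With more tokens both sides vanish at time 0, the left
    -- one because no pair has collided.
    rcases m with _ | m
    · simp [pfaffianSum, pfaffianTerm, pairVal]
    · rw [if_neg (by omega), mul_zero, pfaffianSum, Finset.sum_eq_zero]
      intro σ _
      rw [pfaffianTerm, pairVal, Function.iterate_zero_apply, Finset.prod_eq_zero
        (Finset.mem_univ (0 : Fin (m + 1))), mul_zero]
      have := cycDist_mem_Ioo hp hpN (σ.injective.ne (slotL_ne_slotR (0 : Fin (m + 1)) 0))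
      rw [collisionSign, if_neg this.1.ne', if_neg this.2.ne]
  | succ k ih =>
    refine singleFormula_of_strict hφ N (k + 1) (fun m p hp hpN => ?_) m p hp hpN
    have hinj := injective_cast_of_strictMono hp hpN
    unfold SingleFormula
    rw [pfaffianSum_succ hφ k hp hpN, oddConfig_eq_map hinj, singleProb, sum_powerset_map_univ,
      Finset.mul_sum]
    refine Finset.sum_congr rfl fun A _ => ?_
    -- A token moves by at most one, so strict inequalities between integer positions weaken at
    -- worst to equalities. This is why the induction runs over weakly ordered positions.
    have h1 := ih (fun u => p u + if u ∈ A then 1 else 0) (fun u v huv => ?_) ?_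
    · rw [h1, oddConfig_move hinj, Finset.card_map, Finset.card_map, Finset.card_univ,
        Fintype.card_fin]
      ring
    · rcases huv.lt_or_eq with h | rfl
      · have := hp h
        dsimp only
        split_ifs <;> omega
      · exact le_rfl
    · split_ifs <;> omega

end Herman

namespace Herman

/-! ### Sums over directed pairings -/

/-- The difference at which two tokens meet in the given direction. -/
def Dir.target (N : ℕ) : Dir → ℤ
  | .down => 0
  | .up => N

/-- The sign of a direction. -/
def Dir.sign : Dir → ℝ
  | .down => 1
  | .up => -1

theorem collisionSign_eq_sum {N : ℕ} (hN : N ≠ 0) (x : ℤ) :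
    collisionSign N x = ∑ δ : Dir, δ.sign * if x = δ.target N then 1 else 0 := by
  have h : (Finset.univ : Finset Dir) = {Dir.down, Dir.up} := rfl
  have h0 : (0 : ℤ) ≠ N := by exact_mod_cast hN.symm
  rw [h, Finset.sum_pair (by simp)]
  change _ = 1 * (if x = (0 : ℤ) then (1 : ℝ) else 0) + (-1) * if x = (N : ℤ) then (1 : ℝ) else 0
  unfold collisionSign
  split_ifs <;> first | omega | simp

theorem iterate_stepOp_sum {ι L : Type*} [Fintype L] [DecidableEq L] (φ : ℕ → ℕ → ℝ) (N : ℕ)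
    (u v : ι → L) {K : Type*} (s : Finset K) (c : K → ℝ) (f : K → (ι → ℤ) → ℝ) (k : ℕ)
    (x : ι → ℤ) :
    (stepOp φ N u v)^[k] (fun x => ∑ a ∈ s, c a * f a x) x =
      ∑ a ∈ s, c a * (stepOp φ N u v)^[k] (f a) x := by
  induction k generalizing x with
  | zero => rfl
  | succ k ih =>
    simp only [iterate_stepOp_succ, ih, Finset.mul_sum]
    rw [Finset.sum_comm]
    exact Finset.sum_congr rfl fun a _ => Finset.sum_congr rfl fun A _ => mul_left_comm _ _ _

/-- The probability that differences started in `x` are at their targets at time `k`. -/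
noncomputable def targetProb (φ : ℕ → ℕ → ℝ) (N k : ℕ) {ι L : Type*} [Fintype ι] [Fintype L]
    [DecidableEq L] (u v : ι → L) (d : ι → Dir) (x : ι → ℤ) : ℝ :=
  (stepOp φ N u v)^[k] (fun x => if ∀ i, x i = (d i).target N then 1 else 0) x

theorem pairVal_eq_sum (φ : ℕ → ℕ → ℝ) {N : ℕ} (hN : N ≠ 0) (k : ℕ) {m : ℕ} (x : Fin m → ℤ) :
    pairVal φ N k x =
      ∑ d : Fin m → Dir, (∏ i, (d i).sign) * targetProb φ N k slotL slotR d x := by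
  unfold pairVal targetProb
  rw [← iterate_stepOp_sum]
  refine congrFun (congrArg _ ?_) x
  ext y
  simp only [collisionSign_eq_sum hN, Finset.prod_univ_sum, Finset.prod_mul_distrib,
    Fintype.piFinset_univ, Finset.prod_ite_zero, Finset.prod_const_one, Finset.mem_univ,
    true_imp_iff]
  congr!

/-- Two listings of the same pairs differ by a permutation of the slots, which is even; the unpaired
last token is then forced. -/
theorem IsListing.sign_eq {m : ℕ} {σ σ' : Equiv.Perm (Fin (2 * m + 1))}
    {w : Finset (Fin (2 * m + 1) × Fin (2 * m + 1))} (h : IsListing σ w) (h' : IsListing σ' w) :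
    Equiv.Perm.sign σ = Equiv.Perm.sign σ' := by
  have key : ∀ i : Fin m, ∃ j : Fin m,
      σ (slotL j) = σ' (slotL i) ∧ σ (slotR j) = σ' (slotR i) := by
    intro i
    have hi : (σ' (slotL i), σ' (slotR i)) ∈ w :=
      (h' _ _).2 ⟨slotL i, slotR i, by simp [slotL], rfl, rfl, rfl⟩
    obtain ⟨a, b, ha, hb, h1, h2⟩ := (h _ _).1 hi
    obtain ⟨c, hc⟩ := ha
    have hb2 := b.2
    refine ⟨⟨c, by omega⟩, ?_, ?_⟩
    · rw [← h1]; congr 1; ext; simp only [slotL]; omega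
    · rw [← h2]; congr 1; ext; simp only [slotR]; omega
  choose π hl hr using key
  have hπ : Function.Injective π := fun i j hij => by
    have := hl i
    rw [hij, hl j] at this
    exact (slotL_inj.1 (σ'.injective this)).symm
  let π' := Equiv.ofBijective π (Finite.injective_iff_bijective.1 hπ)
  have heq : ∀ x, x ≠ Fin.last _ → σ (pairPerm π' x) = σ' x := by
    intro x hx
    rcases slot_cases x with ⟨i, rfl⟩ | ⟨i, rfl⟩ | rfl
    · rw [pairPerm_slotL]; exact hl i
    · rw [pairPerm_slotR]; exact hr i
    · exact absurd rfl hx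
  have : σ' = σ * pairPerm π' := by
    ext1 x
    by_cases hx : x = Fin.last _
    · subst hx
      obtain ⟨y, hy⟩ := (σ * pairPerm π').surjective (σ' (Fin.last _))
      by_cases hyl : y = Fin.last _
      · rw [← hy, hyl]
      · exact absurd (σ'.injective ((heq y hyl).symm.trans hy)) hyl
    · exact (heq x hx).symm
  rw [this, Equiv.Perm.sign_mul, sign_pairPerm, mul_one]

theorem IsListing.pairingSign_eq {m : ℕ} {σ : Equiv.Perm (Fin (2 * m + 1))}
    {w : Finset (Fin (2 * m + 1) × Fin (2 * m + 1))} (h : IsListing σ w) :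
    pairingSign w = (Equiv.Perm.sign σ : ℤ) := by
  unfold pairingSign
  split_ifs with h1
  · obtain ⟨σ', h', hs⟩ := h1
    rw [h.sign_eq h', hs]; simp
  · have : Equiv.Perm.sign σ ≠ 1 := fun hs => h1 ⟨σ, h, hs⟩
    rw [(Int.units_eq_one_or _).resolve_left this]; simp

/-- The directed pairs at the positions of a word. -/
def listedPairs {m : ℕ} (σ : Equiv.Perm (Fin (2 * m + 1))) (d : Fin m → Dir) :
    Finset (Fin (2 * m + 1) × Fin (2 * m + 1) × Dir) :=
  Finset.univ.image fun i => (σ (slotL i), σ (slotR i), d i)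

theorem listedPairs_injective {m : ℕ} (σ : Equiv.Perm (Fin (2 * m + 1))) (d : Fin m → Dir) :
    Function.Injective fun i => (σ (slotL i), σ (slotR i), d i) := by
  intro i j h
  exact slotL_inj.1 (σ.injective (congrArg Prod.fst h))

theorem undirected_listedPairs {m : ℕ} (σ : Equiv.Perm (Fin (2 * m + 1))) (d : Fin m → Dir) :
    undirected (listedPairs σ d) = Finset.univ.image fun i => (σ (slotL i), σ (slotR i)) := by
  rw [undirected, listedPairs, Finset.image_image]
  rfl

theorem isListing_undirected {m : ℕ} (σ : Equiv.Perm (Fin (2 * m + 1))) (d : Fin m → Dir) :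
    IsListing σ (undirected (listedPairs σ d)) := by
  intro u v
  rw [undirected_listedPairs]
  simp only [Finset.mem_image, Finset.mem_univ, true_and, Prod.mk.injEq]
  constructor
  · rintro ⟨i, rfl, rfl⟩
    exact ⟨slotL i, slotR i, by simp [slotL], rfl, rfl, rfl⟩
  · rintro ⟨a, b, ⟨c, hc⟩, hb, rfl, rfl⟩
    have hb2 := b.2
    refine ⟨⟨c, by omega⟩, ?_, ?_⟩
    · congr 1; ext; simp only [slotL]; omega
    · congr 1; ext; simp only [slotR]; omega

theorem directedSign_listedPairs {m : ℕ} (σ : Equiv.Perm (Fin (2 * m + 1))) (d : Fin m → Dir) :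
    directedSign (listedPairs σ d) = (Equiv.Perm.sign σ : ℤ) * ∏ i, (d i).sign := by
  rw [directedSign, (isListing_undirected σ d).pairingSign_eq]
  congr 1
  rw [listedPairs, Finset.filter_image,
    Finset.card_image_of_injective _ (listedPairs_injective σ d),
    ← Finset.prod_const, Finset.prod_filter]
  refine Finset.prod_congr rfl fun i _ => ?_
  cases h : d i <;> simp [Dir.sign]

theorem mem_directedPairings {m : ℕ} {w : Finset (Fin (2 * m + 1) × Fin (2 * m + 1) × Dir)} :
    w ∈ directedPairings (2 * m + 1) ↔ w.card = m ∧ (undirected w).card = m ∧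
      (∀ e ∈ w, e.1 < e.2.1) ∧ ∃ w₀, ∀ x, x = w₀ ∨ ∃ e ∈ w, x = e.1 ∨ x = e.2.1 := by
  have h : (2 * m + 1 - 1) / 2 = m := by omega
  classical
  unfold directedPairings
  rw [Finset.mem_filter, IsPairing, h]
  simp only [Finset.mem_univ, true_and, undirected, Finset.forall_mem_image,
    Finset.exists_mem_image]

theorem listedPairs_mem_directedPairings {m : ℕ} (σ : Equiv.Perm (Fin (2 * m + 1)))
    (d : Fin m → Dir) (hσ : ∀ i : Fin m, σ (slotL i) < σ (slotR i)) :
    listedPairs σ d ∈ directedPairings (2 * m + 1) := by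
  rw [mem_directedPairings]
  refine ⟨?_, ?_, ?_, σ (Fin.last _), fun x => ?_⟩
  · rw [listedPairs, Finset.card_image_of_injective _ (listedPairs_injective σ d)]; simp
  · rw [undirected_listedPairs, Finset.card_image_of_injective]
    · simp
    · exact fun i j h => slotL_inj.1 (σ.injective (congrArg Prod.fst h))
  · intro e he
    obtain ⟨i, -, rfl⟩ := Finset.mem_image.1 he
    exact hσ i
  · obtain ⟨y, rfl⟩ := σ.surjective x
    rcases slot_cases y with ⟨i, rfl⟩ | ⟨i, rfl⟩ | rfl
    · exact Or.inr ⟨_, Finset.mem_image_of_mem _ (Finset.mem_univ i), Or.inl rfl⟩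
    · exact Or.inr ⟨_, Finset.mem_image_of_mem _ (Finset.mem_univ i), Or.inr rfl⟩
    · exact Or.inl rfl

/-- The listing of the tokens that belongs to an enumeration of the pairs. -/
theorem exists_perm_of_enumeration {m : ℕ} {w : Finset (Fin (2 * m + 1) × Fin (2 * m + 1) × Dir)}
    (hw : w ∈ directedPairings (2 * m + 1)) (e : Fin m ≃ w) :
    ∃ σ : Equiv.Perm (Fin (2 * m + 1)),
      ∀ i, σ (slotL i) = (e i).1.1 ∧ σ (slotR i) = (e i).1.2.1 := by
  obtain ⟨-, -, -, w₀, hw₀⟩ := mem_directedPairings.1 hw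
  let g : (Fin m ⊕ Fin m) ⊕ Unit → Fin (2 * m + 1) :=
    Sum.elim (Sum.elim (fun i => (e i).1.1) fun i => (e i).1.2.1) fun _ => w₀
  have hg : Function.Surjective g := by
    intro x
    rcases hw₀ x with rfl | ⟨a, ha, rfl | rfl⟩
    · exact ⟨Sum.inr (), rfl⟩
    · exact ⟨Sum.inl (Sum.inl (e.symm ⟨a, ha⟩)), by simp [g]⟩
    · exact ⟨Sum.inl (Sum.inr (e.symm ⟨a, ha⟩)), by simp [g]⟩
  have hs : Function.Surjective (g ∘ (slotEquiv m).symm) := hg.comp (slotEquiv m).symm.surjective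
  refine ⟨Equiv.ofBijective _ (Finite.surjective_iff_bijective.1 hs), fun i => ⟨?_, ?_⟩⟩
  · have : (slotEquiv m).symm (slotL i) = Sum.inl (Sum.inl i) := by
      rw [Equiv.symm_apply_eq]; rfl
    simp [this, g]
  · have : (slotEquiv m).symm (slotR i) = Sum.inl (Sum.inr i) := by
      rw [Equiv.symm_apply_eq]; rfl
    simp [this, g]

theorem perm_ext_slots {m : ℕ} {σ τ : Equiv.Perm (Fin (2 * m + 1))}
    (h : ∀ i : Fin m, σ (slotL i) = τ (slotL i) ∧ σ (slotR i) = τ (slotR i)) : σ = τ := by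
  have heq : ∀ x, x ≠ Fin.last _ → σ x = τ x := by
    intro x hx
    rcases slot_cases x with ⟨i, rfl⟩ | ⟨i, rfl⟩ | rfl
    exacts [(h i).1, (h i).2, absurd rfl hx]
  ext1 x
  by_cases hx : x = Fin.last _
  · subst hx
    obtain ⟨y, hy⟩ := σ.surjective (τ (Fin.last _))
    by_cases hyl : y = Fin.last _
    · rw [← hy, hyl]
    · exact absurd (τ.injective ((heq y hyl).symm.trans hy)) hyl
  · exact heq x hx

-- Listings of `w` correspond to enumerations of its m pairs: an enumeration fixes the word outside
-- the last position, and with it the last letter, as well as the directions.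
open Classical in
theorem card_listings {m : ℕ} {w : Finset (Fin (2 * m + 1) × Fin (2 * m + 1) × Dir)}
    (hw : w ∈ directedPairings (2 * m + 1)) :
    ((Finset.univ.filter fun q : Equiv.Perm (Fin (2 * m + 1)) × (Fin m → Dir) =>
      ∀ i : Fin m, q.1 (slotL i) < q.1 (slotR i)).filter
        fun q => listedPairs q.1 q.2 = w).card = m.factorial := by
  obtain ⟨hcard, -, hlt, -⟩ := mem_directedPairings.1 hw
  have hc : Fintype.card (Fin m ≃ w) = m.factorial := by
    rw [Fintype.card_equiv (Fintype.equivOfCardEq (by simp [hcard])), Fintype.card_fin]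
  rw [← hc, ← Finset.card_univ]
  choose σ hσ using fun e : Fin m ≃ w => exists_perm_of_enumeration hw e
  symm
  refine Finset.card_bij (fun e _ => (σ e, fun i => (e i).1.2.2)) (fun e _ => ?_)
    (fun e _ e' _ h => ?_) (fun q hq => ?_)
  · rw [Finset.mem_filter, Finset.mem_filter]
    refine ⟨⟨Finset.mem_univ _, fun i => ?_⟩, ?_⟩
    · rw [(hσ e i).1, (hσ e i).2]
      exact hlt _ (e i).2
    · ext a
      simp only [listedPairs, Finset.mem_image, Finset.mem_univ, true_and, hσ]
      constructor
      · rintro ⟨i, rfl⟩; exact (e i).2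
      · intro ha; exact ⟨e.symm ⟨a, ha⟩, by simp⟩
  · ext i : 2
    have h1 := congrArg Prod.fst h
    have h2 := congrFun (congrArg Prod.snd h) i
    simp only at h1 h2
    have h3 := hσ e i
    rw [h1, (hσ e' i).1, (hσ e' i).2] at h3
    exact Prod.ext h3.1.symm (Prod.ext h3.2.symm h2)
  · rw [Finset.mem_filter, Finset.mem_filter] at hq
    obtain ⟨⟨-, hq⟩, rfl⟩ := hq
    let g : Fin m → ↥(listedPairs q.1 q.2) := fun i =>
      ⟨(q.1 (slotL i), q.1 (slotR i), q.2 i), Finset.mem_image_of_mem _ (Finset.mem_univ i)⟩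
    have hg : Function.Bijective g := by
      constructor
      · intro i j h
        exact listedPairs_injective q.1 q.2 (congrArg Subtype.val h)
      · rintro ⟨a, ha⟩
        obtain ⟨i, -, rfl⟩ := Finset.mem_image.1 ha
        exact ⟨i, rfl⟩
    refine ⟨Equiv.ofBijective g hg, Finset.mem_univ _, Prod.ext (perm_ext_slots fun i => ?_) rfl⟩
    exact hσ (Equiv.ofBijective g hg) i

/-- The probability that the pairs in `w` have collided in the prescribed directions at time `k`,
for tokens started at the positions `p`. -/
noncomputable def pairingProb (φ : ℕ → ℕ → ℝ) (N k : ℕ) {M : ℕ} (p : Fin M → ℤ)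
    (w : Finset (Fin M × Fin M × Dir)) : ℝ :=
  targetProb φ N k (fun e : w => e.1.1) (fun e => e.1.2.1) (fun e => e.1.2.2)
    fun e => p e.1.2.1 - p e.1.1

/-- `σ` is merely a relabelling of the tokens, and for pairs listed in increasing order the cyclic
distance is the plain difference of positions. -/
theorem pairingProb_listedPairs {φ : ℕ → ℕ → ℝ} (hφ : Consistent φ) (N k : ℕ) {m : ℕ}
    (p : Fin (2 * m + 1) → ℤ) (σ : Equiv.Perm (Fin (2 * m + 1))) (d : Fin m → Dir)
    (hσ : ∀ i : Fin m, σ (slotL i) < σ (slotR i)) :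
    pairingProb φ N k p (listedPairs σ d) =
      targetProb φ N k slotL slotR d fun i => cycDist N p (σ (slotL i)) (σ (slotR i)) := by
  let j : Fin m → ↥(listedPairs σ d) := fun i =>
      ⟨(σ (slotL i), σ (slotR i), d i), Finset.mem_image_of_mem _ (Finset.mem_univ i)⟩
  have hj : Function.Surjective j := by
    rintro ⟨a, ha⟩
    obtain ⟨i, -, rfl⟩ := Finset.mem_image.1 ha
    exact ⟨i, rfl⟩
  have hr : ∀ e, ¬ e ∉ Set.range j := fun e h => h (hj e)
  unfold pairingProb targetProb
  rw [iterate_stepOp_comap hφ N (u' := slotL) (v' := slotR) σ.toEmbedding j (fun i => rfl)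
    (fun i => rfl) _ (fun e he => absurd he (hr e)) 1
    (f' := fun x => if ∀ i, x i = (d i).target N then 1 else 0) (fun x _ => ?_) k _
    (fun _ _ => rfl), one_mul]
  · have : (fun e : ↥(listedPairs σ d) => p e.1.2.1 - p e.1.1) ∘ j =
        fun i => cycDist N p (σ (slotL i)) (σ (slotR i)) := by
      ext i
      simp [j, cycDist, (hσ i).le]
    rw [this]
    congr!
  · rw [one_mul]
    refine if_congr ⟨fun h i => h (j i), fun h e => ?_⟩ rfl rfl
    obtain ⟨i, rfl⟩ := hj e
    exact h i

-- In each slot the two orders of its letters give equal terms and exactly one of them is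
-- increasing. Fixing the order slot by slot yields a factor 2 each time.
open Classical in
theorem pfaffianSum_eq_oriented (φ : ℕ → ℕ → ℝ) {N : ℕ} (hN : N ≠ 0) (k : ℕ) {m : ℕ}
    (p : Fin (2 * m + 1) → ℤ) :
    pfaffianSum φ N k p = 2 ^ m * ∑ σ, if ∀ i : Fin m, σ (slotL i) < σ (slotR i) then
      pfaffianTerm φ N k p σ else 0 := by
  have key : ∀ s : Finset (Fin m), pfaffianSum φ N k p = 2 ^ s.card * ∑ σ,
      if ∀ i ∈ s, σ (slotL i) < σ (slotR i) then pfaffianTerm φ N k p σ else 0 := by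
    intro s
    induction s using Finset.induction_on with
    | empty => simp [pfaffianSum]
    | insert a s ha ih =>
      rw [ih, Finset.card_insert_of_notMem ha, pow_succ, mul_assoc]
      congr 1
      have hsw := Equiv.sum_comp (Equiv.mulRight (Equiv.swap (slotL a) (slotR a)))
        fun σ => if ∀ i ∈ insert a s, σ (slotL i) < σ (slotR i) then pfaffianTerm φ N k p σ else 0
      rw [two_mul (α := ℝ)]
      conv_rhs => arg 2; rw [← hsw]
      rw [← Finset.sum_add_distrib]
      refine Finset.sum_congr rfl fun σ _ => ?_
      rw [Equiv.coe_mulRight, pfaffianTerm_mul_swap φ hN]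
      have h1 : (∀ i ∈ insert a s, (σ * Equiv.swap (slotL a) (slotR a)) (slotL i) <
          (σ * Equiv.swap (slotL a) (slotR a)) (slotR i)) ↔
          σ (slotR a) < σ (slotL a) ∧ ∀ i ∈ s, σ (slotL i) < σ (slotR i) := by
        rw [Finset.forall_mem_insert, Equiv.Perm.mul_apply, Equiv.Perm.mul_apply,
          Equiv.swap_apply_left, Equiv.swap_apply_right]
        refine and_congr_right fun _ => forall₂_congr fun i hi => ?_
        have hia : i ≠ a := fun h => ha (h ▸ hi)
        rw [Equiv.Perm.mul_apply, Equiv.Perm.mul_apply,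
          Equiv.swap_apply_of_ne_of_ne (by simpa [slotL_inj] using hia) (slotL_ne_slotR _ _),
          Equiv.swap_apply_of_ne_of_ne (slotL_ne_slotR _ _).symm (by simpa [slotR_inj] using hia)]
      have h2 : σ (slotL a) ≠ σ (slotR a) := σ.injective.ne (slotL_ne_slotR a a)
      rw [if_congr h1 rfl rfl, if_congr (Finset.forall_mem_insert _ _ _) rfl rfl]
      rcases lt_or_gt_of_ne h2 with h | h
      · simp [h, h.le]
      · simp [h, h.le]
  have := key Finset.univ
  simpa using this

theorem pfaffianSum_eq_sum_directedPairings {φ : ℕ → ℕ → ℝ} (hφ : Consistent φ) {N : ℕ}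
    (hN : N ≠ 0) (k : ℕ) {m : ℕ} (p : Fin (2 * m + 1) → ℤ) :
    pfaffianSum φ N k p = 2 ^ m * m.factorial *
      ∑ w ∈ directedPairings (2 * m + 1), directedSign w * pairingProb φ N k p w := by
  classical
  set S := Finset.univ.filter fun q : Equiv.Perm (Fin (2 * m + 1)) × (Fin m → Dir) =>
      ∀ i : Fin m, q.1 (slotL i) < q.1 (slotR i) with hS
  have h1 : (∑ σ, if ∀ i : Fin m, σ (slotL i) < σ (slotR i) then
      pfaffianTerm φ N k p σ else 0) = ∑ q ∈ S,
        directedSign (listedPairs q.1 q.2) * pairingProb φ N k p (listedPairs q.1 q.2) := by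
    rw [hS, Finset.sum_filter, Fintype.sum_prod_type]
    refine Finset.sum_congr rfl fun σ _ => ?_
    simp only
    split_ifs with h
    · rw [pfaffianTerm, pairVal_eq_sum φ hN, Finset.mul_sum]
      refine Finset.sum_congr rfl fun d _ => ?_
      rw [directedSign_listedPairs, pairingProb_listedPairs hφ N k p σ d h, mul_assoc]
    · simp
  rw [pfaffianSum_eq_oriented φ hN, h1, mul_assoc]
  congr 1
  -- Grouping the increasing listings by the directed pairing they list yields m! equal summands for
  -- each.
  rw [← Finset.sum_fiberwise_of_maps_to (s := S) (t := directedPairings (2 * m + 1))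
    (g := fun q => listedPairs q.1 q.2), Finset.mul_sum]
  · refine Finset.sum_congr rfl fun w hw => ?_
    rw [Finset.sum_congr rfl (g := fun _ => directedSign w * pairingProb φ N k p w)
      fun q hq => by rw [(Finset.mem_filter.1 hq).2], Finset.sum_const, card_listings hw,
      nsmul_eq_mul]
  · intro q hq
    exact listedPairs_mem_directedPairings _ _ (Finset.mem_filter.1 hq).2

/-- The probability that a single token is left, as a sum over directed pairings. -/
theorem singleProb_eq_sum {φ : ℕ → ℕ → ℝ} (hφ : Consistent φ) {N : ℕ} [NeZero N] (k : ℕ) {m : ℕ}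
    {p : Fin (2 * m + 1) → ℤ} (hp : Monotone p) (hpN : p (Fin.last _) ≤ p 0 + N) :
    singleProb φ k (oddConfig N p) =
      ∑ w ∈ directedPairings (2 * m + 1), directedSign w * pairingProb φ N k p w := by
  have h := singleFormula hφ N k p hp hpN
  rw [SingleFormula, pfaffianSum_eq_sum_directedPairings hφ (NeZero.ne N)] at h
  exact (mul_left_cancel₀ (by positivity) h).symm

end Herman

namespace Herman

/-! ### Long-time behaviour -/

/-- Weights that define a nondegenerate probability law for at most `n₀` tokens. -/
structure Weights (φ : ℕ → ℕ → ℝ) (n₀ : ℕ) : Prop where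
  consistent : Consistent φ
  zero : φ 0 0 = 1
  nonneg : ∀ n ≤ n₀, ∀ k, 0 ≤ φ n k
  pos : ∀ n ≤ n₀, 0 < n → 0 < φ n 1

section Free

set_option linter.unusedSectionVars false

variable {ι L : Type*} [Fintype ι] [Fintype L] [DecidableEq L]

/-- The states in which all differences are between `0` and `N`. -/
def InBox (N : ℕ) (x : ι → ℤ) : Prop := ∀ i, 0 ≤ x i ∧ x i ≤ N

theorem InBox.stoppedStep {N : ℕ} {x : ι → ℤ} (hx : InBox N x) (u v : ι → L) (A : Finset L) :
    InBox N (stoppedStep N u v x A) := by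
  intro i
  have := hx i
  unfold Herman.stoppedStep
  split_ifs <;> omega

/-- Some difference has not reached `0` or `N`. -/
def Pending (N : ℕ) (x : ι → ℤ) : Prop := ∃ i, x i ≠ 0 ∧ x i ≠ N

theorem stoppedStep_of_not_pending {N : ℕ} {x : ι → ℤ} (hx : ¬ Pending N x) (u v : ι → L)
    (A : Finset L) : stoppedStep N u v x A = x := by
  ext i
  have : x i = 0 ∨ x i = N := by
    by_contra h
    push Not at h
    exact hx ⟨i, h⟩
  rw [stoppedStep, if_pos this]

open Classical in
/-- The indicator function of `Pending`. -/
noncomputable def pendingInd (N : ℕ) (x : ι → ℤ) : ℝ := if Pending N x then 1 else 0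

theorem pendingInd_nonneg (N : ℕ) (x : ι → ℤ) : 0 ≤ pendingInd N x := by
  unfold pendingInd; split_ifs <;> simp

theorem stepOp_mono {φ : ℕ → ℕ → ℝ} {n₀ : ℕ} (hφ : Weights φ n₀) (hL : Fintype.card L ≤ n₀)
    (N : ℕ) (u v : ι → L) {f g : (ι → ℤ) → ℝ} (h : ∀ x, InBox N x → f x ≤ g x) (x : ι → ℤ)
    (hx : InBox N x) : stepOp φ N u v f x ≤ stepOp φ N u v g x :=
  Finset.sum_le_sum fun A _ =>
    mul_le_mul_of_nonneg_left (h _ (hx.stoppedStep u v A)) (hφ.nonneg _ hL _)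

theorem iterate_stepOp_mono {φ : ℕ → ℕ → ℝ} {n₀ : ℕ} (hφ : Weights φ n₀)
    (hL : Fintype.card L ≤ n₀) (N : ℕ) (u v : ι → L) {f g : (ι → ℤ) → ℝ}
    (h : ∀ x, InBox N x → f x ≤ g x) (k : ℕ) (x : ι → ℤ) (hx : InBox N x) :
    (stepOp φ N u v)^[k] f x ≤ (stepOp φ N u v)^[k] g x := by
  induction k generalizing x with
  | zero => exact h x hx
  | succ k ih =>
    rw [Function.iterate_succ_apply', Function.iterate_succ_apply']
    exact stepOp_mono hφ hL N u v ih x hx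

theorem iterate_stepOp_add (φ : ℕ → ℕ → ℝ) (N : ℕ) (u v : ι → L) (f g : (ι → ℤ) → ℝ) (k : ℕ)
    (x : ι → ℤ) : (stepOp φ N u v)^[k] (fun x => f x + g x) x =
      (stepOp φ N u v)^[k] f x + (stepOp φ N u v)^[k] g x := by
  have := iterate_stepOp_sum φ N u v (Finset.univ : Finset Bool) (fun _ => 1)
    (fun b => if b then f else g) k x
  simpa using this

theorem iterate_stepOp_nonneg {φ : ℕ → ℕ → ℝ} {n₀ : ℕ} (hφ : Weights φ n₀)
    (hL : Fintype.card L ≤ n₀) (N : ℕ) (u v : ι → L) {f : (ι → ℤ) → ℝ}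
    (h : ∀ x, 0 ≤ f x) (k : ℕ) (x : ι → ℤ) : 0 ≤ (stepOp φ N u v)^[k] f x := by
  induction k generalizing x with
  | zero => exact h x
  | succ k ih =>
    rw [iterate_stepOp_succ]
    exact Finset.sum_nonneg fun A _ => mul_nonneg (hφ.nonneg _ hL _) (ih _)

theorem iterate_stepOp_le_one {φ : ℕ → ℕ → ℝ} {n₀ : ℕ} (hφ : Weights φ n₀)
    (hL : Fintype.card L ≤ n₀) (N : ℕ) (u v : ι → L) {f : (ι → ℤ) → ℝ}
    (h : ∀ x, f x ≤ 1) (k : ℕ) (x : ι → ℤ) : (stepOp φ N u v)^[k] f x ≤ 1 := by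
  induction k generalizing x with
  | zero => exact h x
  | succ k ih =>
    rw [iterate_stepOp_succ, ← hφ.consistent.sum_weights hφ.zero L]
    exact Finset.sum_le_sum fun A _ => mul_le_of_le_one_right (hφ.nonneg _ hL _) (ih _)

/-- The expectation of a function of the movements of two tokens. -/
theorem Consistent.sum_two {φ : ℕ → ℕ → ℝ} (hφ : Consistent φ) {a b : L} (hab : a ≠ b)
    (g : ℝ → ℝ → ℝ) :
    ∑ A : Finset L, φ (Fintype.card L) A.card *
      g (if a ∈ A then 1 else 0) (if b ∈ A then 1 else 0) =
      φ 2 0 * g 0 0 + φ 2 1 * g 1 0 + φ 2 1 * g 0 1 + φ 2 2 * g 1 1 := by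
  let F : Bool ↪ L := ⟨fun c => if c then a else b, by
    intro c d h
    cases c <;> cases d <;> simp_all [hab.symm]⟩
  have h := hφ.sum_preimage F
    fun B => g (if true ∈ B then 1 else 0) (if false ∈ B then 1 else 0)
  simp only [Finset.mem_filter, Finset.mem_univ, true_and] at h
  have h2 : (Finset.univ : Finset (Finset Bool)) = {∅, {true}, {false}, {true, false}} := by decide
  rw [show F true = a from rfl, show F false = b from rfl] at h
  rw [h2, Finset.sum_insert (by decide), Finset.sum_insert (by decide),
    Finset.sum_insert (by decide), Finset.sum_singleton] at h
  simpa [add_assoc] using h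

/-- A Lyapunov function for the stopped differences. -/
theorem stepOp_quadratic_le {φ : ℕ → ℕ → ℝ} {n₀ : ℕ} (hφ : Weights φ n₀) (h2 : 2 ≤ n₀)
    (N : ℕ) {u v : ι → L} (huv : ∀ i, u i ≠ v i) (x : ι → ℤ) :
    2 * φ 2 1 * pendingInd N x + stepOp φ N u v (fun x => ∑ i, (x i : ℝ) * (N - x i)) x ≤
      ∑ i, (x i : ℝ) * (N - x i) := by
  classical
  have hpos := hφ.pos 2 h2 two_pos
  have hw := hφ.consistent.sum_weights hφ.zero L
  -- The increment of a running difference has mean 0 and second moment 2 φ(2,1), so x(N - x) loses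
  -- exactly 2 φ(2,1) on average.
  have key : ∀ i, ∑ A : Finset L, φ (Fintype.card L) A.card *
      ((stoppedStep N u v x A i : ℝ) * (N - stoppedStep N u v x A i)) =
      (x i : ℝ) * (N - x i) - if x i ≠ 0 ∧ x i ≠ N then 2 * φ 2 1 else 0 := by
    intro i
    by_cases hi : x i = 0 ∨ x i = N
    · have h1 : ∀ A, stoppedStep N u v x A i = x i := fun A => by rw [stoppedStep, if_pos hi]
      simp only [h1]
      rw [← Finset.sum_mul, hw, if_neg (by tauto)]
      ring
    · have h1 : ∀ A, (stoppedStep N u v x A i : ℝ) =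
          x i + (if v i ∈ A then 1 else 0) - (if u i ∈ A then 1 else 0) := fun A => by
        rw [stoppedStep, if_neg hi]; push_cast; rfl
      simp only [h1]
      have h4 := hφ.consistent.sum_two (huv i)
        fun a b => ((x i : ℝ) + b - a) * (N - (x i + b - a))
      have h5 : φ 2 0 + φ 2 1 + φ 2 1 + φ 2 2 = 1 := by
        have h6 := hφ.consistent.sum_two (huv i) fun _ _ => 1
        simp only [mul_one, hw] at h6
        exact h6.symm
      rw [if_pos (by tauto), h4]
      have h7 : φ 2 0 = 1 - φ 2 1 - φ 2 1 - φ 2 2 := by linarith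
      rw [h7]
      ring
  have hsum : stepOp φ N u v (fun x => ∑ i, (x i : ℝ) * (N - x i)) x =
      ∑ i, ((x i : ℝ) * (N - x i) - if x i ≠ 0 ∧ x i ≠ N then 2 * φ 2 1 else 0) := by
    simp only [stepOp, Finset.mul_sum]
    rw [Finset.sum_comm]
    exact Finset.sum_congr rfl fun i _ => key i
  rw [hsum, Finset.sum_sub_distrib]
  have : 2 * φ 2 1 * pendingInd N x ≤ ∑ i, if x i ≠ 0 ∧ x i ≠ N then 2 * φ 2 1 else 0 := by
    have hnn : ∀ i ∈ (Finset.univ : Finset ι),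
        0 ≤ if x i ≠ 0 ∧ x i ≠ N then 2 * φ 2 1 else 0 := by
      intro i _; split_ifs <;> linarith
    unfold pendingInd
    split_ifs with h
    · obtain ⟨i, hi⟩ := h
      have := Finset.single_le_sum hnn (Finset.mem_univ i)
      rw [if_pos hi] at this
      linarith
    · simpa using Finset.sum_nonneg hnn
  linarith

/-- Iterating the drift inequality, the expected number of pending steps times 2 φ(2,1) stays below
the initial value of the Lyapunov function, which is nonnegative on the box. -/
theorem summable_pending {φ : ℕ → ℕ → ℝ} {n₀ : ℕ} (hφ : Weights φ n₀) (h2 : 2 ≤ n₀)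
    (hL : Fintype.card L ≤ n₀) (N : ℕ) {u v : ι → L} (huv : ∀ i, u i ≠ v i) (x : ι → ℤ)
    (hx : InBox N x) :
    Summable fun k => (stepOp φ N u v)^[k] (pendingInd N) x := by
  have hpos := hφ.pos 2 h2 two_pos
  have key : ∀ n x, InBox N x → ∑ k ∈ Finset.range n,
      2 * φ 2 1 * (stepOp φ N u v)^[k] (pendingInd N) x ≤ ∑ i, (x i : ℝ) * (N - x i) := by
    intro n
    induction n with
    | zero =>
      intro x hx
      rw [Finset.sum_range_zero]
      refine Finset.sum_nonneg fun i _ => mul_nonneg ?_ ?_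
      · exact_mod_cast (hx i).1
      · have : (x i : ℝ) ≤ N := by exact_mod_cast (hx i).2
        linarith
    | succ n ih =>
      intro x hx
      rw [Finset.sum_range_succ', add_comm]
      refine le_trans ?_ (stepOp_quadratic_le hφ h2 N huv x)
      refine add_le_add_right ?_ _
      refine le_trans (le_of_eq ?_) (stepOp_mono hφ hL N u v ih x hx)
      simp only [iterate_stepOp_succ, stepOp, Finset.mul_sum]
      rw [Finset.sum_comm]
      exact Finset.sum_congr rfl fun A _ => Finset.sum_congr rfl fun k _ => mul_left_comm _ _ _
  have hs : Summable fun k => 2 * φ 2 1 * (stepOp φ N u v)^[k] (pendingInd N) x :=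
    summable_of_sum_range_le (fun k => mul_nonneg (by linarith)
      (iterate_stepOp_nonneg hφ hL N u v (pendingInd_nonneg N) k x)) fun n => key n x hx
  exact (summable_mul_left_iff (by positivity)).1 hs

/-- The probability that differences started in `x` reach their targets. -/
noncomputable def targetLimit (φ : ℕ → ℕ → ℝ) (N : ℕ) (u v : ι → L) (d : ι → Dir) (x : ι → ℤ) : ℝ :=
  ⨆ k, targetProb φ N k u v d x

theorem targetProb_nonneg {φ : ℕ → ℕ → ℝ} {n₀ : ℕ} (hφ : Weights φ n₀)
    (hL : Fintype.card L ≤ n₀) (N k : ℕ) (u v : ι → L) (d : ι → Dir) (x : ι → ℤ) :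
    0 ≤ targetProb φ N k u v d x :=
  iterate_stepOp_nonneg hφ hL N u v (fun x => by split_ifs <;> simp) k x

theorem targetProb_le_one {φ : ℕ → ℕ → ℝ} {n₀ : ℕ} (hφ : Weights φ n₀)
    (hL : Fintype.card L ≤ n₀) (N k : ℕ) (u v : ι → L) (d : ι → Dir) (x : ι → ℤ) :
    targetProb φ N k u v d x ≤ 1 :=
  iterate_stepOp_le_one hφ hL N u v (fun x => by split_ifs <;> simp) k x

theorem iterate_stepOp_of_not_pending {φ : ℕ → ℕ → ℝ} (hφ : Consistent φ) (h0 : φ 0 0 = 1) {N : ℕ}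
    {x : ι → ℤ} (hx : ¬ Pending N x) (u v : ι → L) (f : (ι → ℤ) → ℝ) (k : ℕ) :
    (stepOp φ N u v)^[k] f x = f x := by
  induction k with
  | zero => rfl
  | succ k ih =>
    rw [iterate_stepOp_succ]
    simp only [stoppedStep_of_not_pending hx, ih]
    rw [← Finset.sum_mul, hφ.sum_weights h0, one_mul]

theorem not_pending_of_target {N : ℕ} {d : ι → Dir} {x : ι → ℤ}
    (hx : ∀ i, x i = (d i).target N) : ¬ Pending N x := by
  rintro ⟨i, h0, hN⟩
  have := hx i
  cases h : d i <;> simp_all [Dir.target]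

/-- The target is absorbing, and only mass still pending at time `k` can reach it later. -/
theorem targetProb_add {φ : ℕ → ℕ → ℝ} {n₀ : ℕ} (hφ : Weights φ n₀)
    (hL : Fintype.card L ≤ n₀) (N k n : ℕ) (u v : ι → L) (d : ι → Dir) {x : ι → ℤ}
    (hx : InBox N x) :
    targetProb φ N k u v d x ≤ targetProb φ N (k + n) u v d x ∧
      targetProb φ N (k + n) u v d x ≤
        targetProb φ N k u v d x + (stepOp φ N u v)^[k] (pendingInd N) x := by
  have h1 : ∀ y : ι → ℤ, (if ∀ i, y i = (d i).target N then (1 : ℝ) else 0) ≤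
      targetProb φ N n u v d y := by
    intro y
    split_ifs with h
    · rw [targetProb, iterate_stepOp_of_not_pending hφ.consistent hφ.zero
        (not_pending_of_target h), if_pos h]
    · exact targetProb_nonneg hφ hL N n u v d y
  have h2 : ∀ y : ι → ℤ, targetProb φ N n u v d y ≤
      (if ∀ i, y i = (d i).target N then (1 : ℝ) else 0) + pendingInd N y := by
    intro y
    by_cases h : Pending N y
    · rw [pendingInd, if_pos h]
      have := targetProb_le_one hφ hL N n u v d y
      split_ifs <;> linarith
    · rw [targetProb, iterate_stepOp_of_not_pending hφ.consistent hφ.zero h]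
      linarith [pendingInd_nonneg N y]
  have h3 : targetProb φ N (k + n) u v d x =
      (stepOp φ N u v)^[k] (targetProb φ N n u v d) x := by
    unfold targetProb
    rw [Function.iterate_add_apply]
  rw [h3]
  refine ⟨iterate_stepOp_mono hφ hL N u v (fun y _ => h1 y) k x hx, ?_⟩
  rw [targetProb, ← iterate_stepOp_add]
  exact iterate_stepOp_mono hφ hL N u v (fun y _ => h2 y) k x hx

theorem tendsto_targetProb {φ : ℕ → ℕ → ℝ} {n₀ : ℕ} (hφ : Weights φ n₀)
    (hL : Fintype.card L ≤ n₀) (N : ℕ) (u v : ι → L) (d : ι → Dir) {x : ι → ℤ}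
    (hx : InBox N x) :
    Tendsto (fun k => targetProb φ N k u v d x) atTop (𝓝 (targetLimit φ N u v d x)) := by
  refine tendsto_atTop_ciSup (monotone_nat_of_le_succ fun k => ?_)
    ⟨1, by rintro _ ⟨k, rfl⟩; exact targetProb_le_one hφ hL N k u v d x⟩
  exact (targetProb_add hφ hL N k 1 u v d hx).1

theorem targetLimit_sub {φ : ℕ → ℕ → ℝ} {n₀ : ℕ} (hφ : Weights φ n₀)
    (hL : Fintype.card L ≤ n₀) (N k : ℕ) (u v : ι → L) (d : ι → Dir) {x : ι → ℤ}
    (hx : InBox N x) :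
    0 ≤ targetLimit φ N u v d x - targetProb φ N k u v d x ∧
      targetLimit φ N u v d x - targetProb φ N k u v d x ≤
        (stepOp φ N u v)^[k] (pendingInd N) x := by
  have h := (tendsto_add_atTop_iff_nat k).2 (tendsto_targetProb hφ hL N u v d hx)
  constructor
  · refine sub_nonneg.2 (ge_of_tendsto' h fun n => ?_)
    rw [add_comm]
    exact (targetProb_add hφ hL N k n u v d hx).1
  · refine sub_le_iff_le_add'.2 (le_of_tendsto' h fun n => ?_)
    rw [add_comm]
    exact (targetProb_add hφ hL N k n u v d hx).2

theorem summable_targetLimit_sub {φ : ℕ → ℕ → ℝ} {n₀ : ℕ} (hφ : Weights φ n₀) (h2 : 2 ≤ n₀)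
    (hL : Fintype.card L ≤ n₀) (N : ℕ) {u v : ι → L} (huv : ∀ i, u i ≠ v i) (d : ι → Dir)
    {x : ι → ℤ} (hx : InBox N x) :
    Summable fun k => targetLimit φ N u v d x - targetProb φ N k u v d x :=
  Summable.of_nonneg_of_le (fun k => (targetLimit_sub hφ hL N k u v d hx).1)
    (fun k => (targetLimit_sub hφ hL N k u v d hx).2) (summable_pending hφ h2 hL N huv x hx)

/-- A favourable path moves one token at a time: `u i` if the pair should meet down, `v i` if up.
The pairs are disjoint, so the other differences stay put, and `n`, the total distance from the
targets, drops by one with positive weight. -/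
theorem exists_targetProb_pos {φ : ℕ → ℕ → ℝ} {n₀ : ℕ} (hφ : Weights φ n₀)
    (hL : Fintype.card L ≤ n₀) (N : ℕ) {u v : ι → L} (huv : Function.Injective (Sum.elim u v))
    (d : ι → Dir) (n : ℕ) (x : ι → ℤ) (hx : InBox N x)
    (hd : ∀ i, x i = 0 ∨ x i = N → x i = (d i).target N)
    (hn : ∑ i, (x i - (d i).target N).natAbs = n) : ∃ k, 0 < targetProb φ N k u v d x := by
  classical
  induction n generalizing x with
  | zero =>
    refine ⟨0, ?_⟩
    have : ∀ i, x i = (d i).target N := by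
      intro i
      have := (Finset.sum_eq_zero_iff.1 hn) i (Finset.mem_univ i)
      omega
    simp [targetProb, this]
  | succ n ih =>
    obtain ⟨i, hi⟩ : ∃ i, x i ≠ (d i).target N := by
      by_contra h
      push Not at h
      simp [h] at hn
    have hi' : ¬ (x i = 0 ∨ x i = N) := fun h => hi (hd i h)
    have hxi := hx i
    have huvi : u i ≠ v i := fun h => by
      simpa using huv (show Sum.elim u v (Sum.inl i) = Sum.elim u v (Sum.inr i) from h)
    have hne : ∀ j, j ≠ i → u j ≠ u i ∧ u j ≠ v i ∧ v j ≠ u i ∧ v j ≠ v i := by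
      intro j hj
      refine ⟨fun h => hj ?_, fun h => ?_, fun h => ?_, fun h => hj ?_⟩
      · simpa using huv (show Sum.elim u v (Sum.inl j) = Sum.elim u v (Sum.inl i) from h)
      · simpa using huv (show Sum.elim u v (Sum.inl j) = Sum.elim u v (Sum.inr i) from h)
      · simpa using huv (show Sum.elim u v (Sum.inr j) = Sum.elim u v (Sum.inl i) from h)
      · simpa using huv (show Sum.elim u v (Sum.inr j) = Sum.elim u v (Sum.inr i) from h)
    obtain ⟨t, s, hts, hdist⟩ : ∃ (t : L) (s : ℤ), stoppedStep N u v x {t} =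
        Function.update x i (x i + s) ∧
        (x i + s - (d i).target N).natAbs + 1 = (x i - (d i).target N).natAbs := by
      cases hdi : d i with
      | down =>
        refine ⟨u i, -1, ?_, ?_⟩
        · ext j
          rcases eq_or_ne j i with rfl | hj
          · rw [Function.update_self, stoppedStep, if_neg hi']
            simp [huvi.symm, sub_eq_add_neg]
          · rw [Function.update_of_ne hj, stoppedStep]
            simp [hne j hj]
        · simp only [Dir.target]; omega
      | up =>
        refine ⟨v i, 1, ?_, ?_⟩
        · ext j
          rcases eq_or_ne j i with rfl | hj
          · rw [Function.update_self, stoppedStep, if_neg hi']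
            simp [huvi]
          · rw [Function.update_of_ne hj, stoppedStep]
            simp [hne j hj]
        · simp only [Dir.target]; omega
    have hcard : 0 < Fintype.card L := Fintype.card_pos_iff.2 ⟨t⟩
    have hbox := hx.stoppedStep u v {t}
    obtain ⟨k, hk⟩ := ih (stoppedStep N u v x {t}) hbox (fun j hj => by
        rw [hts] at hj ⊢
        rcases eq_or_ne j i with rfl | hji
        · rw [Function.update_self] at hj ⊢
          cases hdi : d j <;> rw [hdi] at hdist <;> simp only [Dir.target] at hdist ⊢ <;> omega
        · rw [Function.update_of_ne hji] at hj ⊢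
          exact hd j hj) (by
        rw [hts, ← Finset.add_sum_erase _ _ (Finset.mem_univ i), Function.update_self]
        rw [← Finset.add_sum_erase _ _ (Finset.mem_univ i)] at hn
        rw [Finset.sum_congr rfl fun j hj => by
          rw [Function.update_of_ne (Finset.ne_of_mem_erase hj)]]
        omega)
    refine ⟨k + 1, ?_⟩
    rw [targetProb, iterate_stepOp_succ]
    refine Finset.sum_pos' (fun A _ => mul_nonneg (hφ.nonneg _ hL _)
      (targetProb_nonneg hφ hL N k u v d _)) ⟨{t}, Finset.mem_univ _, ?_⟩
    rw [Finset.card_singleton]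
    exact mul_pos (hφ.pos _ hL hcard) hk

theorem targetLimit_pos {φ : ℕ → ℕ → ℝ} {n₀ : ℕ} (hφ : Weights φ n₀)
    (hL : Fintype.card L ≤ n₀) (N : ℕ) {u v : ι → L} (huv : Function.Injective (Sum.elim u v))
    (d : ι → Dir) {x : ι → ℤ} (hx : ∀ i, 0 < x i ∧ x i < N) : 0 < targetLimit φ N u v d x := by
  have hb : InBox N x := fun i => ⟨(hx i).1.le, (hx i).2.le⟩
  obtain ⟨k, hk⟩ := exists_targetProb_pos hφ hL N huv d _ x hb
    (fun i hi => by have := hx i; omega) rfl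
  have := (targetLimit_sub hφ hL N k u v d hb).1
  linarith

end Free

end Herman

/-! ### Absorption of the annihilating system and summation over time -/

namespace Herman

section Ring

set_option linter.unusedSectionVars false

variable {N : ℕ}

theorem card_pass_le {c A : Config N} (hA : A ⊆ c) : (pass c A).card ≤ c.card := by
  have h1 : (pass c A).card ≤ (c \ A).card + (A.image (· + 1)).card := by
    refine (Finset.card_le_card ?_).trans (Finset.card_union_le _ _)
    exact symmDiff_le_sup
  have h2 := Finset.card_image_le (s := A) (f := (· + 1))
  have h3 := Finset.card_sdiff_add_card_eq_card hA
  omega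

/-- Each annihilation removes two tokens. -/
theorem odd_card_pass {c A : Config N} (hA : A ⊆ c) (hc : Odd c.card) : Odd (pass c A).card := by
  have h2 : (A.image (· + 1)).card = A.card :=
    Finset.card_image_of_injective _ (add_left_injective 1)
  have h3 := Finset.card_sdiff_add_card_eq_card hA
  have h4 : (pass c A).card =
      ((c \ A) \ A.image (· + 1)).card + (A.image (· + 1) \ (c \ A)).card := by
    rw [pass, symmDiff_def, Finset.sup_eq_union, Finset.card_union_of_disjoint]
    exact disjoint_sdiff_sdiff
  have h5 := Finset.card_sdiff_add_card_inter (c \ A) (A.image (· + 1))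
  have h6 := Finset.card_sdiff_add_card_inter (A.image (· + 1)) (c \ A)
  rw [Finset.inter_comm] at h6
  rw [Nat.odd_iff] at hc ⊢
  omega

/-- One token is walked clockwise until it runs into another. This lowers the number of tokens, and
parity prevents it from reaching zero, so repetition ends with one token. -/
theorem exists_single_of_closed [NeZero N] {Q : Config N → Prop}
    (hQ : ∀ c p, Q c → p ∈ c → Q (pass c {p})) {c : Config N} (hc : Q c) (hodd : Odd c.card) :
    ∃ c', Q c' ∧ c'.card = 1 := by
  have key : ∀ (n : ℕ) (c : Config N), c.card ≤ n → Q c → Odd c.card →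
      ∃ c', Q c' ∧ c'.card = 1 := by
    intro n
    induction n with
    | zero =>
      intro c hcn _ hodd
      rw [Nat.odd_iff] at hodd
      omega
    | succ n ih =>
      -- `d + 1` is the clockwise distance from `p` to some other token, not necessarily the
      -- nearest: a collision on the way serves just as well. It is enough to bound the loss of
      -- tokens by one, which is what inclusion in `c.erase p` gives.
      have hdist : ∀ (d : ℕ) (c : Config N) (p : ZMod N), c.card ≤ n + 1 → Q c → Odd c.card →
          p ∈ c → p + (d + 1 : ℕ) ∈ c → p + (d + 1 : ℕ) ≠ p → ∃ c', Q c' ∧ c'.card = 1 := by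
        intro d
        induction d with
        | zero =>
          intro c p hcn hc hodd hp hpd hne
          refine ih (pass c {p}) ?_ (hQ c p hc hp)
            (odd_card_pass (Finset.singleton_subset_iff.2 hp) hodd)
          have hsub : pass c {p} ⊆ c.erase p := by
            intro x hx
            simp only [zero_add, Nat.cast_one] at hpd hne
            rw [pass, Finset.mem_symmDiff] at hx
            simp only [Finset.mem_sdiff, Finset.mem_singleton, Finset.image_singleton,
              Finset.mem_erase] at hx ⊢
            rcases hx with ⟨h, -⟩ | ⟨rfl, -⟩
            · exact ⟨h.2, h.1⟩
            · exact ⟨hne, hpd⟩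
          have := Finset.card_le_card hsub
          rw [Finset.card_erase_of_mem hp] at this
          omega
        | succ d ihd =>
          intro c p hcn hc hodd hp hpd hne
          by_cases h1 : p + 1 ∈ c
          · by_cases h2 : p + 1 = p
            · exfalso
              have h3 : (1 : ZMod N) = 0 := by simpa using h2
              refine hne ?_
              rw [Nat.cast_add, Nat.cast_one, h3, add_zero, ← mul_one ((d + 1 : ℕ) : ZMod N), h3,
                mul_zero, add_zero]
            refine ih (pass c {p}) ?_ (hQ c p hc hp)
              (odd_card_pass (Finset.singleton_subset_iff.2 hp) hodd)
            have hsub : pass c {p} ⊆ c.erase p := by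
              intro x hx
              rw [pass, Finset.mem_symmDiff] at hx
              simp only [Finset.mem_sdiff, Finset.mem_singleton, Finset.image_singleton,
                Finset.mem_erase] at hx ⊢
              rcases hx with ⟨h, -⟩ | ⟨rfl, -⟩
              · exact ⟨h.2, h.1⟩
              · exact ⟨h2, h1⟩
            have := Finset.card_le_card hsub
            rw [Finset.card_erase_of_mem hp] at this
            omega
          · have heq : p + 1 + ((d + 1 : ℕ) : ZMod N) = p + ((d + 1 + 1 : ℕ) : ZMod N) := by
              push_cast; ring
            have hnc : p + ((d + 1 + 1 : ℕ) : ZMod N) ≠ p + 1 := fun h => h1 (h ▸ hpd)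
            refine ihd (pass c {p}) (p + 1)
              ((card_pass_le (Finset.singleton_subset_iff.2 hp)).trans hcn) (hQ c p hc hp)
              (odd_card_pass (Finset.singleton_subset_iff.2 hp) hodd) ?_ ?_ ?_
            · rw [pass, Finset.mem_symmDiff]
              simp [h1]
            · rw [heq, pass, Finset.mem_symmDiff]
              left
              simp only [Finset.mem_sdiff, Finset.mem_singleton, Finset.image_singleton]
              exact ⟨⟨hpd, hne⟩, hnc⟩
            · rw [heq]; exact hnc
      intro c hcn hc hodd
      by_cases h1 : c.card = 1
      · exact ⟨c, hc, h1⟩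
      · have : 1 < c.card := by
          rw [Nat.odd_iff] at hodd
          omega
        obtain ⟨p, hp, q, hq, hpq⟩ := Finset.one_lt_card.1 this
        have hv : (q - p).val ≠ 0 := by
          rw [Ne, ZMod.val_eq_zero, sub_eq_zero]
          exact hpq.symm
        have h0 : p + (((q - p).val - 1 + 1 : ℕ) : ZMod N) = q := by
          rw [Nat.sub_add_cancel (Nat.one_le_iff_ne_zero.2 hv), ZMod.natCast_zmod_val]
          ring
        exact hdist _ c p hcn hc hodd hp (by rw [h0]; exact hq) (by rw [h0]; exact hpq.symm)
  exact key c.card c le_rfl hc hodd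

theorem Consistent.sum_powerset {φ : ℕ → ℕ → ℝ} (hφ : Consistent φ) (h0 : φ 0 0 = 1)
    (c : Config N) : ∑ A ∈ c.powerset, φ c.card A.card = 1 := by
  have := hφ.sum_powerset_union (∅ : Config N) c (Finset.disjoint_empty_left c) (fun _ => 1)
  simpa [h0] using this

theorem singleProb_of_card_eq_one {φ : ℕ → ℕ → ℝ} (hφ : Consistent φ) (h0 : φ 0 0 = 1) (k : ℕ)
    {c : Config N} (hc : c.card = 1) : singleProb φ k c = 1 := by
  induction k generalizing c with
  | zero => rw [singleProb, if_pos hc]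
  | succ k ih =>
    rw [singleProb, ← hφ.sum_powerset h0 c]
    refine Finset.sum_congr rfl fun A hA => ?_
    have hA := Finset.mem_powerset.1 hA
    have h1 := card_pass_le hA
    have h2 := odd_card_pass hA (by rw [hc]; exact odd_one)
    rw [ih (by rw [Nat.odd_iff] at h2; omega), mul_one]

theorem singleProb_le_one {φ : ℕ → ℕ → ℝ} {n₀ : ℕ} (hφ : Weights φ n₀) (k : ℕ)
    {c : Config N} (hc : c.card ≤ n₀) : singleProb φ k c ≤ 1 := by
  induction k generalizing c with
  | zero => rw [singleProb]; split_ifs <;> simp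
  | succ k ih =>
    rw [singleProb, ← hφ.consistent.sum_powerset hφ.zero c]
    refine Finset.sum_le_sum fun A hA => ?_
    exact mul_le_of_le_one_right (hφ.nonneg _ hc _)
      (ih ((card_pass_le (Finset.mem_powerset.1 hA)).trans hc))

variable [NeZero N]

/-- Every configuration arises from ordered positions. -/
theorem exists_positions {c : Config N} {m : ℕ} (hc : c.card = 2 * m + 1) :
    ∃ p : Fin (2 * m + 1) → ℤ, StrictMono p ∧ p (Fin.last _) < p 0 + N ∧ oddConfig N p = c := by
  have hs : (c.image ZMod.val).card = 2 * m + 1 := by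
    rw [Finset.card_image_of_injective _ (ZMod.val_injective N), hc]
  let e := (c.image ZMod.val).orderEmbOfFin hs
  have hmem : ∀ i, e i ∈ c.image ZMod.val := fun i => Finset.orderEmbOfFin_mem _ hs i
  have hmono : StrictMono fun i => (e i : ℤ) := fun a b h => Int.ofNat_lt.2 (e.strictMono h)
  have hN : (e (Fin.last _) : ℤ) < (e 0 : ℤ) + N := by
    obtain ⟨a, -, ha⟩ := Finset.mem_image.1 (hmem (Fin.last _))
    have := ZMod.val_lt a
    omega
  refine ⟨fun i => (e i : ℤ), hmono, hN, ?_⟩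
  rw [oddConfig_eq_map (injective_cast_of_strictMono hmono hN)]
  ext x
  simp only [Finset.mem_map, Finset.mem_univ, true_and, Function.Embedding.coeFn_mk,
    Int.cast_natCast]
  constructor
  · rintro ⟨i, rfl⟩
    obtain ⟨a, ha, hai⟩ := Finset.mem_image.1 (hmem i)
    rw [← hai, ZMod.natCast_zmod_val]
    exact ha
  · intro hx
    have : x.val ∈ Set.range e := by
      rw [Finset.range_orderEmbOfFin]
      exact Finset.mem_coe.2 (Finset.mem_image_of_mem _ hx)
    obtain ⟨i, hi⟩ := this
    exact ⟨i, by rw [hi, ZMod.natCast_zmod_val]⟩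

/-- The probability that the pairs in `w` collide in the prescribed directions. -/
noncomputable def pairingLimit (φ : ℕ → ℕ → ℝ) (N : ℕ) {M : ℕ} (p : Fin M → ℤ)
    (w : Finset (Fin M × Fin M × Dir)) : ℝ :=
  targetLimit φ N (fun e : w => e.1.1) (fun e => e.1.2.1) (fun e => e.1.2.2)
    fun e => p e.1.2.1 - p e.1.1

theorem pairing_difference_mem {m : ℕ} {p : Fin (2 * m + 1) → ℤ} (hp : StrictMono p)
    (hpN : p (Fin.last _) < p 0 + N) {w : Finset (Fin (2 * m + 1) × Fin (2 * m + 1) × Dir)}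
    (hw : w ∈ directedPairings (2 * m + 1)) (e : w) :
    0 < p e.1.2.1 - p e.1.1 ∧ p e.1.2.1 - p e.1.1 < N := by
  have h := (mem_directedPairings.1 hw).2.2.1 e.1 e.2
  have := cycDist_mem_Ioo hp hpN h.ne
  unfold cycDist at this
  rwa [if_neg h.le.not_gt, add_zero] at this

theorem pairing_inBox {m : ℕ} {p : Fin (2 * m + 1) → ℤ} (hp : StrictMono p)
    (hpN : p (Fin.last _) < p 0 + N) {w : Finset (Fin (2 * m + 1) × Fin (2 * m + 1) × Dir)}
    (hw : w ∈ directedPairings (2 * m + 1)) :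
    InBox N fun e : w => p e.1.2.1 - p e.1.1 := fun e =>
  ⟨(pairing_difference_mem hp hpN hw e).1.le, (pairing_difference_mem hp hpN hw e).2.le⟩

theorem pairing_ne {m : ℕ} {w : Finset (Fin (2 * m + 1) × Fin (2 * m + 1) × Dir)}
    (hw : w ∈ directedPairings (2 * m + 1)) (e : w) : e.1.1 ≠ e.1.2.1 :=
  ((mem_directedPairings.1 hw).2.2.1 e.1 e.2).ne

theorem pairing_injective {m : ℕ} {w : Finset (Fin (2 * m + 1) × Fin (2 * m + 1) × Dir)}
    (hw : w ∈ directedPairings (2 * m + 1)) :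
    Function.Injective (Sum.elim (fun e : w => e.1.1) fun e : w => e.1.2.1) := by
  have hcard := (mem_directedPairings.1 hw).1
  obtain ⟨σ, hσ⟩ := exists_perm_of_enumeration hw
    (Fintype.equivOfCardEq (by simp [hcard]) : Fin m ≃ w)
  set e : Fin m ≃ w := Fintype.equivOfCardEq (by simp [hcard])
  have hl : ∀ a : w, a.1.1 = σ (slotL (e.symm a)) := fun a => by simp [hσ]
  have hr : ∀ a : w, a.1.2.1 = σ (slotR (e.symm a)) := fun a => by simp [hσ]
  rintro (a | a) (b | b) h
  · simp only [Sum.elim_inl, hl] at h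
    rw [e.symm.injective (slotL_inj.1 (σ.injective h))]
  · simp only [Sum.elim_inl, Sum.elim_inr, hl, hr] at h
    exact absurd (σ.injective h) (slotL_ne_slotR _ _)
  · simp only [Sum.elim_inl, Sum.elim_inr, hl, hr] at h
    exact absurd (σ.injective h).symm (slotL_ne_slotR _ _)
  · simp only [Sum.elim_inr, hr] at h
    rw [e.symm.injective (slotR_inj.1 (σ.injective h))]

theorem tendsto_pairingProb {φ : ℕ → ℕ → ℝ} {n₀ : ℕ} (hφ : Weights φ n₀) {m : ℕ}
    (hm : 2 * m + 1 ≤ n₀) {p : Fin (2 * m + 1) → ℤ} (hp : StrictMono p)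
    (hpN : p (Fin.last _) < p 0 + N) {w : Finset (Fin (2 * m + 1) × Fin (2 * m + 1) × Dir)}
    (hw : w ∈ directedPairings (2 * m + 1)) :
    Tendsto (fun k => pairingProb φ N k p w) atTop (𝓝 (pairingLimit φ N p w)) :=
  tendsto_targetProb hφ (by simpa using hm) N _ _ _ (pairing_inBox hp hpN hw)

theorem summable_pairing {φ : ℕ → ℕ → ℝ} {n₀ : ℕ} (hφ : Weights φ n₀) (h2 : 2 ≤ n₀) {m : ℕ}
    (hm : 2 * m + 1 ≤ n₀) {p : Fin (2 * m + 1) → ℤ} (hp : StrictMono p)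
    (hpN : p (Fin.last _) < p 0 + N) {w : Finset (Fin (2 * m + 1) × Fin (2 * m + 1) × Dir)}
    (hw : w ∈ directedPairings (2 * m + 1)) :
    Summable fun k => pairingLimit φ N p w - pairingProb φ N k p w :=
  summable_targetLimit_sub hφ h2 (by simpa using hm) N (pairing_ne hw) _ (pairing_inBox hp hpN hw)

theorem tendsto_singleProb_sum {φ : ℕ → ℕ → ℝ} {n₀ : ℕ} (hφ : Weights φ n₀) {m : ℕ}
    (hm : 2 * m + 1 ≤ n₀) {p : Fin (2 * m + 1) → ℤ} (hp : StrictMono p)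
    (hpN : p (Fin.last _) < p 0 + N) : Tendsto (fun k => singleProb φ k (oddConfig N p)) atTop
    (𝓝 (∑ w ∈ directedPairings (2 * m + 1), directedSign w * pairingLimit φ N p w)) := by
  simp only [singleProb_eq_sum hφ.consistent _ hp.monotone hpN.le]
  exact tendsto_finsetSum _ fun w hw => (tendsto_pairingProb hφ hm hp hpN hw).const_mul _

theorem exists_tendsto_singleProb {φ : ℕ → ℕ → ℝ} {n₀ : ℕ} (hφ : Weights φ n₀) {c : Config N}
    (hodd : Odd c.card) (hc : c.card ≤ n₀) :
    ∃ a, Tendsto (fun k => singleProb φ k c) atTop (𝓝 a) := by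
  obtain ⟨m, hm⟩ := hodd
  obtain ⟨p, hp, hpN, rfl⟩ := exists_positions hm
  exact ⟨_, tendsto_singleProb_sum hφ (hm ▸ hc) hp hpN⟩

/-- The limit exists because the pairing probabilities converge, and it is harmonic for the
annihilating chain. By the minimum principle its minimizers are closed under single moves, which
have positive weight. Hence some single-token configuration is a minimizer, and there the value is
1. -/
theorem tendsto_singleProb {φ : ℕ → ℕ → ℝ} {n₀ : ℕ} (hφ : Weights φ n₀) {c : Config N}
    (hodd : Odd c.card) (hc : c.card ≤ n₀) :
    Tendsto (fun k => singleProb φ k c) atTop (𝓝 1) := by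
  classical
  choose! a ha using fun (c : Config N) (h : Odd c.card ∧ c.card ≤ n₀) =>
    exists_tendsto_singleProb hφ h.1 h.2
  have hle : ∀ c : Config N, Odd c.card ∧ c.card ≤ n₀ → a c ≤ 1 := fun c h =>
    le_of_tendsto' (ha c h) fun k => singleProb_le_one hφ k h.2
  have hpass : ∀ c : Config N, Odd c.card ∧ c.card ≤ n₀ → ∀ A ⊆ c,
      Odd (pass c A).card ∧ (pass c A).card ≤ n₀ := fun c h A hA =>
    ⟨odd_card_pass hA h.1, (card_pass_le hA).trans h.2⟩
  have hharm : ∀ c : Config N, Odd c.card ∧ c.card ≤ n₀ →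
      a c = ∑ A ∈ c.powerset, φ c.card A.card * a (pass c A) := by
    intro c h
    refine tendsto_nhds_unique ((tendsto_add_atTop_iff_nat 1).2 (ha c h)) ?_
    simp only [singleProb]
    exact tendsto_finsetSum _ fun A hA =>
      (ha _ (hpass c h A (Finset.mem_powerset.1 hA))).const_mul _
  obtain ⟨c₁, hc₁, hmin⟩ := Finset.exists_min_image
    (Finset.univ.filter fun c : Config N => Odd c.card ∧ c.card ≤ n₀) a ⟨c, by simp [hodd, hc]⟩
  simp only [Finset.mem_filter, Finset.mem_univ, true_and] at hc₁ hmin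
  have hclosed : ∀ (c : Config N) (q : ZMod N),
      ((Odd c.card ∧ c.card ≤ n₀) ∧ a c = a c₁) → q ∈ c →
      ((Odd (pass c {q}).card ∧ (pass c {q}).card ≤ n₀) ∧ a (pass c {q}) = a c₁) := by
    rintro c q ⟨h, hac⟩ hq
    have hqc : {q} ⊆ c := Finset.singleton_subset_iff.2 hq
    refine ⟨hpass c h _ hqc, ?_⟩
    have hzero : ∑ A ∈ c.powerset, φ c.card A.card * (a (pass c A) - a c₁) = 0 := by
      simp only [mul_sub, Finset.sum_sub_distrib]
      rw [← hharm c h, ← Finset.sum_mul, hφ.consistent.sum_powerset hφ.zero, hac]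
      ring
    have hnn : ∀ A ∈ c.powerset, 0 ≤ φ c.card A.card * (a (pass c A) - a c₁) := fun A hA =>
      mul_nonneg (hφ.nonneg _ h.2 _)
        (sub_nonneg.2 (hmin _ (hpass c h A (Finset.mem_powerset.1 hA))))
    have h0 := (Finset.sum_eq_zero_iff_of_nonneg hnn).1 hzero {q} (Finset.mem_powerset.2 hqc)
    rw [Finset.card_singleton] at h0
    have hpos := hφ.pos c.card h.2 (Finset.card_pos.2 ⟨q, hq⟩)
    linarith [(mul_eq_zero.1 h0).resolve_left hpos.ne']
  obtain ⟨c', ⟨h', hac'⟩, hc'⟩ := exists_single_of_closed hclosed ⟨hc₁, rfl⟩ hc₁.1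
  have h1 : a c' = 1 := by
    refine tendsto_nhds_unique (ha c' h') ?_
    simp only [singleProb_of_card_eq_one hφ.consistent hφ.zero _ hc']
    exact tendsto_const_nhds
  have : a c = 1 := le_antisymm (hle c ⟨hodd, hc⟩) (by rw [← h1, hac']; exact hmin c ⟨hodd, hc⟩)
  exact this ▸ ha c ⟨hodd, hc⟩

/-- Two expressions for the limit show that the signed sum of the `pairingLimit`s is 1; the formula
at time `k` is subtracted from this. Unlike the probabilities themselves, the differences are
summable over `k`. -/
theorem one_sub_singleProb {φ : ℕ → ℕ → ℝ} {n₀ : ℕ} (hφ : Weights φ n₀) {m : ℕ}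
    (hm : 2 * m + 1 ≤ n₀) {p : Fin (2 * m + 1) → ℤ} (hp : StrictMono p)
    (hpN : p (Fin.last _) < p 0 + N) (k : ℕ) : 1 - singleProb φ k (oddConfig N p) =
    ∑ w ∈ directedPairings (2 * m + 1),
      directedSign w * (pairingLimit φ N p w - pairingProb φ N k p w) := by
  have hcard : (oddConfig N p).card = 2 * m + 1 := by
    rw [oddConfig_eq_map (injective_cast_of_strictMono hp hpN), Finset.card_map]; simp
  have h1 := tendsto_nhds_unique (tendsto_singleProb_sum hφ hm hp hpN)
    (tendsto_singleProb hφ (by rw [hcard]; exact ⟨m, rfl⟩) (by omega))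
  rw [singleProb_eq_sum hφ.consistent _ hp.monotone hpN.le, ← h1, ← Finset.sum_sub_distrib]
  exact Finset.sum_congr rfl fun w _ => (mul_sub _ _ _).symm

theorem tsum_one_sub_singleProb {φ : ℕ → ℕ → ℝ} {n₀ : ℕ} (hφ : Weights φ n₀) (h2 : 2 ≤ n₀) {m : ℕ}
    (hm : 2 * m + 1 ≤ n₀) {p : Fin (2 * m + 1) → ℤ} (hp : StrictMono p)
    (hpN : p (Fin.last _) < p 0 + N) : ∑' k, (1 - singleProb φ k (oddConfig N p)) =
    ∑ w ∈ directedPairings (2 * m + 1),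
      directedSign w * ∑' k, (pairingLimit φ N p w - pairingProb φ N k p w) := by
  simp only [one_sub_singleProb hφ hm hp hpN]
  rw [Summable.tsum_finsetSum fun w hw => (summable_pairing hφ h2 hm hp hpN hw).mul_left _]
  simp only [tsum_mul_left]

theorem summable_one_sub_singleProb {φ : ℕ → ℕ → ℝ} {n₀ : ℕ} (hφ : Weights φ n₀) (h2 : 2 ≤ n₀)
    {c : Config N} (hodd : Odd c.card) (hc : c.card ≤ n₀) :
    Summable fun k => 1 - singleProb φ k c := by
  obtain ⟨m, hm⟩ := hodd
  obtain ⟨p, hp, hpN, rfl⟩ := exists_positions hm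
  simp only [one_sub_singleProb hφ (hm ▸ hc) hp hpN]
  exact summable_sum fun w hw => (summable_pairing hφ h2 (hm ▸ hc) hp hpN hw).mul_left _

end Ring

end Herman

namespace Herman

/-! ### Markov chains and holding times -/

section Chain

set_option linter.unusedSectionVars false

variable {S Ω : Type*} [Countable S] [MeasurableSpace Ω] {P : Measure Ω}

theorem lintegral_eq_tsum_fiber {T : Type*} [Countable T] {g : Ω → T}
    (hg : ∀ t, MeasurableSet {ω | g ω = t}) (f : Ω → ℝ≥0∞) :
    ∫⁻ ω, f ω ∂P = ∑' t, ∫⁻ ω in {ω | g ω = t}, f ω ∂P := by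
  rw [← lintegral_iUnion hg]
  · rw [Set.iUnion_eq_univ_iff.2 fun ω => ⟨g ω, rfl⟩, Measure.restrict_univ]
  · intro s t hst
    refine Set.disjoint_left.2 fun ω h1 h2 => hst ?_
    exact h1.symm.trans h2

theorem measurableSet_path {Y : ℕ → Ω → S} (hY : ∀ n x, MeasurableSet {ω | Y n ω = x}) (n : ℕ)
    (x : ℕ → S) : MeasurableSet {ω | ∀ k ≤ n, Y k ω = x k} := by
  have : {ω | ∀ k ≤ n, Y k ω = x k} = ⋂ k ∈ Set.Iic n, {ω | Y k ω = x k} := by ext; simp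
  rw [this]
  exact MeasurableSet.biInter (Set.to_countable _) fun k _ => hY k _

/-- The extension of an initial segment of a path. -/
def extendPath {n : ℕ} (x : Fin (n + 1) → S) (k : ℕ) : S :=
  if h : k < n + 1 then x ⟨k, h⟩ else x 0

theorem extendPath_of_le {n k : ℕ} (x : Fin (n + 1) → S) (h : k ≤ n) :
    extendPath x k = x ⟨k, Nat.lt_succ_of_le h⟩ := dif_pos (Nat.lt_succ_of_le h)

theorem eq_restrict_iff {n : ℕ} (y : ℕ → S) (x : Fin (n + 1) → S) :
    (fun k : Fin (n + 1) => y k) = x ↔ ∀ k ≤ n, y k = extendPath x k := by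
  constructor
  · rintro rfl k hk
    rw [extendPath_of_le _ hk]
  · intro h
    ext k
    rw [h k (Nat.le_of_lt_succ k.2), extendPath_of_le x (Nat.le_of_lt_succ k.2)]

theorem lintegral_eq_tsum_path {Y : ℕ → Ω → S} (hY : ∀ n x, MeasurableSet {ω | Y n ω = x}) (n : ℕ)
    (f : Ω → ℝ≥0∞) : ∫⁻ ω, f ω ∂P = ∑' x : Fin (n + 1) → S,
      ∫⁻ ω in {ω | ∀ k ≤ n, Y k ω = extendPath x k}, f ω ∂P := by
  have h : ∀ x : Fin (n + 1) → S, {ω | (fun k : Fin (n + 1) => Y k ω) = x} =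
      {ω | ∀ k ≤ n, Y k ω = extendPath x k} := fun x => by
    ext ω; exact eq_restrict_iff (fun k => Y k ω) x
  rw [lintegral_eq_tsum_fiber (g := fun ω => fun k : Fin (n + 1) => Y k ω)]
  · simp only [h]
  · intro x
    rw [h]
    exact measurableSet_path hY n _

/-- `G` depends only on the path up to time `n`. -/
def Adapted {α : Type*} (n : ℕ) (G : (ℕ → S) → α) : Prop :=
  ∀ a b : ℕ → S, (∀ k ≤ n, a k = b k) → G a = G b

theorem measurable_of_adapted {α : Type*} [MeasurableSpace α] {Y : ℕ → Ω → S}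
    (hY : ∀ n x, MeasurableSet {ω | Y n ω = x}) {n : ℕ} {G : (ℕ → S) → α} (hG : Adapted n G) :
    Measurable fun ω => G fun k => Y k ω := by
  intro B _
  have : (fun ω => G fun k => Y k ω) ⁻¹' B =
      ⋃ x ∈ {x : Fin (n + 1) → S | G (extendPath x) ∈ B},
        {ω | ∀ k ≤ n, Y k ω = extendPath x k} := by
    ext ω
    simp only [Set.mem_preimage, Set.mem_iUnion, Set.mem_ofPred_eq, exists_prop]
    constructor
    · intro h
      have h1 := (eq_restrict_iff (fun k => Y k ω) (fun k : Fin (n + 1) => Y k ω)).1 rfl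
      exact ⟨fun k => Y k ω, by rwa [← hG _ _ h1], h1⟩
    · rintro ⟨x, hx, h⟩
      rwa [hG _ _ h]
  rw [this]
  exact MeasurableSet.biUnion (Set.to_countable _) fun x _ => measurableSet_path hY n _

theorem IsMarkovChain.measure_path_succ [IsProbabilityMeasure P] {p : S → S → ℝ} {x₀ : S}
    {Y : ℕ → Ω → S} (h : IsMarkovChain p x₀ P Y) (hp : ∀ x y, 0 ≤ p x y) (n : ℕ) (x : ℕ → S)
    (y : S) :
    P ({ω | ∀ k ≤ n, Y k ω = x k} ∩ {ω | Y (n + 1) ω = y}) =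
      P {ω | ∀ k ≤ n, Y k ω = x k} * ENNReal.ofReal (p (x n) y) := by
  by_cases hx : x 0 = x₀
  · have h1 := h.law (n + 1) (fun k => if k ≤ n then x k else y) (by simpa using hx)
    have h2 : {ω | ∀ k ≤ n, Y k ω = x k} ∩ {ω | Y (n + 1) ω = y} =
        {ω | ∀ k ≤ n + 1, Y k ω = if k ≤ n then x k else y} := by
      ext ω
      simp only [Set.mem_inter_iff, Set.mem_ofPred_eq]
      constructor
      · rintro ⟨h1, h2⟩ k hk
        split_ifs with hkn
        · exact h1 k hkn
        · obtain rfl : k = n + 1 := by omega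
          exact h2
      · intro h3
        refine ⟨fun k hk => by simpa [hk] using h3 k (by omega), by simpa using h3 (n + 1) le_rfl⟩
    rw [h2, h1, h.law n x hx, Finset.prod_range_succ, ENNReal.ofReal_mul
      (Finset.prod_nonneg fun _ _ => hp _ _), if_pos le_rfl, if_neg (by omega)]
    congr 2
    refine Finset.prod_congr rfl fun k hk => ?_
    rw [Finset.mem_range] at hk
    rw [if_pos (by omega), if_pos (by omega)]
  · have h0 : P {ω | ∀ k ≤ n, Y k ω = x k} = 0 := by
      refine measure_mono_null (fun ω hω => ?_)
        ((prob_compl_eq_zero_iff (h.measurable 0 x₀)).2 h.start)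
      intro h1
      exact hx ((hω 0 (Nat.zero_le n)).symm.trans h1)
    rw [h0, zero_mul]
    exact measure_mono_null Set.inter_subset_left h0

/-- The Markov property. -/
theorem IsMarkovChain.lintegral_step [IsProbabilityMeasure P] {p : S → S → ℝ} {x₀ : S}
    {Y : ℕ → Ω → S} (h : IsMarkovChain p x₀ P Y) (hp : ∀ x y, 0 ≤ p x y) (n : ℕ)
    {G : (ℕ → S) → S → ℝ≥0∞} (hG : Adapted n G) :
    ∫⁻ ω, G (fun k => Y k ω) (Y (n + 1) ω) ∂P =
      ∫⁻ ω, ∑' y, ENNReal.ofReal (p (Y n ω) y) * G (fun k => Y k ω) y ∂P := by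
  rw [lintegral_eq_tsum_path h.measurable n, lintegral_eq_tsum_path h.measurable n]
  refine tsum_congr fun x => ?_
  have hm := measurableSet_path h.measurable n (extendPath x)
  rw [lintegral_eq_tsum_fiber (h.measurable (n + 1)),
    setLIntegral_congr_fun (g := fun _ => ∑' y, ENNReal.ofReal (p (extendPath x n) y) *
      G (extendPath x) y) hm, setLIntegral_const, mul_comm, ← ENNReal.tsum_mul_left]
  · refine tsum_congr fun y => ?_
    rw [Measure.restrict_restrict (h.measurable (n + 1) y),
      setLIntegral_congr_fun (g := fun _ => G (extendPath x) y) ((h.measurable _ y).inter hm),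
      setLIntegral_const, Set.inter_comm, h.measure_path_succ hp]
    · ring
    · rintro ω ⟨h1, h2⟩
      have h1 : Y (n + 1) ω = y := h1
      simp only [hG _ _ h2, h1]
  · intro ω h2
    simp only [hG _ _ h2, show Y n ω = extendPath x n from h2 n le_rfl]

/-- The Markov property, applied to the indicator of transitions of probability zero, shows that
they almost surely never occur. -/
theorem IsMarkovChain.ae_transition [IsProbabilityMeasure P] {p : S → S → ℝ} {x₀ : S}
    {Y : ℕ → Ω → S} (h : IsMarkovChain p x₀ P Y) (hp : ∀ x y, 0 ≤ p x y) :
    ∀ᵐ ω ∂P, Y 0 ω = x₀ ∧ ∀ n, p (Y n ω) (Y (n + 1) ω) ≠ 0 := by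
  classical
  have h0 : ∀ᵐ ω ∂P, Y 0 ω = x₀ :=
    (prob_compl_eq_zero_iff (h.measurable 0 x₀)).2 h.start
  refine h0.and (ae_all_iff.2 fun n => ?_)
  have hG : Adapted n fun (a : ℕ → S) (y : S) =>
      if p (a n) y = 0 then (1 : ℝ≥0∞) else 0 := fun a b hab => by
    simp only [hab n le_rfl]
  have h1 := h.lintegral_step hp n hG
  have h2 : ∀ x, ∑' y, ENNReal.ofReal (p x y) * (if p x y = 0 then (1 : ℝ≥0∞) else 0) = 0 := by
    intro x
    refine ENNReal.tsum_eq_zero.2 fun y => ?_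
    split_ifs with h <;> simp [h]
  simp only [h2, lintegral_zero] at h1
  have hmeas : Measurable fun ω => if p (Y n ω) (Y (n + 1) ω) = 0 then (1 : ℝ≥0∞) else 0 :=
    measurable_of_adapted h.measurable (n := n + 1)
      (G := fun a => if p (a n) (a (n + 1)) = 0 then (1 : ℝ≥0∞) else 0) fun a b hab => by
        beta_reduce
        rw [hab n (by omega), hab (n + 1) le_rfl]
  filter_upwards [(lintegral_eq_zero_iff hmeas).1 h1] with ω hω h3
  simp [h3] at hω

/-- The invariant properties of the states along a path. -/
theorem IsMarkovChain.ae_invariant [IsProbabilityMeasure P] {p : S → S → ℝ} {x₀ : S}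
    {Y : ℕ → Ω → S} (h : IsMarkovChain p x₀ P Y) (hp : ∀ x y, 0 ≤ p x y) {Q : S → Prop}
    (h0 : Q x₀) (hQ : ∀ x y, Q x → p x y ≠ 0 → Q y) : ∀ᵐ ω ∂P, ∀ n, Q (Y n ω) := by
  filter_upwards [h.ae_transition hp] with ω hω n
  induction n with
  | zero => rw [hω.1]; exact h0
  | succ n ih => exact hQ _ _ ih (hω.2 n)

/-- A quantity `status U ε x n` that is updated along the path `x`. -/
def status {E : Type*} (U : E → S → S → E) (ε : E) (x : ℕ → S) : ℕ → E
  | 0 => ε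
  | n + 1 => U (status U ε x n) (x n) (x (n + 1))

theorem adapted_status {E : Type*} (U : E → S → S → E) (ε : E) (n : ℕ) :
    Adapted n fun x : ℕ → S => status U ε x n := by
  induction n with
  | zero => intro a b _; rfl
  | succ n ih =>
    intro a b hab
    simp only [status]
    rw [hab n (by omega), hab (n + 1) le_rfl,
      show status U ε a n = status U ε b n from ih a b fun k hk => hab k (by omega)]

/-- By `hT` the law of the updated status does not depend on the current state `x`, so the status
evolves as a Markov chain with transition operator `T`. -/
theorem IsMarkovChain.lintegral_status [IsProbabilityMeasure P] {p : S → S → ℝ} {x₀ : S}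
    {Y : ℕ → Ω → S} (h : IsMarkovChain p x₀ P Y) (hp : ∀ x y, 0 ≤ p x y) {E : Type*}
    (U : E → S → S → E) (ε : E) (T : (E → ℝ≥0∞) → E → ℝ≥0∞)
    (hT : ∀ g ε x, ∑' y, ENNReal.ofReal (p x y) * g (U ε x y) = T g ε) (n : ℕ) (g : E → ℝ≥0∞) :
    ∫⁻ ω, g (status U ε (fun k => Y k ω) n) ∂P = T^[n] g ε := by
  induction n generalizing g with
  | zero => simp [status]
  | succ n ih =>
    have hG : Adapted n fun (a : ℕ → S) (y : S) => g (U (status U ε a n) (a n) y) := by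
      intro a b hab
      ext y
      beta_reduce
      rw [hab n le_rfl, show status U ε a n = status U ε b n from adapted_status U ε n a b hab]
    have h1 := h.lintegral_step hp n hG
    simp only [hT] at h1
    rw [Function.iterate_succ_apply, ← ih]
    exact h1

/-- The holding times `H` have, given the path, the expectations `θ` of the visited states. -/
structure IsTimed (θ : S → ℝ≥0∞) (P : Measure Ω) (Y : ℕ → Ω → S) (H : ℕ → Ω → ℝ≥0∞) : Prop where
  measurable : ∀ k, Measurable (H k)
  lintegral : ∀ (k n : ℕ) (x : ℕ → S), k < n →
    ∫⁻ ω in {ω | ∀ j ≤ n, Y j ω = x j}, H k ω ∂P = θ (x k) * P {ω | ∀ j ≤ n, Y j ω = x j}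

/-- `G` may depend on the path after step `k`. The collision times need this, since whether the
prescribed collisions happen is decided only later. -/
theorem IsTimed.lintegral_mul {θ : S → ℝ≥0∞} {Y : ℕ → Ω → S}
    {H : ℕ → Ω → ℝ≥0∞} (h : IsTimed θ P Y H) (hY : ∀ n x, MeasurableSet {ω | Y n ω = x})
    {k n : ℕ} (hkn : k < n) {G : (ℕ → S) → ℝ≥0∞} (hG : Adapted n G) :
    ∫⁻ ω, H k ω * G (fun j => Y j ω) ∂P = ∫⁻ ω, θ (Y k ω) * G (fun j => Y j ω) ∂P := by
  rw [lintegral_eq_tsum_path hY n, lintegral_eq_tsum_path hY n]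
  refine tsum_congr fun x => ?_
  have hm := measurableSet_path hY n (extendPath x)
  rw [setLIntegral_congr_fun (g := fun ω => H k ω * G (extendPath x)) hm,
    setLIntegral_congr_fun (f := fun ω => θ (Y k ω) * G (fun j => Y j ω))
      (g := fun ω => θ (extendPath x k) * G (extendPath x)) hm, setLIntegral_const,
    lintegral_mul_const _ (h.measurable k), h.lintegral k n _ hkn]
  · ring
  · intro ω h2
    simp only [hG _ _ h2, show Y k ω = extendPath x k from h2 k hkn.le]
  · intro ω h2
    simp only [hG _ _ h2]

end Chain

end Herman

namespace Herman

/-! ### The jump chain and the holding times of a continuous-time Markov chain -/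

theorem lintegral_exp_neg_mul {a : ℝ} (ha : 0 < a) :
    ∫⁻ t in Set.Ioi (0 : ℝ), ENNReal.ofReal (Real.exp (-(a * t))) = ENNReal.ofReal (1 / a) := by
  have h := integral_exp_mul_Ioi (a := -a) (by linarith) 0
  have hi := integrableOn_exp_mul_Ioi (a := -a) (by linarith) 0
  simp only [neg_mul] at h hi
  rw [← ofReal_integral_eq_lintegral_ofReal hi (ae_of_all _ fun t => (Real.exp_pos _).le), h]
  simp

section Jump

set_option linter.unusedSectionVars false

variable {S Ω : Type*} [Countable S] [MeasurableSpace Ω] {P : Measure Ω} [IsProbabilityMeasure P]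

/-- `Q` holds for the initial state and is inherited along transitions, and the states with the
property `Q` are not absorbing. -/
structure Regular (q : S → S → ℝ) (x₀ : S) (Q : S → Prop) : Prop where
  nonneg : ∀ x y, 0 ≤ q x y
  start : Q x₀
  step : ∀ x y, Q x → q x y ≠ 0 → Q y
  exitRate_pos : ∀ x, Q x → 0 < exitRate q x
  sum_eq_one : ∀ x, Q x → ∑' y, ENNReal.ofReal (q x y / exitRate q x) = 1

variable {q : S → S → ℝ} {x₀ : S} {Q : S → Prop} {Y : ℕ → Ω → S} {H : ℕ → Ω → ℝ≥0}

theorem Regular.of_prod_ne_zero (hq : Regular q x₀ Q) (n : ℕ) (x : ℕ → S) (hx : x 0 = x₀)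
    (h : ∏ k ∈ Finset.range n, q (x k) (x (k + 1)) / exitRate q (x k) ≠ 0) :
    ∀ k ≤ n, Q (x k) := by
  intro k
  induction k with
  | zero => intro _; rw [hx]; exact hq.start
  | succ k ih =>
    intro hk
    refine hq.step _ _ (ih (by omega)) fun h0 => ?_
    exact (Finset.prod_ne_zero_iff.1 h) k (Finset.mem_range.2 hk) (by rw [h0, zero_div])

theorem measurableSet_lt_holding (hH : ∀ n, Measurable (H n)) (n : ℕ) (t : ℕ → ℝ≥0) :
    MeasurableSet {ω | ∀ k < n, t k < H k ω} := by
  have : {ω | ∀ k < n, t k < H k ω} = ⋂ k ∈ Set.Iio n, {ω | t k < H k ω} := by ext; simp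
  rw [this]
  exact MeasurableSet.biInter (Set.to_countable _) fun k _ =>
    measurableSet_lt measurable_const (hH k)

/-- The law of the jump chain and the holding times, as in `IsJumpProcess`. -/
structure IsJumpData (q : S → S → ℝ) (x₀ : S) (P : Measure Ω) (Y : ℕ → Ω → S)
    (H : ℕ → Ω → ℝ≥0) : Prop where
  measurable_chain : ∀ n x, MeasurableSet {ω | Y n ω = x}
  measurable_holding : ∀ n, Measurable (H n)
  start : P {ω | Y 0 ω = x₀} = 1
  law : ∀ (n : ℕ) (x : ℕ → S) (t : ℕ → ℝ≥0), x 0 = x₀ →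
    P {ω | (∀ k ≤ n, Y k ω = x k) ∧ ∀ k < n, t k < H k ω} =
      ENNReal.ofReal (∏ k ∈ Finset.range n,
        (q (x k) (x (k + 1)) / exitRate q (x k)) * Real.exp (-(exitRate q (x k) * t k)))

theorem IsJumpData.measure_path_of_ne (h : IsJumpData q x₀ P Y H) (n : ℕ) (x : ℕ → S)
    (hx : x 0 ≠ x₀) : P {ω | ∀ k ≤ n, Y k ω = x k} = 0 := by
  refine measure_mono_null (fun ω hω => ?_)
    ((prob_compl_eq_zero_iff (h.measurable_chain 0 x₀)).2 h.start)
  intro h1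
  exact hx ((hω 0 (Nat.zero_le n)).symm.trans h1)

theorem IsJumpData.law_zero (h : IsJumpData q x₀ P Y H) (n : ℕ) (x : ℕ → S) (hx : x 0 = x₀) :
    P ({ω | ∀ k ≤ n, Y k ω = x k} ∩ {ω | ∀ k < n, 0 < H k ω}) =
      ENNReal.ofReal (∏ k ∈ Finset.range n, q (x k) (x (k + 1)) / exitRate q (x k)) := by
  have := h.law n x 0 hx
  simp only [Pi.zero_apply, NNReal.coe_zero, mul_zero, neg_zero, Real.exp_zero, mul_one] at this
  rw [← this]
  rfl

/-- The joint law with all thresholds 0 only measures paths with positive holding times. Summing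
over the next state loses no mass, because the jump probabilities out of states with `Q` add up to
1; hence zero holding times carry no probability. -/
theorem IsJumpData.measure_holding_pos (hq : Regular q x₀ Q) (h : IsJumpData q x₀ P Y H) (n : ℕ) :
    P {ω | ∀ k < n, 0 < H k ω} = 1 := by
  have hm : ∀ n, MeasurableSet {ω | ∀ k < n, 0 < H k ω} := fun n =>
    measurableSet_lt_holding h.measurable_holding n 0
  induction n with
  | zero => simp
  | succ n ih =>
    rw [← ih, ← lintegral_indicator_one (hm _), ← lintegral_indicator_one (hm _),
      lintegral_eq_tsum_path h.measurable_chain n, lintegral_eq_tsum_path h.measurable_chain n]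
    refine tsum_congr fun x => Eq.symm ?_
    have hmx := measurableSet_path h.measurable_chain n (extendPath x)
    rw [lintegral_indicator_one (hm _), Measure.restrict_apply (hm _), Set.inter_comm,
      lintegral_eq_tsum_fiber (h.measurable_chain (n + 1))]
    have h1 : ∀ y, ∫⁻ ω in {ω | Y (n + 1) ω = y},
        ({ω | ∀ k < n + 1, 0 < H k ω}.indicator 1 ω : ℝ≥0∞)
          ∂P.restrict {ω | ∀ k ≤ n, Y k ω = extendPath x k} =
        P ({ω | ∀ k ≤ n + 1, Y k ω = if k ≤ n then extendPath x k else y} ∩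
          {ω | ∀ k < n + 1, 0 < H k ω}) := by
      intro y
      rw [Measure.restrict_restrict (h.measurable_chain (n + 1) y), lintegral_indicator_one (hm _),
        Measure.restrict_apply (hm _)]
      congr 1
      ext ω
      simp only [Set.mem_inter_iff, Set.mem_ofPred_eq]
      constructor
      · rintro ⟨h1, h2, h3⟩
        refine ⟨fun k hk => ?_, h1⟩
        split_ifs with hkn
        · exact h3 k hkn
        · obtain rfl : k = n + 1 := by omega
          exact h2
      · rintro ⟨h1, h2⟩
        exact ⟨h2, by simpa using h1 (n + 1) le_rfl,
          fun k hk => by simpa [hk] using h1 k (by omega)⟩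
    rw [tsum_congr h1]
    by_cases hx : extendPath x 0 = x₀
    · have h2 : ∀ y, P ({ω | ∀ k ≤ n + 1, Y k ω = if k ≤ n then extendPath x k else y} ∩
          {ω | ∀ k < n + 1, 0 < H k ω}) =
          P ({ω | ∀ k ≤ n, Y k ω = extendPath x k} ∩ {ω | ∀ k < n, 0 < H k ω}) *
            ENNReal.ofReal (q (extendPath x n) y / exitRate q (extendPath x n)) := by
        intro y
        have hnn : ∀ x y, 0 ≤ q x y / exitRate q x := fun x y =>
          div_nonneg (hq.nonneg _ _) (tsum_nonneg fun z => hq.nonneg _ _)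
        rw [h.law_zero n _ hx, h.law_zero (n + 1) (fun k => if k ≤ n then extendPath x k else y)
          (by simpa using hx), Finset.prod_range_succ,
          ENNReal.ofReal_mul (Finset.prod_nonneg fun _ _ => hnn _ _), if_pos le_rfl,
          if_neg (by omega)]
        congr 2
        refine Finset.prod_congr rfl fun k hk => ?_
        rw [Finset.mem_range] at hk
        rw [if_pos (by omega), if_pos (by omega)]
      simp only [h2, ENNReal.tsum_mul_left]
      rw [h.law_zero n _ hx]
      by_cases h0 : ∏ k ∈ Finset.range n, q (extendPath x k) (extendPath x (k + 1)) /
          exitRate q (extendPath x k) = 0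
      · rw [h0]; simp
      · rw [hq.sum_eq_one _ (hq.of_prod_ne_zero n _ hx h0 n le_rfl), mul_one]
    · rw [measure_mono_null Set.inter_subset_left (h.measure_path_of_ne n _ hx)]
      symm
      refine ENNReal.tsum_eq_zero.2 fun y => ?_
      exact measure_mono_null Set.inter_subset_left
        (h.measure_path_of_ne (n + 1) _ (by simpa using hx))

theorem IsJumpData.ae_holding_pos (hq : Regular q x₀ Q) (h : IsJumpData q x₀ P Y H) :
    ∀ᵐ ω ∂P, ∀ k, 0 < H k ω := by
  have h1 : ∀ᵐ ω ∂P, ∀ n, ∀ k < n, 0 < H k ω := ae_all_iff.2 fun n =>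
    (prob_compl_eq_zero_iff (measurableSet_lt_holding h.measurable_holding n 0)).2
      (h.measure_holding_pos hq n)
  filter_upwards [h1] with ω hω k
  exact hω (k + 1) k (Nat.lt_succ_self k)

theorem IsJumpData.measure_path (hq : Regular q x₀ Q) (h : IsJumpData q x₀ P Y H) (n : ℕ)
    (x : ℕ → S) (hx : x 0 = x₀) : P {ω | ∀ k ≤ n, Y k ω = x k} =
      ENNReal.ofReal (∏ k ∈ Finset.range n, q (x k) (x (k + 1)) / exitRate q (x k)) := by
  rw [← h.law_zero n x hx]
  refine measure_congr ?_
  filter_upwards [h.ae_holding_pos hq] with ω hω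
  refine propext ⟨fun h1 => ⟨h1, fun k _ => hω k⟩, fun h1 => h1.1⟩

theorem IsJumpData.isMarkovChain (hq : Regular q x₀ Q) (h : IsJumpData q x₀ P Y H) :
    IsMarkovChain (fun x y => q x y / exitRate q x) x₀ P Y :=
  ⟨h.measurable_chain, h.start, h.measure_path hq⟩

/-- The mean is the integral of the tail. The tail of `H k` on a path cylinder is the joint law with
threshold `t` at `k` and 0 elsewhere, the latter being no restriction since holding times are almost
surely positive. -/
theorem IsJumpData.isTimed (hq : Regular q x₀ Q) (h : IsJumpData q x₀ P Y H) :
    IsTimed (fun x => ENNReal.ofReal (1 / exitRate q x)) P Y fun k ω => (H k ω : ℝ≥0∞) := by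
  refine ⟨fun k => (h.measurable_holding k).coe_nnreal_ennreal, fun k n x hkn => ?_⟩
  by_cases hx : x 0 = x₀
  swap
  · have h0 := h.measure_path_of_ne n x hx
    rw [h0, mul_zero, Measure.restrict_eq_zero.2 h0, lintegral_zero_measure]
  by_cases hW : ∏ j ∈ Finset.range n, q (x j) (x (j + 1)) / exitRate q (x j) = 0
  · have h0 := h.measure_path hq n x hx
    rw [hW, ENNReal.ofReal_zero] at h0
    rw [h0, mul_zero, Measure.restrict_eq_zero.2 h0, lintegral_zero_measure]
  have hr := hq.exitRate_pos _ (hq.of_prod_ne_zero n x hx hW k hkn.le)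
  have h1 : ∀ ω, (H k ω : ℝ≥0∞) = ENNReal.ofReal (H k ω : ℝ) := fun ω => by simp
  simp only [h1]
  have hmr : Measurable fun ω => (H k ω : ℝ) := (h.measurable_holding k).coe_nnreal_real
  rw [lintegral_eq_lintegral_meas_lt (f := fun ω => (H k ω : ℝ)) _
    (ae_of_all _ fun ω => (H k ω).2) hmr.aemeasurable]
  have h2 : ∀ t ∈ Set.Ioi (0 : ℝ),
      P.restrict {ω | ∀ j ≤ n, Y j ω = x j} {ω | t < (H k ω : ℝ)} =
        ENNReal.ofReal (∏ j ∈ Finset.range n, q (x j) (x (j + 1)) / exitRate q (x j)) *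
          ENNReal.ofReal (Real.exp (-(exitRate q (x k) * t))) := by
    intro t ht
    have ht : 0 < t := ht
    have h3 := h.law n x (fun j => if j = k then t.toNNReal else 0) hx
    have h4 : ∏ j ∈ Finset.range n, (q (x j) (x (j + 1)) / exitRate q (x j)) *
        Real.exp (-(exitRate q (x j) * ((if j = k then t.toNNReal else 0 : ℝ≥0) : ℝ))) =
        (∏ j ∈ Finset.range n, q (x j) (x (j + 1)) / exitRate q (x j)) *
          Real.exp (-(exitRate q (x k) * t)) := by
      rw [Finset.prod_mul_distrib]
      congr 1
      rw [Finset.prod_eq_single k]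
      · simp [ht.le]
      · intro j _ hj
        simp [hj]
      · intro hk
        exact absurd (Finset.mem_range.2 hkn) hk
    have hnn : ∀ x y, 0 ≤ q x y / exitRate q x := fun x y =>
      div_nonneg (hq.nonneg _ _) (tsum_nonneg fun z => hq.nonneg _ _)
    rw [h4, ENNReal.ofReal_mul (Finset.prod_nonneg fun _ _ => hnn _ _)] at h3
    rw [← h3, Measure.restrict_apply (measurableSet_lt measurable_const hmr)]
    refine measure_congr ?_
    filter_upwards [h.ae_holding_pos hq] with ω hω
    refine propext ⟨fun h5 => ⟨h5.2, fun j _ => ?_⟩, fun h5 => ⟨?_, h5.1⟩⟩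
    · split_ifs with hj
      · subst hj
        exact (Real.toNNReal_lt_iff_lt_coe ht.le).2 h5.1
      · exact hω j
    · have := h5.2 k hkn
      rw [if_pos rfl] at this
      exact (Real.toNNReal_lt_iff_lt_coe ht.le).1 this
  rw [setLIntegral_congr_fun measurableSet_Ioi h2, lintegral_const_mul', lintegral_exp_neg_mul hr,
    h.measure_path hq n x hx, mul_comm]
  exact ENNReal.ofReal_ne_top

end Jump

end Herman

namespace Herman

/-! ### Processes that visit the states of a chain one after the other -/

/-- The path `X` visits the states `Y 0, Y 1, …` one after the other, at the times `t 0, t 1, …`,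
and stays in them for the times `H 0, H 1, …`. -/
structure TimeChange {𝕋 S : Type*} [LinearOrder 𝕋] (time : 𝕋 → ℝ≥0∞) (X : 𝕋 → S) (Y : ℕ → S)
    (H : ℕ → ℝ≥0∞) (t : ℕ → 𝕋) : Prop where
  eval : ∀ n, X (t n) = Y n
  before : ∀ n s, s < t n → ∃ k < n, X s = Y k
  time_eq : ∀ n, time (t n) = ∑ k ∈ Finset.range n, H k

theorem TimeChange.iInf_eq {𝕋 S : Type*} [LinearOrder 𝕋] {time : 𝕋 → ℝ≥0∞}
    (htime : Monotone time) {X : 𝕋 → S} {Y : ℕ → S} {H : ℕ → ℝ≥0∞} {t : ℕ → 𝕋}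
    (h : TimeChange time X Y H t) {B : S → Prop} {τ : ℕ} (hτ : B (Y τ))
    (hlt : ∀ k < τ, ¬ B (Y k)) :
    (⨅ (s : 𝕋) (_ : B (X s)), time s) = ∑ k ∈ Finset.range τ, H k := by
  rw [← h.time_eq]
  refine le_antisymm (iInf₂_le (t τ) (by rwa [h.eval])) (le_iInf₂ fun s hs => htime ?_)
  by_contra! hst
  obtain ⟨k, hk, hX⟩ := h.before τ s hst
  exact hlt k hk (hX ▸ hs)

theorem tsum_lt_eq_sum_range (H : ℕ → ℝ≥0∞) (τ : ℕ) :
    ∑' k, (if k < τ then H k else 0) = ∑ k ∈ Finset.range τ, H k := by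
  rw [tsum_eq_sum (s := Finset.range τ) fun k hk => if_neg (by simpa using hk)]
  exact Finset.sum_congr rfl fun k hk => if_pos (Finset.mem_range.1 hk)

theorem timeChange_nat {S : Type*} (X : ℕ → S) :
    TimeChange (fun n : ℕ => (n : ℝ≥0∞)) X X (fun _ => 1) id :=
  ⟨fun _ => rfl, fun _ s hs => ⟨s, hs, rfl⟩, fun n => by simp⟩

/-- Positive holding times ensure that the n-th jump time lies in the n-th interval of constancy.
Explosion need not be excluded, since nothing is asserted beyond the jump times. -/
theorem timeChange_nnreal {S : Type*} {X : ℝ≥0 → S} {Y : ℕ → S} {H : ℕ → ℝ≥0}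
    (hH : ∀ k, 0 < H k)
    (hX : ∀ (n : ℕ) (t : ℝ≥0), ∑ k ∈ Finset.range n, H k ≤ t →
      t < ∑ k ∈ Finset.range (n + 1), H k → X t = Y n) :
    TimeChange (fun t : ℝ≥0 => (t : ℝ≥0∞)) X Y (fun k => (H k : ℝ≥0∞))
      fun n => ∑ k ∈ Finset.range n, H k := by
  refine ⟨fun n => hX n _ le_rfl ?_, fun n s hs => ?_, fun n => by push_cast; rfl⟩
  · rw [Finset.sum_range_succ]
    exact lt_add_of_pos_right _ (hH n)
  · induction n with
    | zero => simp at hs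
    | succ n ih =>
      by_cases h : s < ∑ k ∈ Finset.range n, H k
      · obtain ⟨k, hk, hk'⟩ := ih h
        exact ⟨k, by omega, hk'⟩
      · exact ⟨n, Nat.lt_succ_self n, hX n s (not_lt.1 h) hs⟩

/-! ### The expected stabilization time -/

theorem exists_le_mul {S : Type*} [Finite S] {θ g : S → ℝ≥0∞} {B : S → Prop}
    (hθ : ∀ x, B x → θ x ≠ 0 ∧ θ x ≠ ∞) (hg : ∀ x, B x → g x ≠ ∞) :
    ∃ C : ℝ≥0∞, C ≠ ∞ ∧ ∀ x, B x → g x ≤ C * θ x := by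
  classical
  have := Fintype.ofFinite S
  refine ⟨∑ x, if B x then g x / θ x else 0, ?_, fun x hx => ?_⟩
  · refine ENNReal.sum_ne_top.2 fun x _ => ?_
    split_ifs with h
    · exact ENNReal.div_ne_top (hg x h) (hθ x h).1
    · exact ENNReal.zero_ne_top
  · have h1 := Finset.single_le_sum (f := fun x => if B x then g x / θ x else 0)
      (fun _ _ => zero_le) (Finset.mem_univ x)
    simp only [if_pos hx] at h1
    calc g x = g x / θ x * θ x := (ENNReal.div_mul_cancel (hθ x hx).1 (hθ x hx).2).symm
      _ ≤ _ := by gcongr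

/-- The expected stabilization time is the value of the solution `h` of the difference equation. -/
theorem lintegral_stabilizationTime {N : ℕ} [NeZero N] {𝕋 Ω : Type*} [LinearOrder 𝕋]
    [MeasurableSpace Ω] {time : 𝕋 → ℝ≥0∞} (htime : Monotone time) {P : Measure Ω}
    [IsProbabilityMeasure P] {X : 𝕋 → Ω → Config N} {Y : ℕ → Ω → Config N}
    {H : ℕ → Ω → ℝ≥0∞} {p : Config N → Config N → ℝ} (hp : ∀ c c', 0 ≤ p c c') {c₀ : Config N}
    (hY : IsMarkovChain p c₀ P Y) {θ : Config N → ℝ≥0∞} (hH : IsTimed θ P Y H)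
    (hX : ∀ᵐ ω ∂P, ∃ t, TimeChange time (fun s => X s ω) (fun k => Y k ω) (fun k => H k ω) t)
    {Q : Config N → Prop} (hQ0 : Q c₀)
    (hQ : ∀ c c', Q c → p c c' ≠ 0 → Q c' ∧ (c.card = 1 → c'.card = 1))
    (hθ : ∀ c, Q c → c.card ≠ 1 → θ c ≠ 0) {h : Config N → ℝ≥0∞} (hfin : ∀ c, Q c → h c ≠ ∞)
    (h1 : ∀ c, c.card = 1 → h c = 0)
    (heq : ∀ c, Q c → h c =
      (if c.card ≠ 1 then θ c else 0) + ∑' c', ENNReal.ofReal (p c c') * h c') :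
    AEMeasurable (stabilizationTime time X) P ∧ ∫⁻ ω, stabilizationTime time X ω ∂P = h c₀ := by
  have hmeas : ∀ {k : ℕ} (g : Config N → ℝ≥0∞), Measurable fun ω => g (Y k ω) := fun {k} g =>
    measurable_of_adapted hY.measurable (n := k) (G := fun a => g (a k)) fun a b hab => by
      simp only [hab k le_rfl]
  have haeQ : ∀ᵐ ω ∂P, ∀ n, Q (Y n ω) :=
    hY.ae_invariant hp hQ0 fun x y hx hxy => (hQ x y hx hxy).1
  set g : Config N → ℝ≥0∞ := fun c => if c.card ≠ 1 then θ c else 0 with hg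
  have hθtop : ∀ c, Q c ∧ c.card ≠ 1 → θ c ≠ 0 ∧ θ c ≠ ∞ := by
    rintro c ⟨hc, hc1⟩
    refine ⟨hθ c hc hc1, fun htop => hfin c hc ?_⟩
    rw [heq c hc]
    simp [hc1, htop]
  have hstep : ∀ k, ∫⁻ ω, h (Y k ω) ∂P =
      ∫⁻ ω, g (Y k ω) ∂P + ∫⁻ ω, h (Y (k + 1) ω) ∂P := by
    intro k
    have h2 := hY.lintegral_step hp k (G := fun _ y => h y) fun _ _ _ => rfl
    rw [h2, ← lintegral_add_left (hmeas g)]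
    refine lintegral_congr_ae ?_
    filter_upwards [haeQ] with ω hω
    exact heq _ (hω k)
  -- The equation for `h` telescopes along the chain; it remains to show that the remainder vanishes
  -- in the limit.
  have hsum : ∀ n, ∑ k ∈ Finset.range n, ∫⁻ ω, g (Y k ω) ∂P + ∫⁻ ω, h (Y n ω) ∂P = h c₀ := by
    intro n
    induction n with
    | zero =>
      rw [Finset.sum_range_zero, zero_add]
      have : ∀ᵐ ω ∂P, h (Y 0 ω) = h c₀ := by
        filter_upwards [hY.ae_transition hp] with ω hω
        rw [hω.1]
      rw [lintegral_congr_ae this]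
      simp
    | succ n ih => rw [← ih, Finset.sum_range_succ, hstep n, add_assoc]
  have htsum : ∑' k, ∫⁻ ω, g (Y k ω) ∂P ≠ ∞ := by
    refine ne_top_of_le_ne_top (hfin c₀ hQ0) (ENNReal.tsum_le_of_sum_range_le fun n => ?_)
    rw [← hsum n]
    exact le_self_add
  obtain ⟨C, hC, hCle⟩ := exists_le_mul hθtop fun c hc => hfin c hc.1
  -- The state space is finite, so `h` is at most a constant times `g` on the relevant states, and
  -- the expectations of `g` tend to 0 because their sum is finite.
  have hlim : Tendsto (fun n => ∫⁻ ω, h (Y n ω) ∂P) atTop (𝓝 0) := by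
    have h3 := ENNReal.Tendsto.const_mul (a := C)
      (ENNReal.tendsto_atTop_zero_of_tsum_ne_top htsum) (Or.inr hC)
    rw [mul_zero] at h3
    refine tendsto_of_tendsto_of_tendsto_of_le_of_le tendsto_const_nhds h3
      (fun _ => zero_le) fun n => ?_
    rw [← lintegral_const_mul _ (hmeas g)]
    refine lintegral_mono_ae ?_
    filter_upwards [haeQ] with ω hω
    by_cases hc : (Y n ω).card = 1
    · rw [h1 _ hc]; exact zero_le
    · simp only [hg, if_pos hc]
      exact hCle _ ⟨hω n, hc⟩
  have hval : ∑' k, ∫⁻ ω, g (Y k ω) ∂P = h c₀ := by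
    have h3 := (ENNReal.summable (f := fun k => ∫⁻ ω, g (Y k ω) ∂P)).hasSum.tendsto_sum_nat.add hlim
    simp only [hsum, add_zero] at h3
    exact tendsto_nhds_unique h3 tendsto_const_nhds
  obtain ⟨C', hC', hCle'⟩ := exists_le_mul (g := fun _ => 1) hθtop fun _ _ => ENNReal.one_ne_top
  -- `g` is bounded below on the configurations with several tokens, so its almost surely finite sum
  -- along the path rules out staying there forever.
  have hhit : ∀ᵐ ω ∂P, ∃ k, (Y k ω).card = 1 := by
    have h3 : ∀ᵐ ω ∂P, ∑' k, g (Y k ω) < ∞ := by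
      refine ae_lt_top (Measurable.tsum fun k => hmeas g) ?_
      rwa [lintegral_tsum fun k => (hmeas g).aemeasurable]
    filter_upwards [h3, haeQ] with ω hω hQω
    by_contra! hne
    have h4 : ∑' _ : ℕ, (1 : ℝ≥0∞) ≤ C' * ∑' k, g (Y k ω) := by
      rw [← ENNReal.tsum_mul_left]
      refine ENNReal.tsum_le_tsum fun k => ?_
      simp only [hg, if_pos (hne k)]
      exact hCle' _ ⟨hQω k, hne k⟩
    rw [ENNReal.tsum_const_eq_top_of_ne_zero one_ne_zero, top_le_iff] at h4
    exact ENNReal.mul_ne_top hC' hω.ne h4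
  have hind : ∀ k, Measurable fun ω => H k ω * if (Y k ω).card ≠ 1 then 1 else 0 := fun k =>
    (hH.measurable k).mul (hmeas fun c => if c.card ≠ 1 then 1 else 0)
  have hstab : ∀ᵐ ω ∂P, stabilizationTime time X ω =
      ∑' k, H k ω * if (Y k ω).card ≠ 1 then 1 else 0 := by
    filter_upwards [hhit, hX, hY.ae_transition hp, haeQ] with ω hω hXω htr hQω
    classical
    obtain ⟨t, ht⟩ := hXω
    have h5 : ∀ k, Nat.find hω ≤ k → (Y k ω).card = 1 := by
      intro k hk
      induction k, hk using Nat.le_induction with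
      | base => exact Nat.find_spec hω
      | succ k _ ih => exact (hQ _ _ (hQω k) (htr.2 k)).2 ih
    have h6 := ht.iInf_eq htime (B := fun c => c.card = 1) (Nat.find_spec hω)
      fun k hk => Nat.find_min hω hk
    rw [stabilizationTime, h6, ← tsum_lt_eq_sum_range]
    refine tsum_congr fun k => ?_
    by_cases hk : k < Nat.find hω
    · rw [if_pos hk, if_pos (Nat.find_min hω hk), mul_one]
    · rw [if_neg hk, if_neg (not_not.2 (h5 k (not_lt.1 hk))), mul_zero]
  refine ⟨⟨_, Measurable.tsum hind, hstab⟩, ?_⟩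
  rw [lintegral_congr_ae hstab, lintegral_tsum fun k => (hind k).aemeasurable, ← hval]
  refine tsum_congr fun k => ?_
  rw [hH.lintegral_mul hY.measurable (Nat.lt_succ_self k)
    (G := fun a => if (a k).card ≠ 1 then 1 else 0) fun a b hab => by
      simp only [hab k (Nat.le_succ k)]]
  refine lintegral_congr fun ω => ?_
  simp only [hg, mul_ite, mul_one, mul_zero]

end Herman

namespace Herman

/-! ### Collisions of tokens that do not interact -/

section Collision

set_option linter.unusedSectionVars false

variable {ι L : Type*} [Fintype ι] [Fintype L] [DecidableEq L]

/-- The distances travelled after the tokens in `A` have moved. -/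
def moved (x : L → ℕ) (A : Finset L) : L → ℕ := fun i => x i + if i ∈ A then 1 else 0

theorem moved_injective (x : L → ℕ) : Function.Injective (moved x) := by
  intro A B h
  ext i
  have := congrFun h i
  simp only [moved, add_right_inj] at this
  split_ifs at this <;> simp_all

/-- In the chain with transition probabilities `p`, the members of any given set of `k` tokens
move together with probability `φ (card L) k`. -/
structure IsFree (φ : ℕ → ℕ → ℝ) (p : (L → ℕ) → (L → ℕ) → ℝ) : Prop where
  nonneg : ∀ x y, 0 ≤ p x y
  weight : ∀ x A, p x (moved x A) = φ (Fintype.card L) A.card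
  support : ∀ x y, p x y ≠ 0 → ∃ A, moved x A = y

theorem IsFree.tsum_eq {φ : ℕ → ℕ → ℝ} {p : (L → ℕ) → (L → ℕ) → ℝ} (h : IsFree φ p)
    (x : L → ℕ) (g : (L → ℕ) → ℝ≥0∞) : ∑' y, ENNReal.ofReal (p x y) * g y =
      ∑ A : Finset L, ENNReal.ofReal (φ (Fintype.card L) A.card) * g (moved x A) := by
  rw [← (moved_injective x).tsum_eq, tsum_fintype]
  · simp only [h.weight]
  · intro y hy
    refine h.support x y fun h0 => hy ?_
    simp [h0]

/-- The change of the differences that have not reached `0` or `N` in the step from `x` to `y`. -/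
def diffUpdate (N : ℕ) (u v : ι → L) (ε : ι → ℤ) (x y : L → ℕ) : ι → ℤ := fun i =>
  if ε i = 0 ∨ ε i = N then ε i
  else ε i + ((y (v i) : ℤ) - x (v i)) - ((y (u i) : ℤ) - x (u i))

theorem diffUpdate_moved (N : ℕ) (u v : ι → L) (ε : ι → ℤ) (x : L → ℕ) (A : Finset L) :
    diffUpdate N u v ε x (moved x A) = stoppedStep N u v ε A := by
  ext i
  simp [diffUpdate, stoppedStep, moved]

/-- The differences along the path `a`, stopped when they reach `0` or `N`. -/
def stoppedDiff (N : ℕ) (u v : ι → L) (ε : ι → ℤ) (a : ℕ → L → ℕ) (n : ℕ) : ι → ℤ :=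
  status (diffUpdate N u v) ε a n

theorem adapted_stoppedDiff (N : ℕ) (u v : ι → L) (ε : ι → ℤ) (n : ℕ) :
    Adapted n fun a : ℕ → L → ℕ => stoppedDiff N u v ε a n :=
  adapted_status _ _ _

/-- The law of the set of moving tokens does not depend on the distances travelled, so the stopped
differences form a chain whose transition operator is `stepOp`. -/
theorem lintegral_stoppedDiff {φ : ℕ → ℕ → ℝ} {n₀ : ℕ} (hφ : Weights φ n₀)
    (hL : Fintype.card L ≤ n₀) {p : (L → ℕ) → (L → ℕ) → ℝ} (hp : IsFree φ p) {Ω : Type*}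
    [MeasurableSpace Ω] {P : Measure Ω} [IsProbabilityMeasure P] {x₀ : L → ℕ}
    {Y : ℕ → Ω → L → ℕ} (hY : IsMarkovChain p x₀ P Y) (N : ℕ) (u v : ι → L) (ε : ι → ℤ) (n : ℕ)
    {f : (ι → ℤ) → ℝ} (hf : ∀ x, 0 ≤ f x) :
    ∫⁻ ω, ENNReal.ofReal (f (stoppedDiff N u v ε (fun k => Y k ω) n)) ∂P =
      ENNReal.ofReal ((stepOp φ N u v)^[n] f ε) := by
  let T : ((ι → ℤ) → ℝ≥0∞) → (ι → ℤ) → ℝ≥0∞ := fun g ε =>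
    ∑ A : Finset L, ENNReal.ofReal (φ (Fintype.card L) A.card) * g (stoppedStep N u v ε A)
  have h1 := hY.lintegral_status hp.nonneg (diffUpdate N u v) ε T (fun g ε x => by
    rw [hp.tsum_eq x fun y => g (diffUpdate N u v ε x y)]
    simp only [diffUpdate_moved, T]) n fun x => ENNReal.ofReal (f x)
  have h2 : T^[n] (fun x => ENNReal.ofReal (f x)) =
      fun x => ENNReal.ofReal ((stepOp φ N u v)^[n] f x) := by
    clear h1
    induction n with
    | zero => rfl
    | succ n ih =>
      rw [Function.iterate_succ_apply', ih]
      ext x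
      rw [iterate_stepOp_succ, ENNReal.ofReal_sum_of_nonneg fun A _ =>
        mul_nonneg (hφ.nonneg _ hL _) (iterate_stepOp_nonneg hφ hL N u v hf n _)]
      exact Finset.sum_congr rfl fun A _ => (ENNReal.ofReal_mul (hφ.nonneg _ hL _)).symm
  rw [h2] at h1
  exact h1

/-- The current difference. -/
def currentDiff (u v : ι → L) (ε : ι → ℤ) (a : ℕ → L → ℕ) (n : ℕ) (i : ι) : ℤ :=
  ε i + a n (v i) - a n (u i)

theorem stoppedDiff_succ_of_hit {N : ℕ} {u v : ι → L} {ε : ι → ℤ} {a : ℕ → L → ℕ} {n : ℕ} {i : ι}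
    (h : stoppedDiff N u v ε a n i = 0 ∨ stoppedDiff N u v ε a n i = N) :
    stoppedDiff N u v ε a (n + 1) i = stoppedDiff N u v ε a n i := if_pos h

theorem stoppedDiff_of_hit {N : ℕ} {u v : ι → L} {ε : ι → ℤ} {a : ℕ → L → ℕ} {k n : ℕ}
    (hkn : k ≤ n) {i : ι}
    (h : stoppedDiff N u v ε a k i = 0 ∨ stoppedDiff N u v ε a k i = N) :
    stoppedDiff N u v ε a n i = stoppedDiff N u v ε a k i := by
  induction n, hkn using Nat.le_induction with
  | base => rfl
  | succ n _ ih => rw [stoppedDiff_succ_of_hit (by rwa [ih]), ih]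

theorem stoppedDiff_cases (N : ℕ) (u v : ι → L) (ε : ι → ℤ) {a : ℕ → L → ℕ} (ha : a 0 = 0)
    (n : ℕ) (i : ι) :
    ((∀ k ≤ n, currentDiff u v ε a k i ≠ 0 ∧ currentDiff u v ε a k i ≠ N) ∧
        stoppedDiff N u v ε a n i = currentDiff u v ε a n i) ∨
      ∃ τ ≤ n, (currentDiff u v ε a τ i = 0 ∨ currentDiff u v ε a τ i = N) ∧
        (∀ k < τ, currentDiff u v ε a k i ≠ 0 ∧ currentDiff u v ε a k i ≠ N) ∧
        stoppedDiff N u v ε a n i = currentDiff u v ε a τ i := by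
  induction n with
  | zero =>
    have h0 : stoppedDiff N u v ε a 0 i = currentDiff u v ε a 0 i := by
      simp [stoppedDiff, status, currentDiff, ha]
    by_cases h : currentDiff u v ε a 0 i = 0 ∨ currentDiff u v ε a 0 i = N
    · exact Or.inr ⟨0, le_rfl, h, fun k hk => absurd hk (Nat.not_lt_zero k), h0⟩
    · push Not at h
      exact Or.inl ⟨fun k hk => by rwa [Nat.le_zero.1 hk], h0⟩
  | succ n ih =>
    rcases ih with ⟨h1, h2⟩ | ⟨τ, hτ, h1, h2, h3⟩
    · have h3 : stoppedDiff N u v ε a (n + 1) i = currentDiff u v ε a (n + 1) i := by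
        have h4 := h1 n le_rfl
        rw [← h2] at h4
        have h5 : stoppedDiff N u v ε a (n + 1) i = stoppedDiff N u v ε a n i +
            ((a (n + 1) (v i) : ℤ) - a n (v i)) - ((a (n + 1) (u i) : ℤ) - a n (u i)) :=
          if_neg (by tauto)
        rw [h5, h2, currentDiff, currentDiff]
        ring
      by_cases h : currentDiff u v ε a (n + 1) i = 0 ∨ currentDiff u v ε a (n + 1) i = N
      · exact Or.inr ⟨n + 1, le_rfl, h, fun k hk => h1 k (Nat.le_of_lt_succ hk), h3⟩
      · push Not at h
        refine Or.inl ⟨fun k hk => ?_, h3⟩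
        rcases Nat.le_succ_iff.1 hk with hk | rfl
        · exact h1 k hk
        · exact h
    · refine Or.inr ⟨τ, by omega, h1, h2, ?_⟩
      rw [stoppedDiff_succ_of_hit (by rwa [h3]), h3]

/-- If every difference is eventually stopped, this happens at certain times `τ i`. -/
theorem exists_hitting_times {N : ℕ} {u v : ι → L} {ε : ι → ℤ} {a : ℕ → L → ℕ} (ha : a 0 = 0)
    {n : ℕ} (hn : ¬ Pending N (stoppedDiff N u v ε a n)) : ∃ τ : ι → ℕ, ∀ i,
      (currentDiff u v ε a (τ i) i = 0 ∨ currentDiff u v ε a (τ i) i = N) ∧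
      (∀ k < τ i, currentDiff u v ε a k i ≠ 0 ∧ currentDiff u v ε a k i ≠ N) ∧
      (∀ k, τ i ≤ k → stoppedDiff N u v ε a k i = currentDiff u v ε a (τ i) i) ∧
      ∀ k < τ i, stoppedDiff N u v ε a k i = currentDiff u v ε a k i := by
  have key : ∀ i, ∃ τ : ℕ,
      (currentDiff u v ε a τ i = 0 ∨ currentDiff u v ε a τ i = N) ∧
      (∀ k < τ, currentDiff u v ε a k i ≠ 0 ∧ currentDiff u v ε a k i ≠ N) ∧
      (∀ k, τ ≤ k → stoppedDiff N u v ε a k i = currentDiff u v ε a τ i) ∧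
      ∀ k < τ, stoppedDiff N u v ε a k i = currentDiff u v ε a k i := by
    intro i
    have hi : stoppedDiff N u v ε a n i = 0 ∨ stoppedDiff N u v ε a n i = N := by
      by_contra h
      push Not at h
      exact hn ⟨i, h⟩
    obtain ⟨h1, h2⟩ | ⟨τ, -, h1, h2, -⟩ := stoppedDiff_cases N u v ε ha n i
    · have := h1 n le_rfl
      rw [h2] at hi
      tauto
    refine ⟨τ, h1, h2, fun k hk => ?_, fun k hk => ?_⟩
    · obtain ⟨h4, -⟩ | ⟨τ', -, h4, h5, h6⟩ := stoppedDiff_cases N u v ε ha k i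
      · have := h4 τ hk
        tauto
      · rcases lt_trichotomy τ τ' with h | rfl | h
        · have := h5 τ h
          tauto
        · exact h6
        · have := h2 τ' h
          tauto
    · obtain ⟨-, h5⟩ | ⟨τ', h3, h4, -, -⟩ := stoppedDiff_cases N u v ε ha k i
      · exact h5
      · have := h2 τ' (by omega)
        tauto
  choose τ hτ using key
  exact ⟨τ, hτ⟩

end Collision

/-! ### Collisions of pairs along a single path -/

section Pairs

set_option linter.unusedSectionVars false

variable {N M : ℕ}

theorem meet_iff (z : Fin M → ℕ) (u v : Fin M) (δ : Dir) (d : Fin M → ℕ) :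
    Meet N z u v δ d ↔ ((z v : ℤ) - z u) + d v - d u = δ.target N := by
  cases δ <;> simp only [Meet, Dir.target] <;> omega

theorem exists_meet_iff (z : Fin M → ℕ) (u v : Fin M) (d : Fin M → ℕ) :
    (∃ δ, Meet N z u v δ d) ↔ ((z v : ℤ) - z u) + d v - d u = 0 ∨
      ((z v : ℤ) - z u) + d v - d u = N := by
  simp only [meet_iff]
  constructor
  · rintro ⟨_ | _, h⟩
    · exact Or.inl h
    · exact Or.inr h
  · rintro (h | h)
    · exact ⟨.down, h⟩
    · exact ⟨.up, h⟩

/-- The stopped differences of the pairs in `w`. -/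
def pairDiff (N : ℕ) (z : Fin M → ℕ) (w : Finset (Fin M × Fin M × Dir)) (a : ℕ → Fin M → ℕ)
    (n : ℕ) : w → ℤ :=
  stoppedDiff N (fun e : w => e.1.1) (fun e => e.1.2.1) (fun e => (z e.1.2.1 : ℤ) - z e.1.1) a n

/-- All pairs in `w` have collided in the prescribed directions. -/
def Reached (N : ℕ) (z : Fin M → ℕ) (w : Finset (Fin M × Fin M × Dir)) (a : ℕ → Fin M → ℕ)
    (n : ℕ) : Prop :=
  ∀ e : w, pairDiff N z w a n e = e.1.2.2.target N

theorem Reached.not_pending {z : Fin M → ℕ} {w : Finset (Fin M × Fin M × Dir)}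
    {a : ℕ → Fin M → ℕ} {n : ℕ} (h : Reached N z w a n) : ¬ Pending N (pairDiff N z w a n) :=
  not_pending_of_target h

theorem pairDiff_of_not_pending {z : Fin M → ℕ} {w : Finset (Fin M × Fin M × Dir)}
    {a : ℕ → Fin M → ℕ} {k n : ℕ} (hkn : k ≤ n) (h : ¬ Pending N (pairDiff N z w a k)) :
    pairDiff N z w a n = pairDiff N z w a k := by
  ext e
  refine stoppedDiff_of_hit hkn ?_
  by_contra h1
  push Not at h1
  exact h ⟨e, h1⟩

theorem Reached.mono {z : Fin M → ℕ} {w : Finset (Fin M × Fin M × Dir)}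
    {a : ℕ → Fin M → ℕ} {k n : ℕ} (hkn : k ≤ n) (h : Reached N z w a k) : Reached N z w a n := by
  intro e
  rw [pairDiff_of_not_pending hkn h.not_pending]
  exact h e

/-- On a path where `w` is eventually reached, differences that have all stopped have stopped at the
right ends. -/
theorem pending_iff_not_reached {z : Fin M → ℕ} {w : Finset (Fin M × Fin M × Dir)}
    {a : ℕ → Fin M → ℕ} (h : ∃ n, Reached N z w a n) (k : ℕ) :
    Pending N (pairDiff N z w a k) ↔ ¬ Reached N z w a k := by
  refine ⟨fun h1 h2 => h2.not_pending h1, fun h1 => ?_⟩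
  by_contra h2
  obtain ⟨n, hn⟩ := h
  rcases le_total n k with hnk | hkn
  · exact h1 (hn.mono hnk)
  · refine h1 fun e => ?_
    rw [← pairDiff_of_not_pending hkn h2]
    exact hn e

/-- Each pair meets first at the step when its difference hits 0 or N, and the partial sum of
holding times up to that step is its collision time. The partial sums are monotone, so the maximal
collision time runs to the last of these steps, that is, over exactly the steps with a pending pair.
-/
theorem collision_path {𝕋 Ω : Type*} [LinearOrder 𝕋] {time : 𝕋 → ℝ≥0∞} (htime : Monotone time)
    {z : Fin M → ℕ} {w : Finset (Fin M × Fin M × Dir)}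
    {D : 𝕋 → Ω → Fin M → ℕ} {ω : Ω} {Y : ℕ → Fin M → ℕ} {H : ℕ → ℝ≥0∞} {t : ℕ → 𝕋}
    (ht : TimeChange time (fun s => D s ω) Y H t) (hY : Y 0 = 0) {n : ℕ}
    (hn : ¬ Pending N (pairDiff N z w Y n)) :
    (ω ∈ allCollide N z D w ↔ ∃ k, Reached N z w Y k) ∧
      maxCollisionTime N time z D w ω =
        ∑' k, H k * (pendingInd N (pairDiff N z w Y k)).toNNReal := by
  classical
  obtain ⟨τ, hτ⟩ := exists_hitting_times hY hn
  have hcol : ∀ e : w, collisionTime N time z D e.1.1 e.1.2.1 ω =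
      ∑ k ∈ Finset.range (τ e), H k := by
    intro e
    obtain ⟨h1, h2, -, -⟩ := hτ e
    refine ht.iInf_eq htime (B := fun d => ∃ δ, Meet N z e.1.1 e.1.2.1 δ d) ?_ fun k hk h => ?_
    · rw [exists_meet_iff]; exact h1
    · rw [exists_meet_iff] at h
      have h3 := h2 k hk
      exact h.elim h3.1 h3.2
  have hev : ∀ e : w, ω ∈ collisionEvent N z D e.1.1 e.1.2.1 e.1.2.2 ↔
      currentDiff (fun e : w => e.1.1) (fun e => e.1.2.1)
        (fun e => (z e.1.2.1 : ℤ) - z e.1.1) Y (τ e) e = e.1.2.2.target N := by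
    intro e
    obtain ⟨h1, h2, -, -⟩ := hτ e
    have hno : ∀ s < t (τ e), ∀ δ, ¬ Meet N z e.1.1 e.1.2.1 δ (D s ω) := by
      intro s hs δ h
      obtain ⟨k, hk, hX⟩ := ht.before _ s hs
      have h3 := (exists_meet_iff z e.1.1 e.1.2.1 (Y k)).1 ⟨δ, hX ▸ h⟩
      have h4 := h2 k hk
      exact h3.elim h4.1 h4.2
    have hat : D (t (τ e)) ω = Y (τ e) := ht.eval _
    constructor
    · rintro ⟨s, hs, hs'⟩
      rcases lt_trichotomy s (t (τ e)) with h | rfl | h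
      · exact absurd hs (hno s h _)
      · rw [hat, meet_iff] at hs
        exact hs
      · obtain ⟨δ, hδ⟩ := (exists_meet_iff z e.1.1 e.1.2.1 (Y (τ e))).2 h1
        exact absurd (hat ▸ hδ) (hs' _ h δ)
    · intro h
      refine ⟨t (τ e), ?_, hno⟩
      rw [hat, meet_iff]
      exact h
  constructor
  · have h1 : ω ∈ allCollide N z D w ↔
        ∀ e : w, ω ∈ collisionEvent N z D e.1.1 e.1.2.1 e.1.2.2 := by
      simp only [allCollide, Set.mem_iInter, Subtype.forall]
    rw [h1]
    constructor
    · intro h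
      refine ⟨Finset.univ.sup τ, fun e => ?_⟩
      rw [← (hev e).1 (h e)]
      exact (hτ e).2.2.1 _ (Finset.le_sup (f := τ) (Finset.mem_univ e))
    · rintro ⟨k, hk⟩ e
      refine (hev e).2 ?_
      rw [← (hτ e).2.2.1 _ (le_max_right k (τ e))]
      exact (hk.mono (le_max_left k (τ e))) e
  · have hpend : ∀ k, Pending N (pairDiff N z w Y k) ↔ k < Finset.univ.sup τ := by
      intro k
      simp only [Finset.lt_sup_iff, Finset.mem_univ, true_and]
      refine exists_congr fun e => ?_
      obtain ⟨h1, h2, h3, h4⟩ := hτ e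
      constructor
      · rintro ⟨h5, h6⟩
        by_contra! h7
        unfold pairDiff at h5 h6
        rw [h3 k h7] at h5 h6
        tauto
      · intro h5
        unfold pairDiff
        rw [h4 k h5]
        exact h2 k h5
    have h1 : maxCollisionTime N time z D w ω =
        Finset.univ.sup fun e : w => ∑ k ∈ Finset.range (τ e), H k := by
      rw [maxCollisionTime, ← Finset.sup_attach]
      exact Finset.sup_congr rfl fun e _ => hcol e
    have h2 := Finset.apply_sup_eq_sup_comp_of_linearOrder (s := Finset.univ) (f := τ)
      (fun n => ∑ k ∈ Finset.range n, H k)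
      (fun a b hab => Finset.sum_le_sum_of_subset (Finset.range_mono hab)) (by simp)
    refine h1.trans (h2.symm.trans ?_)
    rw [← tsum_lt_eq_sum_range]
    refine tsum_congr fun k => ?_
    unfold pendingInd
    simp only [hpend]
    split_ifs <;> simp

end Pairs

end Herman

namespace Herman

/-! ### The expected collision times -/

section Times

variable {N M : ℕ} {𝕋 Ω : Type*} [LinearOrder 𝕋] [MeasurableSpace Ω]

theorem measurable_pairDiff {Y : ℕ → Ω → Fin M → ℕ}
    (hY : ∀ n x, MeasurableSet {ω | Y n ω = x}) (z : Fin M → ℕ)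
    (w : Finset (Fin M × Fin M × Dir)) (n : ℕ) {α : Type*} [MeasurableSpace α]
    (g : (w → ℤ) → α) : Measurable fun ω => g (pairDiff N z w (fun k => Y k ω) n) :=
  measurable_of_adapted hY (n := n) (G := fun a => g (pairDiff N z w a n)) fun a b hab =>
    congrArg g (adapted_stoppedDiff N _ _ _ n a b hab)

theorem measurableSet_reached {Y : ℕ → Ω → Fin M → ℕ}
    (hY : ∀ n x, MeasurableSet {ω | Y n ω = x}) (z : Fin M → ℕ)
    (w : Finset (Fin M × Fin M × Dir)) (n : ℕ) :
    MeasurableSet {ω | Reached N z w (fun k => Y k ω) n} :=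
  measurableSet_setOfPred.2 (measurable_pairDiff hY z w n fun x => ∀ e : w, x e = e.1.2.2.target N)

/-- Moments of the collision times of the pairs in `w`. -/
theorem lintegral_maxCollisionTime {time : 𝕋 → ℝ≥0∞} (htime : Monotone time) {P : Measure Ω}
    [IsProbabilityMeasure P] {φ : ℕ → ℕ → ℝ} {n₀ : ℕ} (hφ : Weights φ n₀) (h2 : 2 ≤ n₀)
    (hM : M ≤ n₀) {p : (Fin M → ℕ) → (Fin M → ℕ) → ℝ} (hp : IsFree φ p)
    {D : 𝕋 → Ω → Fin M → ℕ} {Y : ℕ → Ω → Fin M → ℕ} (hY : IsMarkovChain p 0 P Y)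
    {H : ℕ → Ω → ℝ≥0∞} {θ : ℝ≥0∞} (hH : IsTimed (fun _ => θ) P Y H)
    (hD : ∀ᵐ ω ∂P, ∃ t, TimeChange time (fun s => D s ω) (fun k => Y k ω) (fun k => H k ω) t)
    {z : Fin M → ℕ} {w : Finset (Fin M × Fin M × Dir)} (hne : ∀ e : w, e.1.1 ≠ e.1.2.1)
    (hbox : InBox N fun e : w => (z e.1.2.1 : ℤ) - z e.1.1) :
    NullMeasurableSet (allCollide N z D w) P ∧
      P (allCollide N z D w) = ENNReal.ofReal (pairingLimit φ N (fun i => (z i : ℤ)) w) ∧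
      AEMeasurable (maxCollisionTime N time z D w) P ∧
      ∫⁻ ω in allCollide N z D w, maxCollisionTime N time z D w ω ∂P =
        θ * ENNReal.ofReal (∑' k, (pairingLimit φ N (fun i => (z i : ℤ)) w -
          pairingProb φ N k (fun i => (z i : ℤ)) w)) := by
  classical
  have hL : Fintype.card (Fin M) ≤ n₀ := by simpa using hM
  set κ := pairingLimit φ N (fun i => (z i : ℤ)) w with hκ
  set q := fun k => pairingProb φ N k (fun i => (z i : ℤ)) w with hq
  have hlim : Tendsto q atTop (𝓝 κ) := tendsto_targetProb hφ hL N _ _ _ hbox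
  have hsub : ∀ k, 0 ≤ κ - q k := fun k => (targetLimit_sub hφ hL N k _ _ _ hbox).1
  have hsum : Summable fun k => κ - q k := summable_targetLimit_sub hφ h2 hL N hne _ hbox
  have hq0 : ∀ k, 0 ≤ q k := fun k => targetProb_nonneg hφ hL N k _ _ _ _
  set F : ℕ → Set Ω := fun k => {ω | Reached N z w (fun j => Y j ω) k} with hF
  have hFm : ∀ k, MeasurableSet (F k) := measurableSet_reached hY.measurable z w
  have hFmono : Monotone F := fun k n hkn ω hω => Reached.mono hkn hω
  have hPF : ∀ k, P (F k) = ENNReal.ofReal (q k) := by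
    intro k
    have h := lintegral_stoppedDiff hφ hL hp hY N (fun e : w => e.1.1) (fun e => e.1.2.1)
      (fun e => (z e.1.2.1 : ℤ) - z e.1.1) k
      (f := fun x => if ∀ e : w, x e = e.1.2.2.target N then 1 else 0)
      fun x => by split_ifs <;> simp
    rw [← lintegral_indicator_one (hFm k)]
    refine Eq.trans (lintegral_congr fun ω => ?_) (h.trans ?_)
    · rw [Set.indicator_apply]
      split_ifs with h5 h6 h6
      · simp
      · exact absurd h5 h6
      · exact absurd h6 h5
      · simp
    · simp only [hq, pairingProb, targetProb]
  have hPU : P (⋃ k, F k) = ENNReal.ofReal κ :=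
    tendsto_nhds_unique (tendsto_measure_iUnion_atTop hFmono)
      (((ENNReal.continuous_ofReal.tendsto κ).comp hlim).congr fun k => (hPF k).symm)
  have hUm : MeasurableSet (⋃ k, F k) := MeasurableSet.iUnion hFm
  -- The probability of never being decided is at most that of being pending at step `n`, which
  -- tends to 0 as the terms of a convergent series.
  have hpend : ∀ᵐ ω ∂P, ∃ n, ¬ Pending N (pairDiff N z w (fun k => Y k ω) n) := by
    have h1 : ∀ n, P {ω | ∀ n, Pending N (pairDiff N z w (fun k => Y k ω) n)} ≤
        ENNReal.ofReal ((stepOp φ N (fun e : w => e.1.1) (fun e => e.1.2.1))^[n] (pendingInd N)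
          fun e => (z e.1.2.1 : ℤ) - z e.1.1) := by
      intro n
      rw [← lintegral_stoppedDiff hφ hL hp hY N _ _ _ n (pendingInd_nonneg N)]
      have hm : MeasurableSet {ω | Pending N (pairDiff N z w (fun k => Y k ω) n)} :=
        measurableSet_setOfPred.2 (measurable_pairDiff hY.measurable z w n (Pending N))
      have hle : {ω | ∀ n, Pending N (pairDiff N z w (fun k => Y k ω) n)} ⊆
          {ω | Pending N (pairDiff N z w (fun k => Y k ω) n)} := fun ω hω =>
        (show ∀ n, Pending N (pairDiff N z w (fun k => Y k ω) n) from hω) n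
      refine (measure_mono hle).trans ?_
      rw [← lintegral_indicator_one hm]
      refine lintegral_mono fun ω => ?_
      rw [Set.indicator_apply]
      split_ifs with hω
      · unfold pendingInd
        split_ifs with h5
        · simp
        · exact absurd hω h5
      · exact zero_le
    have h3 := (summable_pending hφ h2 hL N hne _ hbox).tendsto_atTop_zero
    have h4 := ge_of_tendsto' ((ENNReal.continuous_ofReal.tendsto _).comp h3) h1
    rw [ENNReal.ofReal_zero, nonpos_iff_eq_zero] at h4
    rw [ae_iff]
    simpa using h4
  have hpath : ∀ᵐ ω ∂P, (ω ∈ allCollide N z D w ↔ ω ∈ ⋃ k, F k) ∧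
      maxCollisionTime N time z D w ω =
        ∑' k, H k ω * (pendingInd N (pairDiff N z w (fun j => Y j ω) k)).toNNReal := by
    filter_upwards [hpend, hD, hY.ae_transition hp.nonneg] with ω h3 h4 h5
    obtain ⟨n, hn⟩ := h3
    obtain ⟨t, ht⟩ := h4
    rw [Set.mem_iUnion]
    exact collision_path htime ht h5.1 hn
  have hset : allCollide N z D w =ᵐ[P] ⋃ k, F k := by
    filter_upwards [hpath] with ω hω
    exact propext hω.1
  have hmeas : ∀ k, Measurable fun ω =>
      H k ω * ((pendingInd N (pairDiff N z w (fun j => Y j ω) k)).toNNReal : ℝ≥0∞) := fun k =>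
    (hH.measurable k).mul (measurable_pairDiff hY.measurable z w k
      fun x => ((pendingInd N x).toNNReal : ℝ≥0∞))
  have hmax : maxCollisionTime N time z D w =ᵐ[P] fun ω =>
      ∑' k, H k ω * (pendingInd N (pairDiff N z w (fun j => Y j ω) k)).toNNReal := by
    filter_upwards [hpath] with ω hω
    exact hω.2
  refine ⟨hUm.nullMeasurableSet.congr hset.symm, by rw [measure_congr hset, hPU],
    ⟨_, Measurable.tsum hmeas, hmax⟩, ?_⟩
  -- The eventual collision event is not determined by any finite path. It is therefore approximated
  -- by `F n`, which depends on the path up to `n` only and so allows `H k` to be replaced by its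
  -- mean.
  have hdiff : ∀ k n, ∫⁻ ω in F n \ F k, H k ω ∂P = θ * P (F n \ F k) := by
    intro k n
    rcases le_or_gt n k with hnk | hkn
    · rw [Set.sdiff_eq_empty.2 (hFmono hnk)]
      simp
    · have hm := (hFm n).diff (hFm k)
      have h3 := hH.lintegral_mul hY.measurable hkn
        (G := fun a => if Reached N z w a n ∧ ¬ Reached N z w a k then 1 else 0) fun a b hab => by
          have h4 : pairDiff N z w a n = pairDiff N z w b n := adapted_stoppedDiff N _ _ _ n a b hab
          have h5 : pairDiff N z w a k = pairDiff N z w b k :=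
            adapted_stoppedDiff N _ _ _ k a b fun j hj => hab j (hj.trans hkn.le)
          have h6 : (Reached N z w a n ∧ ¬ Reached N z w a k) ↔
              (Reached N z w b n ∧ ¬ Reached N z w b k) := by simp only [Reached, h4, h5]
          exact if_congr h6 rfl rfl
      have h4 : ∀ f : Ω → ℝ≥0∞, ∫⁻ ω in F n \ F k, f ω ∂P = ∫⁻ ω, f ω *
          (if Reached N z w (fun j => Y j ω) n ∧ ¬ Reached N z w (fun j => Y j ω) k
            then 1 else 0) ∂P := by
        intro f
        rw [← lintegral_indicator hm]
        refine lintegral_congr fun ω => ?_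
        rw [Set.indicator_apply, mul_ite, mul_one, mul_zero]
        rfl
      rw [h4, h3, ← h4, setLIntegral_const]
  have hlimit : ∀ k, ∫⁻ ω in (⋃ n, F n) \ F k, H k ω ∂P = θ * ENNReal.ofReal (κ - q k) := by
    intro k
    have hmono : Monotone fun n => F n \ F k := fun a b hab =>
      Set.sdiff_subset_sdiff_left (hFmono hab)
    have h3 : P ((⋃ n, F n) \ F k) = ENNReal.ofReal (κ - q k) := by
      rw [measure_sdiff (Set.subset_iUnion F k) (hFm k).nullMeasurableSet (measure_ne_top P _),
        hPU, hPF, ENNReal.ofReal_sub _ (hq0 k)]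
    rw [← h3, Set.iUnion_sdiff, setLIntegral_iUnion_of_directed _ hmono.directed_le,
      hmono.measure_iUnion, ENNReal.mul_iSup]
    exact iSup_congr (hdiff k)
  rw [Measure.restrict_congr_set hset, lintegral_congr_ae (ae_restrict_of_ae hmax),
    lintegral_tsum fun k => (hmeas k).aemeasurable, ENNReal.ofReal_tsum_of_nonneg hsub hsum,
    ← ENNReal.tsum_mul_left]
  refine tsum_congr fun k => ?_
  rw [← hlimit, ← lintegral_indicator hUm, ← lintegral_indicator (hUm.diff (hFm k))]
  refine lintegral_congr fun ω => ?_
  by_cases hω : ω ∈ ⋃ n, F n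
  · rw [Set.indicator_of_mem hω, pendingInd]
    have h3 := pending_iff_not_reached (Set.mem_iUnion.1 hω) k
    by_cases hk : ω ∈ F k
    · rw [if_neg (by rw [h3]; exact not_not.2 hk), Set.indicator_of_notMem fun h => h.2 hk]
      simp
    · rw [if_pos (h3.2 hk), Set.indicator_of_mem (show ω ∈ _ \ _ from ⟨hω, hk⟩)]
      simp
  · rw [Set.indicator_of_notMem hω, Set.indicator_of_notMem fun h => hω h.1]

end Times

end Herman

namespace Herman

/-! ### The equation for the expected stabilization time -/

theorem tsum_ofReal_sum_ite_mul {α S : Type*} [Fintype S] [DecidableEq S] (s : Finset α)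
    (f : α → S) {a : α → ℝ} (ha : ∀ i ∈ s, 0 ≤ a i) (g : S → ℝ≥0∞) :
    ∑' y, ENNReal.ofReal (∑ i ∈ s, if f i = y then a i else 0) * g y =
      ∑ i ∈ s, ENNReal.ofReal (a i) * g (f i) := by
  rw [tsum_fintype]
  have h : ∀ y, ENNReal.ofReal (∑ i ∈ s, if f i = y then a i else 0) * g y =
      ∑ i ∈ s, if f i = y then ENNReal.ofReal (a i) * g (f i) else 0 := by
    intro y
    rw [ENNReal.ofReal_sum_of_nonneg fun i hi => by split_ifs <;> simp [ha i hi], Finset.sum_mul]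
    refine Finset.sum_congr rfl fun i _ => ?_
    split_ifs with h
    · rw [h]
    · simp
  simp only [h]
  rw [Finset.sum_comm]
  exact Finset.sum_congr rfl fun i _ => by simp

section Value

set_option linter.unusedSectionVars false

variable {N : ℕ} [NeZero N] {φ : ℕ → ℕ → ℝ} {n₀ : ℕ}

/-- The expected number of steps until only one token is left. -/
noncomputable def stepValue (φ : ℕ → ℕ → ℝ) (c : Config N) : ℝ := ∑' k, (1 - singleProb φ k c)

theorem stepValue_nonneg (hφ : Weights φ n₀) {c : Config N} (hc : c.card ≤ n₀) :
    0 ≤ stepValue φ c :=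
  tsum_nonneg fun k => sub_nonneg.2 (singleProb_le_one hφ k hc)

theorem stepValue_of_card_eq_one (hφ : Weights φ n₀) {c : Config N} (hc : c.card = 1) :
    stepValue φ c = 0 := by
  simp [stepValue, singleProb_of_card_eq_one hφ.consistent hφ.zero _ hc]

/-- First-step analysis: the term at time 0 is split off, and the recursion of `singleProb` is
summed over the remaining times. -/
theorem stepValue_eq (hφ : Weights φ n₀) (h2 : 2 ≤ n₀) {c : Config N} (hodd : Odd c.card)
    (hc : c.card ≤ n₀) : stepValue φ c = (if c.card ≠ 1 then 1 else 0) +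
      ∑ A ∈ c.powerset, φ c.card A.card * stepValue φ (pass c A) := by
  have hs : ∀ A ∈ c.powerset, Summable fun k => 1 - singleProb φ k (pass c A) := fun A hA =>
    summable_one_sub_singleProb hφ h2 (odd_card_pass (Finset.mem_powerset.1 hA) hodd)
      ((card_pass_le (Finset.mem_powerset.1 hA)).trans hc)
  rw [stepValue, (summable_one_sub_singleProb hφ h2 hodd hc).tsum_eq_zero_add]
  congr 1
  · rw [singleProb]
    split_ifs <;> simp_all
  · simp only [stepValue, ← tsum_mul_left]
    rw [← Summable.tsum_finsetSum fun A hA => (hs A hA).mul_left _]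
    refine tsum_congr fun k => ?_
    simp only [singleProb, mul_sub, Finset.sum_sub_distrib, mul_one]
    rw [hφ.consistent.sum_powerset hφ.zero]

end Value

/-! ### The formula for abstract time changes -/

section Formula

set_option linter.unusedSectionVars false

variable {N : ℕ} [NeZero N] {𝕋 Ω Ω' : Type*} [LinearOrder 𝕋] [MeasurableSpace Ω]
  [MeasurableSpace Ω']

theorem initialConfig_eq_oddConfig {M : ℕ} {z : Fin M → ℕ}
    (hz : Function.Injective fun i => ((z i : ℤ) : ZMod N)) :
    initialConfig N z = oddConfig N fun i => (z i : ℤ) := by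
  rw [oddConfig_eq_map hz, initialConfig, Finset.map_eq_image]
  congr 1
  ext i
  simp

theorem strictMono_positions {m : ℕ} {z : Fin (2 * m + 1) → ℕ} (hz : StrictMono z)
    (hzN : ∀ i, z i ∈ Finset.Icc 1 N) : (StrictMono fun i => (z i : ℤ)) ∧
      (z (Fin.last (2 * m)) : ℤ) < z 0 + N := by
  refine ⟨fun a b h => Int.ofNat_lt.2 (hz h), ?_⟩
  have h1 := Finset.mem_Icc.1 (hzN (Fin.last _))
  have h2 := Finset.mem_Icc.1 (hzN 0)
  omega

theorem card_initialConfig {m : ℕ} {z : Fin (2 * m + 1) → ℕ} (hz : StrictMono z)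
    (hzN : ∀ i, z i ∈ Finset.Icc 1 N) : (initialConfig N z).card = 2 * m + 1 := by
  obtain ⟨h1, h2⟩ := strictMono_positions hz hzN
  have h3 := injective_cast_of_strictMono h1 h2
  rw [initialConfig_eq_oddConfig h3, oddConfig_eq_map h3]
  simp

theorem expectedTimeFormula_of_timeChange {time : 𝕋 → ℝ≥0∞} (htime : Monotone time)
    {P : Measure Ω} {P' : Measure Ω'} [IsProbabilityMeasure P'] {φ : ℕ → ℕ → ℝ} {m : ℕ}
    (hm : 1 ≤ m) (hφ : Weights φ (2 * m + 1)) {z : Fin (2 * m + 1) → ℕ} (hz : StrictMono z)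
    (hzN : ∀ i, z i ∈ Finset.Icc 1 N) {θ : ℝ} (hθ : 0 ≤ θ) {X : 𝕋 → Ω → Config N}
    (hX : AEMeasurable (stabilizationTime time X) P)
    (hXval : ∫⁻ ω, stabilizationTime time X ω ∂P =
      ENNReal.ofReal (θ * stepValue φ (initialConfig N z)))
    {p : (Fin (2 * m + 1) → ℕ) → (Fin (2 * m + 1) → ℕ) → ℝ} (hp : IsFree φ p)
    {D : 𝕋 → Ω' → Fin (2 * m + 1) → ℕ} {Y : ℕ → Ω' → Fin (2 * m + 1) → ℕ}
    (hY : IsMarkovChain p 0 P' Y) {H : ℕ → Ω' → ℝ≥0∞}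
    (hH : IsTimed (fun _ => ENNReal.ofReal θ) P' Y H)
    (hD : ∀ᵐ ω ∂P', ∃ t,
      TimeChange time (fun s => D s ω) (fun k => Y k ω) (fun k => H k ω) t) :
    ExpectedTimeFormula N time z P X P' D := by
  obtain ⟨hp1, hpN⟩ := strictMono_positions hz hzN
  have h2 : 2 ≤ 2 * m + 1 := by omega
  have hcol := fun (w) (hw : w ∈ directedPairings (2 * m + 1)) =>
    lintegral_maxCollisionTime htime hφ h2 le_rfl hp hY hH hD (pairing_ne hw)
      (pairing_inBox hp1 hpN hw)
  have hcard := card_initialConfig hz hzN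
  have htsum : ∀ w ∈ directedPairings (2 * m + 1),
      0 ≤ ∑' k, (pairingLimit φ N (fun i => (z i : ℤ)) w -
        pairingProb φ N k (fun i => (z i : ℤ)) w) := fun w hw =>
    tsum_nonneg fun k => (targetLimit_sub hφ (by simp) N k _ _ _ (pairing_inBox hp1 hpN hw)).1
  have hpos : ∀ w ∈ directedPairings (2 * m + 1), P' (allCollide N z D w) ≠ 0 := by
    intro w hw
    rw [(hcol w hw).2.1]
    exact (ENNReal.ofReal_pos.2 (targetLimit_pos hφ (by simp) N (pairing_injective hw) _
      (pairing_difference_mem hp1 hpN hw))).ne'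
  have hcond : ∀ w ∈ directedPairings (2 * m + 1),
      ∫⁻ ω, maxCollisionTime N time z D w ω ∂P'[|allCollide N z D w] =
        (P' (allCollide N z D w))⁻¹ *
          ∫⁻ ω in allCollide N z D w, maxCollisionTime N time z D w ω ∂P' := by
    intro w hw
    rw [ProbabilityTheory.cond, lintegral_smul_measure, smul_eq_mul]
  refine ⟨⟨hX, by rw [hXval]; exact ENNReal.ofReal_ne_top⟩, fun w hw =>
    ⟨(hcol w hw).1, hpos w hw, ?_, ?_⟩, ?_⟩
  · exact (hcol w hw).2.2.1.mono_ac cond_absolutelyContinuous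
  · rw [hcond w hw, (hcol w hw).2.2.2]
    exact ENNReal.mul_ne_top (ENNReal.inv_ne_top.2 (hpos w hw))
      (ENNReal.mul_ne_top ENNReal.ofReal_ne_top ENNReal.ofReal_ne_top)
  · rw [mean, hXval, ENNReal.toReal_ofReal (mul_nonneg hθ (stepValue_nonneg hφ hcard.le)),
      stepValue, initialConfig_eq_oddConfig (injective_cast_of_strictMono hp1 hpN),
      tsum_one_sub_singleProb hφ h2 le_rfl hp1 hpN, Finset.mul_sum]
    refine Finset.sum_congr rfl fun w hw => ?_
    -- Conditional mean times probability is the integral over the event, already computed as θ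
    -- times the sum of the tails.
    have h3 : mean (P'[|allCollide N z D w]) (maxCollisionTime N time z D w) *
        P'.real (allCollide N z D w) = θ * ∑' k, (pairingLimit φ N (fun i => (z i : ℤ)) w -
          pairingProb φ N k (fun i => (z i : ℤ)) w) := by
      rw [mean, Measure.real, ← ENNReal.toReal_mul, hcond w hw, mul_comm, ← mul_assoc,
        ENNReal.mul_inv_cancel (hpos w hw) (measure_ne_top _ _), one_mul, (hcol w hw).2.2.2,
        ENNReal.toReal_mul, ENNReal.toReal_ofReal hθ, ENNReal.toReal_ofReal (htsum w hw)]
    rw [mul_assoc, h3]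
    ring

end Formula

/-! ### The synchronous protocol -/

section Sync

/-- The weights of the synchronous protocol. -/
noncomputable def syncWeight (r : ℝ) (n k : ℕ) : ℝ := r ^ k * (1 - r) ^ ((n : ℤ) - k)

variable {r : ℝ}

/-- With the integer exponent `n - k` the recursion holds also for k > n, where truncated
subtraction would break it. -/
theorem weights_sync (h0 : 0 < r) (h1 : r < 1) (n₀ : ℕ) : Weights (syncWeight r) n₀ := by
  have hs : 0 < 1 - r := by linarith
  refine ⟨fun n k => ?_, by simp [syncWeight], fun n _ k => ?_, fun n _ _ => ?_⟩
  · have h2 : ((n + 1 : ℕ) : ℤ) - k = n - k + 1 := by push_cast; ring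
    have h3 : ((n + 1 : ℕ) : ℤ) - (k + 1 : ℕ) = n - k := by push_cast; ring
    rw [syncWeight, syncWeight, syncWeight, h2, h3, zpow_add_one₀ hs.ne', pow_succ]
    ring
  · exact (mul_pos (pow_pos h0 _) (zpow_pos hs _)).le
  · exact mul_pos (pow_pos h0 _) (zpow_pos hs _)

theorem syncWeight_eq {α : Type*} [DecidableEq α] {c A : Finset α} (hA : A ⊆ c) :
    syncWeight r c.card A.card = r ^ A.card * (1 - r) ^ (c \ A).card := by
  have h := Finset.card_sdiff_add_card_eq_card hA
  have h1 : (c.card : ℤ) - A.card = ((c \ A).card : ℕ) := by omega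
  rw [syncWeight, h1, zpow_natCast]

theorem isFree_sync (h0 : 0 < r) (h1 : r < 1) (M : ℕ) :
    IsFree (syncWeight r) (freeSyncProb M r) := by
  have hs : 0 < 1 - r := by linarith
  refine ⟨fun x y => Finset.prod_nonneg fun i _ => ?_, fun x A => ?_, fun x y h => ?_⟩
  · split_ifs <;> linarith
  · have h2 : ∀ i, (if moved x A i = x i + 1 then r else if moved x A i = x i then 1 - r else 0) =
        if i ∈ A then r else 1 - r := by
      intro i
      unfold moved
      split_ifs <;> simp_all
    unfold freeSyncProb
    rw [Finset.prod_congr rfl fun i _ => h2 i, Finset.prod_ite, Finset.prod_const,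
      Finset.prod_const, ← Finset.card_univ, syncWeight_eq (Finset.subset_univ A)]
    congr 3 <;> ext <;> simp
  · refine ⟨Finset.univ.filter fun i => y i = x i + 1, ?_⟩
    ext i
    have h2 := Finset.prod_ne_zero_iff.1 h i (Finset.mem_univ i)
    simp only [moved, Finset.mem_filter, Finset.mem_univ, true_and]
    split_ifs at h2 ⊢ <;> simp_all

theorem isTimed_one {S Ω : Type*} [Countable S] [MeasurableSpace Ω] (P : Measure Ω)
    (Y : ℕ → Ω → S) : IsTimed (fun _ => 1) P Y fun _ _ => 1 :=
  ⟨fun _ => measurable_const, fun _ _ _ _ => by simp⟩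

theorem syncProb_nonneg (h0 : 0 < r) (h1 : r < 1) {N : ℕ} (c c' : Config N) :
    0 ≤ syncProb N r c c' :=
  Finset.sum_nonneg fun A _ => by
    have : 0 < 1 - r := by linarith
    split_ifs <;> positivity

theorem exists_pass_of_syncProb_ne_zero {N : ℕ} {c c' : Config N} (h : syncProb N r c c' ≠ 0) :
    ∃ A ⊆ c, pass c A = c' := by
  obtain ⟨A, hA, h1⟩ := Finset.exists_ne_zero_of_sum_ne_zero h
  exact ⟨A, Finset.mem_powerset.1 hA, by_contra fun h2 => h1 (if_neg h2)⟩

theorem odd_card_and_card_le_pass {N n₀ : ℕ} {c A : Config N} (hA : A ⊆ c)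
    (hc : Odd c.card ∧ c.card ≤ n₀) : (Odd (pass c A).card ∧ (pass c A).card ≤ n₀) ∧
      (c.card = 1 → (pass c A).card = 1) := by
  have h1 := odd_card_pass hA hc.1
  have h2 := card_pass_le hA
  refine ⟨⟨h1, h2.trans hc.2⟩, fun h3 => ?_⟩
  rw [Nat.odd_iff] at h1
  omega

theorem expectedTimeFormula_sync (h0 : 0 < r) (h1 : r < 1) {N : ℕ} [NeZero N] {m : ℕ} (hm : 1 ≤ m)
    {z : Fin (2 * m + 1) → ℕ} (hz : StrictMono z) (hzN : ∀ i, z i ∈ Finset.Icc 1 N)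
    {Ω Ω' : Type*} [MeasurableSpace Ω] [MeasurableSpace Ω'] {P : Measure Ω}
    [IsProbabilityMeasure P] {P' : Measure Ω'} [IsProbabilityMeasure P']
    {X : ℕ → Ω → Config N} {D : ℕ → Ω' → Fin (2 * m + 1) → ℕ}
    (hX : IsMarkovChain (syncProb N r) (initialConfig N z) P X)
    (hD : IsMarkovChain (freeSyncProb (2 * m + 1) r) 0 P' D) :
    ExpectedTimeFormula N (fun n : ℕ => (n : ℝ≥0∞)) z P X P' D := by
  have hφ := weights_sync h0 h1 (2 * m + 1)
  have htime : Monotone fun n : ℕ => (n : ℝ≥0∞) := Nat.mono_cast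
  have hcard := card_initialConfig hz hzN
  obtain ⟨hXm, hXval⟩ := lintegral_stabilizationTime htime (syncProb_nonneg h0 h1) hX
    (isTimed_one P X) (ae_of_all _ fun ω => ⟨id, timeChange_nat fun s => X s ω⟩)
    (Q := fun c => Odd c.card ∧ c.card ≤ 2 * m + 1)
    (h := fun c => ENNReal.ofReal (stepValue (syncWeight r) c))
    ⟨⟨m, hcard⟩, hcard.le⟩ (fun c c' hc h => by
      obtain ⟨A, hA, rfl⟩ := exists_pass_of_syncProb_ne_zero h
      exact odd_card_and_card_le_pass hA hc)
    (fun _ _ _ => one_ne_zero) (fun _ _ => ENNReal.ofReal_ne_top)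
    (fun c hc => by rw [stepValue_of_card_eq_one hφ hc, ENNReal.ofReal_zero])
    (fun c hc => by
      have hs : 0 < 1 - r := by linarith
      unfold syncProb
      rw [tsum_ofReal_sum_ite_mul _ _ fun A _ => by positivity,
        stepValue_eq hφ (by omega) hc.1 hc.2, ENNReal.ofReal_add (by split_ifs <;> simp)
        (Finset.sum_nonneg fun A hA => ?_), ENNReal.ofReal_sum_of_nonneg fun A hA => ?_]
      · congr 1
        · split_ifs <;> simp
        · refine Finset.sum_congr rfl fun A hA => ?_
          rw [← syncWeight_eq (Finset.mem_powerset.1 hA), ENNReal.ofReal_mul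
            (hφ.nonneg _ hc.2 _)]
      all_goals exact mul_nonneg (hφ.nonneg _ hc.2 _) (stepValue_nonneg hφ
        (odd_card_and_card_le_pass (Finset.mem_powerset.1 hA) hc).1.2))
  refine expectedTimeFormula_of_timeChange htime hm hφ hz hzN zero_le_one hXm
    (by rw [hXval, one_mul]) (isFree_sync h0 h1 _) hD (H := fun _ _ => 1)
    (by rw [ENNReal.ofReal_one]; exact isTimed_one P' D)
    (ae_of_all _ fun ω => ⟨id, timeChange_nat fun s => D s ω⟩)

end Sync

end Herman

namespace Herman

/-! ### The asynchronous protocol -/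

section Async

theorem Regular.of_exitRate_pos {S : Type*} {q : S → S → ℝ} {x₀ : S} {Q : S → Prop}
    (hq : ∀ x y, 0 ≤ q x y) (h0 : Q x₀) (hstep : ∀ x y, Q x → q x y ≠ 0 → Q y)
    (hpos : ∀ x, Q x → 0 < exitRate q x) : Regular q x₀ Q := by
  refine ⟨hq, h0, hstep, hpos, fun x hx => ?_⟩
  have hs : Summable (q x) := by
    by_contra h
    exact (hpos x hx).ne' (tsum_eq_zero_of_not_summable h)
  rw [← ENNReal.ofReal_tsum_of_nonneg (fun y => div_nonneg (hq x y) (hpos x hx).le)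
    (hs.div_const _), tsum_div_const]
  have h1 : (∑' y, q x y) / exitRate q x = 1 := div_self (hpos x hx).ne'
  rw [h1, ENNReal.ofReal_one]

/-- The weights of the asynchronous protocol with `M` tokens, uniformized to the rate with which
some of these tokens move. -/
noncomputable def asyncWeight (M n k : ℕ) : ℝ :=
  if k = 0 then 1 - n / M else if k = 1 then 1 / M else 0

/-- Consistency is an algebraic identity for all n, but for n > M the weight of standing still is
negative; hence the bound on the number of tokens in `Weights`. -/
theorem weights_async {M : ℕ} (hM : 0 < M) : Weights (asyncWeight M) M := by
  have h0 : (0 : ℝ) < M := by exact_mod_cast hM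
  refine ⟨fun n k => ?_, by simp [asyncWeight], fun n hn k => ?_, fun n _ _ => ?_⟩
  · rcases k with _ | _ | k
    · simp only [asyncWeight, if_true, Nat.cast_add, Nat.cast_one, add_div, zero_add, one_ne_zero,
        if_false]
      ring
    · simp [asyncWeight]
    · simp [asyncWeight]
  · have h1 : (n : ℝ) / M ≤ 1 := (div_le_one h0).2 (by exact_mod_cast hn)
    unfold asyncWeight
    split_ifs
    · linarith
    · positivity
    · rfl
  · simpa [asyncWeight] using hM

theorem sum_asyncWeight {α : Type*} [DecidableEq α] (M : ℕ) (c : Finset α) (f : Finset α → ℝ) :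
    ∑ A ∈ c.powerset, asyncWeight M c.card A.card * f A =
      (1 - c.card / M) * f ∅ + 1 / M * ∑ i ∈ c, f {i} := by
  have h1 : ∀ A : Finset α, asyncWeight M c.card A.card * f A =
      (if A = ∅ then (1 - c.card / M) * f ∅ else 0) +
        if A.card = 1 then 1 / M * f A else 0 := by
    intro A
    rcases eq_or_ne A ∅ with rfl | hA
    · simp [asyncWeight]
    · have := Finset.card_ne_zero.2 (Finset.nonempty_iff_ne_empty.2 hA)
      simp only [asyncWeight, this, hA, if_false]
      split_ifs <;> simp
  simp only [h1, Finset.sum_add_distrib]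
  congr 1
  · simp
  · rw [← Finset.sum_filter, ← Finset.powersetCard_eq_filter, Finset.powersetCard_one,
      Finset.sum_map, Finset.mul_sum]
    rfl

variable {lam : ℝ}

theorem add_single_eq_moved {M : ℕ} (x : Fin M → ℕ) (i : Fin M) :
    x + Pi.single i 1 = moved x {i} := by
  ext j
  simp [moved, Pi.single_apply]

theorem exitRate_freeAsyncRate (M : ℕ) (x : Fin M → ℕ) :
    exitRate (freeAsyncRate M lam) x = M * lam := by
  unfold exitRate freeAsyncRate
  have h : ∀ i, HasSum (fun y => if y = x + Pi.single i 1 then lam else 0) lam := fun i =>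
    hasSum_ite_eq (x + Pi.single i 1) lam
  rw [Summable.tsum_finsetSum fun i _ => (h i).summable,
    Finset.sum_congr rfl fun i _ => (h i).tsum_eq]
  simp

/-- With all M tokens present the weight of an idle step is 1 - M/M = 0, so the jump chain of the
free tokens has exactly the uniformized weights. -/
theorem isFree_async (hlam : 0 < lam) (M : ℕ) (hM : 0 < M) : IsFree (asyncWeight M)
    fun x y => freeAsyncRate M lam x y / exitRate (freeAsyncRate M lam) x := by
  have h0 : (0 : ℝ) < M := by exact_mod_cast hM
  refine ⟨fun x y => ?_, fun x A => ?_, fun x y h => ?_⟩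
  · rw [exitRate_freeAsyncRate]
    refine div_nonneg (Finset.sum_nonneg fun i _ => ?_) (by positivity)
    split_ifs <;> simp [hlam.le]
  · have h1 : ∀ i, moved x A = x + Pi.single i 1 ↔ A = {i} := fun i => by
      rw [add_single_eq_moved, (moved_injective x).eq_iff]
    simp only [exitRate_freeAsyncRate, freeAsyncRate, h1, Fintype.card_fin]
    by_cases hA : A.card = 1
    · obtain ⟨i, rfl⟩ := Finset.card_eq_one.1 hA
      simp only [Finset.singleton_inj, Finset.sum_ite_eq, Finset.mem_univ, if_true, asyncWeight,
        Finset.card_singleton, one_ne_zero, if_false]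
      field_simp
    · rw [Finset.sum_eq_zero fun i _ => if_neg fun h => hA (by rw [h, Finset.card_singleton])]
      unfold asyncWeight
      split_ifs <;> simp [h0.ne']
  · have h1 : freeAsyncRate M lam x y ≠ 0 := fun h2 => h (by simp only [h2, zero_div])
    obtain ⟨i, -, hi⟩ := Finset.exists_ne_zero_of_sum_ne_zero h1
    refine ⟨{i}, ?_⟩
    rw [← add_single_eq_moved]
    by_contra h2
    exact hi (if_neg fun h3 => h2 h3.symm)

theorem exitRate_asyncRate {N : ℕ} [NeZero N] (c : Config N) :
    exitRate (asyncRate N lam) c = c.card * lam := by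
  unfold exitRate asyncRate
  rw [tsum_fintype, Finset.sum_comm]
  simp

theorem asyncRate_nonneg (hlam : 0 < lam) {N : ℕ} (c c' : Config N) : 0 ≤ asyncRate N lam c c' :=
  Finset.sum_nonneg fun A _ => by split_ifs <;> simp [hlam.le]

theorem exists_pass_of_asyncRate_ne_zero {N : ℕ} {c c' : Config N}
    (h : asyncRate N lam c c' ≠ 0) : ∃ A ⊆ c, pass c A = c' := by
  obtain ⟨i, hi, h1⟩ := Finset.exists_ne_zero_of_sum_ne_zero h
  exact ⟨{i}, Finset.singleton_subset_iff.2 hi, by_contra fun h2 => h1 (if_neg h2)⟩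

/-- The first-step equation contains the idle term (1 - |c|/M) times the value at c itself; moving
it to the left and multiplying by M removes the idle steps. -/
theorem stepValue_async {N : ℕ} [NeZero N] {M : ℕ} (h2 : 2 ≤ M) {c : Config N}
    (hodd : Odd c.card) (hc : c.card ≤ M) : c.card * stepValue (asyncWeight M) c =
      (if c.card ≠ 1 then (M : ℝ) else 0) + ∑ i ∈ c, stepValue (asyncWeight M) (pass c {i}) := by
  have h0 : (0 : ℝ) < M := by exact_mod_cast (by omega : 0 < M)
  have h1 := stepValue_eq (weights_async (by omega : 0 < M)) h2 hodd hc
  rw [sum_asyncWeight M c fun A => stepValue (asyncWeight M) (pass c A),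
    show pass c ∅ = c by simp [pass]] at h1
  have h3 : c.card * stepValue (asyncWeight M) c / M =
      (if c.card ≠ 1 then 1 else 0) +
        1 / M * ∑ i ∈ c, stepValue (asyncWeight M) (pass c {i}) := by
    have h4 : c.card * stepValue (asyncWeight M) c / M =
      c.card / M * stepValue (asyncWeight M) c := by ring
    rw [h4]
    linarith
  rw [div_eq_iff h0.ne'] at h3
  rw [h3, add_mul, ite_mul, one_mul, zero_mul]
  congr 1
  field_simp

/-- Dividing the equation without idle steps by |c|Mλ gives the first-step equation of the true jump
chain, with mean holding time 1/(|c|λ). This undoes the uniformization. -/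
theorem ofReal_stepValue_async (hlam : 0 < lam) {N : ℕ} [NeZero N] {M : ℕ} (h2 : 2 ≤ M)
    {c : Config N} (hc : Odd c.card ∧ c.card ≤ M) :
    ENNReal.ofReal (1 / (M * lam) * stepValue (asyncWeight M) c) =
      (if c.card ≠ 1 then ENNReal.ofReal (1 / exitRate (asyncRate N lam) c) else 0) +
        ∑' c', ENNReal.ofReal (asyncRate N lam c c' / exitRate (asyncRate N lam) c) *
          ENNReal.ofReal (1 / (M * lam) * stepValue (asyncWeight M) c') := by
  have hM0 : (0 : ℝ) < M := by exact_mod_cast (by omega : 0 < M)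
  have hc0 : (0 : ℝ) < c.card := Nat.cast_pos.2 hc.1.pos
  have hnn : ∀ i ∈ c, 0 ≤ stepValue (asyncWeight M) (pass c {i}) := fun i hi =>
    stepValue_nonneg (weights_async (by omega))
      (odd_card_and_card_le_pass (Finset.singleton_subset_iff.2 hi) hc).1.2
  have h1 : ∀ c', asyncRate N lam c c' / exitRate (asyncRate N lam) c =
      ∑ i ∈ c, if pass c {i} = c' then 1 / (c.card : ℝ) else 0 := by
    intro c'
    rw [exitRate_asyncRate, asyncRate, Finset.sum_div]
    refine Finset.sum_congr rfl fun i _ => ?_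
    split_ifs
    · field_simp
    · rw [zero_div]
  have h3 := stepValue_async h2 hc.1 hc.2
  have h4 : 1 / (M * lam) * stepValue (asyncWeight M) c =
      (if c.card ≠ 1 then 1 / (c.card * lam) else 0) +
        ∑ i ∈ c, 1 / (c.card : ℝ) * (1 / (M * lam) * stepValue (asyncWeight M) (pass c {i})) := by
    have h5 : stepValue (asyncWeight M) c =
        (c.card * stepValue (asyncWeight M) c) / c.card := by field_simp
    have h6 : ∀ a b s : ℝ, 0 < a → 0 < b →
        1 / (b * lam) * ((b + s) / a) = 1 / (a * lam) + 1 / a * (1 / (b * lam) * s) := by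
      intro a b s ha hb
      field_simp
    rw [← Finset.mul_sum, ← Finset.mul_sum, h5, h3]
    split_ifs
    · exact h6 _ _ _ hc0 hM0
    · rw [zero_add, zero_add]
      ring
  simp only [h1]
  rw [tsum_ofReal_sum_ite_mul _ _ fun _ _ => by positivity, h4,
    ENNReal.ofReal_add (by split_ifs <;> positivity)
    (Finset.sum_nonneg fun i hi => ?_), ENNReal.ofReal_sum_of_nonneg fun i hi => ?_]
  · congr 1
    · rw [exitRate_asyncRate]
      split_ifs <;> simp
    · exact Finset.sum_congr rfl fun i hi => ENNReal.ofReal_mul (by positivity)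
  all_goals exact mul_nonneg (by positivity) (mul_nonneg (by positivity) (hnn i hi))

theorem expectedTimeFormula_async (hlam : 0 < lam) {N : ℕ} [NeZero N] {m : ℕ} (hm : 1 ≤ m)
    {z : Fin (2 * m + 1) → ℕ} (hz : StrictMono z) (hzN : ∀ i, z i ∈ Finset.Icc 1 N)
    {Ω Ω' : Type*} [MeasurableSpace Ω] [MeasurableSpace Ω'] {P : Measure Ω}
    [IsProbabilityMeasure P] {P' : Measure Ω'} [IsProbabilityMeasure P']
    {X : ℝ≥0 → Ω → Config N} {D : ℝ≥0 → Ω' → Fin (2 * m + 1) → ℕ}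
    (hX : IsJumpProcess (asyncRate N lam) (initialConfig N z) P X)
    (hD : IsJumpProcess (freeAsyncRate (2 * m + 1) lam) 0 P' D) :
    ExpectedTimeFormula N (fun t : ℝ≥0 => (t : ℝ≥0∞)) z P X P' D := by
  obtain ⟨Y, H, hY, hH, hstart, hlaw, hpath⟩ := hX
  obtain ⟨Y', H', hY', hH', hstart', hlaw', hpath'⟩ := hD
  have hX : IsJumpData (asyncRate N lam) (initialConfig N z) P Y H := ⟨hY, hH, hstart, hlaw⟩
  have hD : IsJumpData (freeAsyncRate (2 * m + 1) lam) 0 P' Y' H' := ⟨hY', hH', hstart', hlaw'⟩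
  have hM0 : (0 : ℝ) < (2 * m + 1 : ℕ) := by exact_mod_cast (by omega : 0 < 2 * m + 1)
  have hφ := weights_async (by omega : 0 < 2 * m + 1)
  have htime : Monotone fun t : ℝ≥0 => (t : ℝ≥0∞) := ENNReal.coe_mono
  have hcard := card_initialConfig hz hzN
  have hrX : Regular (asyncRate N lam) (initialConfig N z)
      fun c => Odd c.card ∧ c.card ≤ 2 * m + 1 := by
    refine Regular.of_exitRate_pos (asyncRate_nonneg hlam) ⟨⟨m, hcard⟩, hcard.le⟩
      (fun c c' hc h => ?_) fun c hc => ?_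
    · obtain ⟨A, hA, rfl⟩ := exists_pass_of_asyncRate_ne_zero h
      exact (odd_card_and_card_le_pass hA hc).1
    · rw [exitRate_asyncRate]
      exact mul_pos (Nat.cast_pos.2 hc.1.pos) hlam
  have hrD : Regular (freeAsyncRate (2 * m + 1) lam) 0 fun _ => True := by
    refine Regular.of_exitRate_pos (fun x y => Finset.sum_nonneg fun i _ => ?_) trivial
      (fun _ _ _ _ => trivial) fun x _ => ?_
    · split_ifs <;> simp [hlam.le]
    · rw [exitRate_freeAsyncRate]
      exact mul_pos hM0 hlam
  set θ : ℝ := 1 / ((2 * m + 1 : ℕ) * lam) with hθ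
  have hθ0 : 0 ≤ θ := by positivity
  have htX : ∀ᵐ ω ∂P, ∃ t, TimeChange (fun t : ℝ≥0 => (t : ℝ≥0∞)) (fun s => X s ω)
      (fun k => Y k ω) (fun k => (H k ω : ℝ≥0∞)) t := by
    filter_upwards [hpath, hX.ae_holding_pos hrX] with ω h1 h2
    exact ⟨_, timeChange_nnreal h2 h1⟩
  have htD : ∀ᵐ ω ∂P', ∃ t, TimeChange (fun t : ℝ≥0 => (t : ℝ≥0∞)) (fun s => D s ω)
      (fun k => Y' k ω) (fun k => (H' k ω : ℝ≥0∞)) t := by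
    filter_upwards [hpath', hD.ae_holding_pos hrD] with ω h1 h2
    exact ⟨_, timeChange_nnreal h2 h1⟩
  have htimed := hD.isTimed hrD
  simp only [exitRate_freeAsyncRate] at htimed
  obtain ⟨hXm, hXval⟩ := lintegral_stabilizationTime htime
    (fun c c' => div_nonneg (asyncRate_nonneg hlam c c')
      (tsum_nonneg fun y => asyncRate_nonneg hlam c y))
    (hX.isMarkovChain hrX) (hX.isTimed hrX) htX
    (Q := fun c => Odd c.card ∧ c.card ≤ 2 * m + 1)
    (h := fun c => ENNReal.ofReal (θ * stepValue (asyncWeight (2 * m + 1)) c))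
    ⟨⟨m, hcard⟩, hcard.le⟩ (fun c c' hc h => by
      obtain ⟨A, hA, rfl⟩ := exists_pass_of_asyncRate_ne_zero (c := c) (c' := c') (lam := lam)
        fun h1 => h (by rw [h1, zero_div])
      exact odd_card_and_card_le_pass hA hc)
    (fun c hc _ => (ENNReal.ofReal_pos.2 (one_div_pos.2 (hrX.exitRate_pos c hc))).ne')
    (fun _ _ => ENNReal.ofReal_ne_top)
    (fun c hc => by rw [stepValue_of_card_eq_one hφ hc, mul_zero, ENNReal.ofReal_zero])
    (fun c hc => ofReal_stepValue_async hlam (by omega) hc)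
  exact expectedTimeFormula_of_timeChange htime hm hφ hz hzN hθ0 hXm hXval
    (isFree_async hlam _ (by omega)) (hD.isMarkovChain hrD) htimed htD

end Async

end Herman

/-! ### The theorem for both protocols -/

theorem mainTheorem5 (N M : ℕ) (hN : Odd N) (hM : Odd M) (hM3 : 3 ≤ M)
    (z : Fin M → ℕ) (hz : StrictMono z) (hzN : ∀ i, z i ∈ Finset.Icc 1 N)
    {Ω Ω' : Type*} [MeasurableSpace Ω] [MeasurableSpace Ω']
    (P : Measure Ω) [IsProbabilityMeasure P] (P' : Measure Ω') [IsProbabilityMeasure P'] :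
    (∀ r : ℝ, 0 < r → r < 1 →
      ∀ (X : ℕ → Ω → Herman.Config N) (D : ℕ → Ω' → Fin M → ℕ),
        Herman.IsMarkovChain (Herman.syncProb N r) (Herman.initialConfig N z) P X →
        Herman.IsMarkovChain (Herman.freeSyncProb M r) 0 P' D →
        Herman.ExpectedTimeFormula N (fun n : ℕ => (n : ℝ≥0∞)) z P X P' D) ∧
    (∀ lam : ℝ, 0 < lam →
      ∀ (X : ℝ≥0 → Ω → Herman.Config N) (D : ℝ≥0 → Ω' → Fin M → ℕ),
        Herman.IsJumpProcess (Herman.asyncRate N lam) (Herman.initialConfig N z) P X →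
        Herman.IsJumpProcess (Herman.freeAsyncRate M lam) 0 P' D →
        Herman.ExpectedTimeFormula N (fun t : ℝ≥0 => (t : ℝ≥0∞)) z P X P' D) := by
  have : NeZero N := ⟨hN.pos.ne'⟩
  obtain ⟨m, rfl⟩ := hM
  have hm : 1 ≤ m := by omega
  exact ⟨fun r h0 h1 X D hX hD => Herman.expectedTimeFormula_sync h0 h1 hm hz hzN hX hD,
    fun lam hlam X D hX hD => Herman.expectedTimeFormula_async hlam hm hz hzN hX hD⟩
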